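/- Let $r,s,t\in\mathbb C$ be such that $0,1,r,s,t$ are pairwise distinct, and let $X$ be the compact connected Riemann surface of genus $2$ given in an affine chart by $y^2=F(x)$ with $F(x)=x(x-1)(x-r)(x-s)(x-t)$, with one point $(\infty,\infty)$ added at infinity. Let $\iota:(x,y)\mapsto(x,-y)$ be the hyperelliptic involution, $\pi:(x,y)\mapsto x$ the projection $X\to\mathbb P^1$, and $W\subset X$ the set of Weierstrass points, i.e. of fixed points of $\iota$; put $\underline W=\pi(W)$. Let $E\to X$ be a holomorphic vector bundle of rank $2$ with $\det E\cong\mathcal O_X$, and let $h:E\to\iota^*E$ be an isomorphism of bundles such that $\iota^*h\circ h=\mathrm{id}_E$ and such that, for every $w\in W$, the induced automorphism of the fibre $E_w$ has the two eigenvalues $+1$ and $-1$. *Notation.* For each sign $\pm$, let $\boldsymbol p^\pm=(\boldsymbol p^\pm_w)_{w\in W}$ be the family of $\pm1$-eigenspaces $\boldsymbol p^{\pm}_w\subset E_w$ of $h$. The *hyperelliptic descent* $\underline E^\pm$ is the vector bundle on $\mathbb P^1$ whose sheaf of sections is the $\mathcal O_{\mathbb P^1}$-submodule of $\pi_*E$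 consisting of the sections $\sigma$ with $h\circ\sigma=\pm\,\iota^*\sigma$. For $w\in W$, the natural direction $\underline{\boldsymbol p}^\pm_{\pi(w)}\subset\underline E^\pm_{\pi(w)}$ is the set of values at $\pi(w)$ of those local sections of $\underline E^\pm$ that vanish at $w$ when viewed as sections of $E$. For a rank $2$ bundle $G$ on $X$ with lines $\boldsymbol q_w\subset G_w$ $(w\in W)$, the positive elementary transform $\mathrm{elm}^+_W(G,\boldsymbol q)$ is the bundle whose sections over an open set $U$ are the holomorphic sections of $G$ over $U\setminus W$ having at each $w\in U\cap W$ at most a simple pole, with polar part in $\boldsymbol q_w$; it carries over each $w\in W$ the direction which is the image of $G_w$. **Proposition.** The set $W$ has exactly six points. For each sign $\pm$, the hyperelliptic descent $\underline E^\pm$ exists as a holomorphic vector bundle of rank $2$ on $\mathbb P^1$, its determinant is $\det\underline E^\pm\cong\mathcal O_{\mathbb P^1}(-3)$, the spaces $\boldsymbol p^\pm_w$ and $\underline{\boldsymbol p}^\pm_{\pi(w)}$ are one-dimensional for all $w\in W$ (so that $\boldsymbol p^\pm$ and $\underline{\boldsymbol p}^\pm$ are quasi-parabolic structures with supports $W$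 and $\underline W$), and $$(E,\boldsymbol p^\pm)\;\cong\;\mathrm{elm}^+_W\bigl(\pi^*(\underline E^\pm,\underline{\boldsymbol p}^\pm)\bigr),$$ that is, $(E,\boldsymbol p^\pm)$ is obtained from $\pi^*(\underline E^\pm,\underline{\boldsymbol p}^\pm)$ by six positive elementary transformations, one over each Weierstrass point, given by the quasi-parabolic directions. The isomorphism can be chosen such that, over $X\setminus W$, it identifies a section $\sigma$ of $\underline E^\pm$, viewed as a section of $E$, with the section $\pi^*\sigma$ of $\pi^*\underline E^\pm$. -/

import Mathlib

open scoped Manifold ContDiff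
open Set TopologicalSpace

universe u u' v v' w

/-! ### The Riemann sphere `ℙ¹ = ℂ ∪ {∞}` as a complex manifold -/

/-- The inversion `x ↦ 1 / x` of `ℂ ∪ {∞}`. -/
noncomputable def sphereInv (p : OnePoint ℂ) : OnePoint ℂ :=
  p.elim ((0 : ℂ) : OnePoint ℂ) fun x => if x = 0 then OnePoint.infty else ((x⁻¹ : ℂ) : OnePoint ℂ)

theorem sphereInv_infty : sphereInv OnePoint.infty = ((0 : ℂ) : OnePoint ℂ) := rfl

theorem sphereInv_zero : sphereInv ((0 : ℂ) : OnePoint ℂ) = OnePoint.infty := by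
  simp [sphereInv]

theorem sphereInv_coe {x : ℂ} (hx : x ≠ 0) :
    sphereInv (x : OnePoint ℂ) = ((x⁻¹ : ℂ) : OnePoint ℂ) := by
  simp [sphereInv, hx]

theorem sphereInv_sphereInv (p : OnePoint ℂ) : sphereInv (sphereInv p) = p := by
  induction p using OnePoint.rec with
  | infty => rw [sphereInv_infty, sphereInv_zero]
  | coe x =>
    by_cases hx : x = 0
    · subst hx; rw [sphereInv_zero, sphereInv_infty]
    · rw [sphereInv_coe hx, sphereInv_coe (inv_ne_zero hx), inv_inv]

theorem continuous_sphereInv : Continuous sphereInv := by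
  rw [continuous_iff_continuousAt]
  intro p
  induction p using OnePoint.rec with
  | infty =>
    rw [OnePoint.continuousAt_infty', sphereInv_infty, Filter.coclosedCompact_eq_cocompact,
      ← Metric.cobounded_eq_cocompact]
    have h1 : Filter.Tendsto (fun x : ℂ => ((x⁻¹ : ℂ) : OnePoint ℂ)) (Bornology.cobounded ℂ)
        (nhds ((0 : ℂ) : OnePoint ℂ)) :=
      (OnePoint.continuous_coe.tendsto (0 : ℂ)).comp Filter.tendsto_inv₀_cobounded
    refine h1.congr' ?_
    filter_upwards [Bornology.eventually_ne_cobounded (0 : ℂ)] with x hx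
    exact (sphereInv_coe hx).symm
  | coe x =>
    rw [OnePoint.continuousAt_coe]
    by_cases hx : x = 0
    · subst hx
      rw [continuousAt_iff_punctured_nhds]
      simp only [Function.comp_apply, sphereInv_zero]
      have h1 : Filter.Tendsto (fun x : ℂ => ((x⁻¹ : ℂ) : OnePoint ℂ)) (nhdsWithin 0 {0}ᶜ)
          (nhds (OnePoint.infty : OnePoint ℂ)) := by
        refine OnePoint.tendsto_coe_infty.comp ?_
        rw [Filter.coclosedCompact_eq_cocompact, ← Metric.cobounded_eq_cocompact]
        exact Filter.tendsto_inv₀_nhdsNE_zero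
      refine h1.congr' ?_
      filter_upwards [self_mem_nhdsWithin] with x hx
      exact (sphereInv_coe hx).symm
    · have h1 : ContinuousAt (fun x : ℂ => ((x⁻¹ : ℂ) : OnePoint ℂ)) x :=
        OnePoint.continuous_coe.continuousAt.comp (continuousAt_inv₀ hx)
      refine h1.congr ?_
      filter_upwards [isOpen_ne.mem_nhds hx] with y hy
      exact (sphereInv_coe hy).symm

noncomputable def sphereInvHomeomorph : OnePoint ℂ ≃ₜ OnePoint ℂ where
  toFun := sphereInv
  invFun := sphereInv
  left_inv := sphereInv_sphereInv
  right_inv := sphereInv_sphereInv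
  continuous_toFun := continuous_sphereInv
  continuous_invFun := continuous_sphereInv

/-- The affine coordinate `x` on `ℙ¹ ∖ {∞}`. -/
noncomputable def sphereChartZero : OpenPartialHomeomorph (OnePoint ℂ) ℂ :=
  (OnePoint.isOpenEmbedding_coe.toOpenPartialHomeomorph ((↑) : ℂ → OnePoint ℂ)).symm

/-- The affine coordinate `1 / x` on `ℙ¹ ∖ {0}`. -/
noncomputable def sphereChartInfty : OpenPartialHomeomorph (OnePoint ℂ) ℂ :=
  sphereInvHomeomorph.transOpenPartialHomeomorph sphereChartZero

theorem sphereChartZero_source : sphereChartZero.source = {OnePoint.infty}ᶜ := by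
  simp [sphereChartZero, ← OnePoint.compl_infty]

theorem sphereChartZero_target : sphereChartZero.target = univ := by
  simp [sphereChartZero]

theorem sphereChartZero_symm_apply (x : ℂ) : sphereChartZero.symm x = (x : OnePoint ℂ) := rfl

theorem sphereChartZero_coe (x : ℂ) : sphereChartZero (x : OnePoint ℂ) = x := by
  have := sphereChartZero.right_inv (x := x) (by rw [sphereChartZero_target]; trivial)
  rwa [sphereChartZero_symm_apply] at this

theorem sphereChartInfty_apply (p : OnePoint ℂ) :
    sphereChartInfty p = sphereChartZero (sphereInv p) := rfl

theorem sphereChartInfty_symm_apply (x : ℂ) :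
    sphereChartInfty.symm x = sphereInv (x : OnePoint ℂ) := rfl

theorem sphereChartInfty_source :
    sphereChartInfty.source = {((0 : ℂ) : OnePoint ℂ)}ᶜ := by
  ext p
  have : p ∈ sphereChartInfty.source ↔ sphereInv p ∈ sphereChartZero.source := Iff.rfl
  rw [this, sphereChartZero_source, mem_compl_singleton_iff, mem_compl_singleton_iff, not_iff_not]
  constructor
  · intro h
    rw [← sphereInv_sphereInv p, h, sphereInv_infty]
  · rintro rfl
    exact sphereInv_zero

noncomputable instance sphereChartedSpace : ChartedSpace ℂ (OnePoint ℂ) where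
  atlas := {sphereChartZero, sphereChartInfty}
  chartAt p := p.elim sphereChartInfty fun _ => sphereChartZero
  mem_chart_source p := by
    induction p using OnePoint.rec with
    | infty =>
      change OnePoint.infty ∈ sphereChartInfty.source
      rw [sphereChartInfty_source]
      simp
    | coe x =>
      change (x : OnePoint ℂ) ∈ sphereChartZero.source
      rw [sphereChartZero_source]
      simp
  chart_mem_atlas p := by
    induction p using OnePoint.rec with
    | infty => exact Or.inr rfl
    | coe x => exact Or.inl rfl

instance sphereIsManifold : IsManifold 𝓘(ℂ) ω (OnePoint ℂ) := by
  have hinv : ContDiffOn ℂ ω (fun x : ℂ => x⁻¹) {0}ᶜ := fun x hx =>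
    (contDiffAt_inv ℂ hx).contDiffWithinAt
  apply isManifold_of_contDiffOn
  rintro e e' (rfl | rfl) (rfl | rfl)
  · refine contDiffOn_id.congr ?_
    intro x _
    simp [sphereChartZero_symm_apply, sphereChartZero_coe]
  · refine (hinv.mono ?_).congr ?_
    · intro x hx
      have hx' : (x : OnePoint ℂ) ∈ sphereChartInfty.source := by
        simpa [sphereChartZero_symm_apply, sphereChartZero_target] using hx
      rw [sphereChartInfty_source] at hx'
      simpa using hx'
    · intro x hx
      have hx' : (x : OnePoint ℂ) ∈ sphereChartInfty.source := by
        simpa [sphereChartZero_symm_apply, sphereChartZero_target] using hx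
      rw [sphereChartInfty_source] at hx'
      have h0 : x ≠ 0 := by simpa using hx'
      simp [sphereChartZero_symm_apply, sphereChartInfty_apply, sphereInv_coe h0,
        sphereChartZero_coe]
  · have key : ∀ x : ℂ, sphereInv (x : OnePoint ℂ) ∈ sphereChartZero.source → x ≠ 0 := by
      rintro x hx rfl
      rw [sphereInv_zero, sphereChartZero_source] at hx
      exact hx rfl
    refine (hinv.mono ?_).congr ?_
    · intro x hx
      refine key x ?_
      have h2 := hx.1
      simp only [OpenPartialHomeomorph.trans_toPartialEquiv, mfld_simps,
        sphereChartInfty_symm_apply] at h2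
      exact h2.2
    · intro x hx
      have h2 := hx.1
      simp only [OpenPartialHomeomorph.trans_toPartialEquiv, mfld_simps,
        sphereChartInfty_symm_apply] at h2
      simp [sphereChartInfty_symm_apply, sphereInv_coe (key x h2.2), sphereChartZero_coe]
  · refine contDiffOn_id.congr ?_
    intro x _
    simp [sphereChartInfty_symm_apply, sphereChartInfty_apply, sphereInv_sphereInv,
      sphereChartZero_coe]

/-! ### Holomorphic vector bundles on one-dimensional complex manifolds -/

section VectorBundles


/-- A holomorphic vector bundle of rank `n` on the one-dimensional complex manifold `B`. -/
structure HolBundle (n : ℕ) (B : Type u) [TopologicalSpace B] [ChartedSpace ℂ B] where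
  fiber : B → Type v
  [addCommGroup : ∀ b, AddCommGroup (fiber b)]
  [module : ∀ b, Module ℂ (fiber b)]
  [topTotal : TopologicalSpace (Bundle.TotalSpace (Fin n → ℂ) fiber)]
  [topFiber : ∀ b, TopologicalSpace (fiber b)]
  [fiberBundle : FiberBundle (Fin n → ℂ) fiber]
  [vectorBundle : VectorBundle ℂ (Fin n → ℂ) fiber]
  [holomorphic : ContMDiffVectorBundle ω (Fin n → ℂ) fiber 𝓘(ℂ)]

attribute [instance] HolBundle.addCommGroup HolBundle.module HolBundle.topTotal
  HolBundle.topFiber HolBundle.fiberBundle HolBundle.vectorBundle HolBundle.holomorphic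

namespace HolBundle

variable {n : ℕ} {B : Type u} [TopologicalSpace B] [ChartedSpace ℂ B]

/-- The total space of a holomorphic vector bundle. -/
abbrev Total (E : HolBundle.{u, v} n B) : Type (max u v) :=
  Bundle.TotalSpace (Fin n → ℂ) E.fiber

/-- A family of vectors `s p ∈ E_p`, for `p` in the open set `U`, is a holomorphic section. -/
def IsHolSection (E : HolBundle.{u, v} n B) (U : Opens B) (s : ∀ p : U, E.fiber p) : Prop :=
  ContMDiff 𝓘(ℂ) (𝓘(ℂ).prod 𝓘(ℂ, Fin n → ℂ)) ω (fun p : U => (⟨p, s p⟩ : E.Total))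

theorem isHolSection_iff (E : HolBundle.{u, v} n B) (U : Opens B) (s : ∀ p : U, E.fiber p) :
    E.IsHolSection U s ↔ ∀ p₀ : U, ContMDiffAt 𝓘(ℂ) 𝓘(ℂ, Fin n → ℂ) ω
      (fun p : U => (trivializationAt (Fin n → ℂ) E.fiber (p₀ : B) ⟨p, s p⟩).2) p₀ := by
  refine forall_congr' fun p₀ => ?_
  rw [Bundle.contMDiffAt_totalSpace]
  exact ⟨fun h => h.2, fun h => ⟨contMDiff_subtype_val p₀, h⟩⟩

theorem eventually_mem_baseSet (E : HolBundle.{u, v} n B) (U : Opens B) (p₀ : U) :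
    ∀ᶠ p : U in nhds p₀, (p : B) ∈ (trivializationAt (Fin n → ℂ) E.fiber (p₀ : B)).baseSet :=
  continuous_subtype_val.continuousAt.eventually
    ((trivializationAt (Fin n → ℂ) E.fiber (p₀ : B)).open_baseSet.mem_nhds
      (FiberBundle.mem_baseSet_trivializationAt' (p₀ : B)))

theorem IsHolSection.add {E : HolBundle.{u, v} n B} {U : Opens B} {s t : ∀ p : U, E.fiber p}
    (hs : E.IsHolSection U s) (ht : E.IsHolSection U t) : E.IsHolSection U (s + t) := by
  rw [isHolSection_iff] at *
  intro p₀
  refine ((hs p₀).add (ht p₀)).congr_of_eventuallyEq ?_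
  filter_upwards [E.eventually_mem_baseSet U p₀] with p hp
  exact ((trivializationAt (Fin n → ℂ) E.fiber (p₀ : B)).linear ℂ hp).map_add (s p) (t p)

theorem IsHolSection.smul {E : HolBundle.{u, v} n B} {U : Opens B} {s : ∀ p : U, E.fiber p}
    (hs : E.IsHolSection U s) {f : U → ℂ} (hf : ContMDiff 𝓘(ℂ) 𝓘(ℂ) ω f) :
    E.IsHolSection U (fun p => f p • s p) := by
  rw [isHolSection_iff] at *
  intro p₀
  refine ((hf p₀).smul (hs p₀)).congr_of_eventuallyEq ?_
  filter_upwards [E.eventually_mem_baseSet U p₀] with p hp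
  exact ((trivializationAt (Fin n → ℂ) E.fiber (p₀ : B)).linear ℂ hp).map_smul (f p) (s p)

theorem isHolSection_zero (E : HolBundle.{u, v} n B) (U : Opens B) :
    E.IsHolSection U 0 := by
  rw [isHolSection_iff]
  intro p₀
  refine (contMDiffAt_const (c := (0 : Fin n → ℂ))).congr_of_eventuallyEq ?_
  filter_upwards [E.eventually_mem_baseSet U p₀] with p hp
  exact ((trivializationAt (Fin n → ℂ) E.fiber (p₀ : B)).linear ℂ hp).map_zero

theorem IsHolSection.restrict {E : HolBundle.{u, v} n B} {U V : Opens B}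
    {s : ∀ p : U, E.fiber p} (hs : E.IsHolSection U s) (hVU : V ≤ U) :
    E.IsHolSection V (fun p => s ⟨p, hVU p.2⟩) :=
  ContMDiff.comp (g := fun p : U => (⟨p, s p⟩ : E.Total)) hs (contMDiff_inclusion hVU)

/-- The vector space `Γ(U, E)` of holomorphic sections of `E` over the open set `U`. -/
def sections (E : HolBundle.{u, v} n B) (U : Opens B) : Submodule ℂ (∀ p : U, E.fiber p) where
  carrier := {s | E.IsHolSection U s}
  add_mem' := IsHolSection.add
  zero_mem' := E.isHolSection_zero U
  smul_mem' c _ hs := hs.smul (contMDiff_const (c := c))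

/-- The restriction of sections `Γ(U, E) → Γ(V, E)` for `V ⊆ U`. -/
def restrict (E : HolBundle.{u, v} n B) {U V : Opens B} (hVU : V ≤ U) (s : E.sections U) :
    E.sections V :=
  ⟨fun p => s.1 ⟨p, hVU p.2⟩, IsHolSection.restrict s.2 hVU⟩

/-- The product of a section of `E` over `U` and a holomorphic function on `U`. -/
noncomputable def smulSection (E : HolBundle.{u, v} n B) {U : Opens B} (f : C^ω⟮𝓘(ℂ), U; 𝓘(ℂ), ℂ⟯)
    (s : E.sections U) : E.sections U :=
  ⟨fun p => f p • s.1 p, IsHolSection.smul s.2 f.contMDiff⟩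

/-- The trivial bundle `𝒪^n`. -/
noncomputable def trivial (n : ℕ) (B : Type u) [TopologicalSpace B] [ChartedSpace ℂ B] :
    HolBundle.{u, 0} n B where
  fiber := Bundle.Trivial B (Fin n → ℂ)

/-- The pullback `f^* E` of a holomorphic vector bundle by a holomorphic map. -/
noncomputable def pullback {B' : Type u'} [TopologicalSpace B'] [ChartedSpace ℂ B']
    (E : HolBundle.{u, v} n B) (f : C^ω⟮𝓘(ℂ), B'; 𝓘(ℂ), B⟯) : HolBundle.{u', v} n B' where
  fiber := Bundle.Pullback f E.fiber
  addCommGroup b := inferInstanceAs (AddCommGroup (E.fiber (f b)))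
  module b := inferInstanceAs (Module ℂ (E.fiber (f b)))
  vectorBundle := VectorBundle.pullback ..
  holomorphic := ContMDiffVectorBundle.pullback (Fin n → ℂ) E.fiber 𝓘(ℂ) f

/-- `det E ≅ L` for a bundle `E` of rank two and a line bundle `L`: linear isomorphisms
`⋀² E_b ≃ L_b` of the fibres that take `s₁ ∧ s₂` to a holomorphic section of `L` for all local
holomorphic sections `s₁`, `s₂` of `E`. -/
def DetIso (E : HolBundle.{u, v} 2 B) (L : HolBundle.{u, v'} 1 B) : Prop :=
  ∃ δ : ∀ b, ⋀[ℂ]^2 (E.fiber b) ≃ₗ[ℂ] L.fiber b,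
    ∀ (U : Opens B) (s₁ s₂ : E.sections U),
      L.IsHolSection U fun p => δ p (exteriorPower.ιMulti ℂ 2 ![s₁.1 p, s₂.1 p])

end HolBundle

/-! ### The line bundles `𝒪(k)` on `ℙ¹` -/

/-- The affine coordinate `x` on `ℙ¹ ∖ {∞}` (extended by an irrelevant value at `∞`). -/
noncomputable def affineCoord (p : OnePoint ℂ) : ℂ := p.elim 0 id

/-- The transition functions of `𝒪(k)`: the chart `false` is `ℙ¹ ∖ {∞}`, the chart `true` is
`ℙ¹ ∖ {0}`, and a section given by `f` in the first chart is given by `x^(-k) f` in the second. -/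
noncomputable def lineTransition (k : ℤ) : Bool → Bool → OnePoint ℂ → ℂ
  | false, true, p => affineCoord p ^ (-k)
  | true, false, p => affineCoord p ^ k
  | false, false, _ => 1
  | true, true, _ => 1

/-- The open sets `ℙ¹ ∖ {∞}` and `ℙ¹ ∖ {0}`. -/
def lineBaseSet (i : Bool) : Set (OnePoint ℂ) :=
  if i then {((0 : ℂ) : OnePoint ℂ)}ᶜ else {OnePoint.infty}ᶜ

theorem affineCoord_ne_zero {p : OnePoint ℂ} (h0 : p ∈ lineBaseSet true)
    (h1 : p ∈ lineBaseSet false) : affineCoord p ≠ 0 := by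
  induction p using OnePoint.rec with
  | infty => exact absurd rfl h1
  | coe x =>
    rintro (rfl : x = 0)
    exact h0 rfl

theorem contMDiffOn_affineCoord_zpow (k : ℤ) :
    ContMDiffOn 𝓘(ℂ) 𝓘(ℂ) ω (fun p => affineCoord p ^ k)
      (lineBaseSet true ∩ lineBaseSet false) := by
  have h1 : ContMDiffOn 𝓘(ℂ) 𝓘(ℂ) ω affineCoord (lineBaseSet false) := by
    have h2 : ContMDiffOn 𝓘(ℂ) 𝓘(ℂ) ω sphereChartZero sphereChartZero.source :=
      contMDiffOn_of_mem_maximalAtlas (IsManifold.subset_maximalAtlas (Or.inl rfl))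
    rw [sphereChartZero_source] at h2
    refine h2.congr fun p hp => ?_
    induction p using OnePoint.rec with
    | infty => exact absurd rfl hp
    | coe x => exact (sphereChartZero_coe x).symm
  intro p hp
  have h3 : ContDiffAt ℂ ω (fun z : ℂ => z ^ k) (affineCoord p) :=
    (analyticAt_id.zpow (affineCoord_ne_zero hp.1 hp.2)).contDiffAt
  exact h3.contMDiffAt.comp_contMDiffWithinAt p ((h1 p hp.2).mono inter_subset_right)

theorem contMDiffOn_lineTransition (k : ℤ) (i j : Bool) :
    ContMDiffOn 𝓘(ℂ) 𝓘(ℂ) ω (lineTransition k i j) (lineBaseSet i ∩ lineBaseSet j) := by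
  cases i <;> cases j
  · exact contMDiffOn_const
  · rw [inter_comm]
    exact contMDiffOn_affineCoord_zpow (-k)
  · exact contMDiffOn_affineCoord_zpow k
  · exact contMDiffOn_const

noncomputable def lineCoordChange (k : ℤ) (i j : Bool) (p : OnePoint ℂ) :
    (Fin 1 → ℂ) →L[ℂ] (Fin 1 → ℂ) :=
  lineTransition k i j p • ContinuousLinearMap.id ℂ (Fin 1 → ℂ)

theorem contMDiffOn_lineCoordChange (k : ℤ) (i j : Bool) :
    ContMDiffOn 𝓘(ℂ) 𝓘(ℂ, (Fin 1 → ℂ) →L[ℂ] (Fin 1 → ℂ)) ω (lineCoordChange k i j)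
      (lineBaseSet i ∩ lineBaseSet j) :=
  (contMDiffOn_lineTransition k i j).smul contMDiffOn_const

noncomputable def lineBundleCore (k : ℤ) :
    VectorBundleCore ℂ (OnePoint ℂ) (Fin 1 → ℂ) Bool where
  baseSet := lineBaseSet
  isOpen_baseSet i := by
    cases i
    · exact OnePoint.isClosed_infty.isOpen_compl
    · exact isClosed_singleton.isOpen_compl
  indexAt p := p.elim true fun _ => false
  mem_baseSet_at p := by
    induction p using OnePoint.rec with
    | infty => exact OnePoint.infty_ne_coe 0
    | coe x => exact OnePoint.coe_ne_infty x
  coordChange := lineCoordChange k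
  coordChange_self i p _ v := by
    cases i <;> simp [lineCoordChange, lineTransition]
  continuousOn_coordChange i j := (contMDiffOn_lineCoordChange k i j).continuousOn
  coordChange_comp i j l p hp v := by
    obtain ⟨⟨hi, hj⟩, hl⟩ := hp
    cases i <;> cases j <;> cases l <;>
      simp [lineCoordChange, lineTransition, smul_smul, zpow_neg]
    · rw [inv_mul_cancel₀ (zpow_ne_zero k (affineCoord_ne_zero hj hi)), one_smul]
    · rw [mul_inv_cancel₀ (zpow_ne_zero k (affineCoord_ne_zero hi hj)), one_smul]

instance lineBundleCore_isContMDiff (k : ℤ) : (lineBundleCore k).IsContMDiff 𝓘(ℂ) ω :=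
  ⟨contMDiffOn_lineCoordChange k⟩

/-- The line bundle `𝒪(k)` on `ℙ¹`. -/
noncomputable def sphereLineBundle (k : ℤ) : HolBundle.{0, 0} 1 (OnePoint ℂ) where
  fiber := (lineBundleCore k).Fiber

end VectorBundles

/-! ### Positive elementary transformations -/

section ElementaryTransformations


variable {B : Type u} [TopologicalSpace B] [ChartedSpace ℂ B]

/-- A holomorphic section `t` of `G` over `U ∖ W` has at most a simple pole at `w ∈ U ∩ W`, with
polar part in the subspace `q` of `G_w`: for a local coordinate `ζ` vanishing at `w`, the section
`ζ t` extends holomorphically across `w`, with value in `q` at `w`. -/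
def HasSimplePoleAlong (W : Closeds B) (G : HolBundle.{u, v} 2 B) {U : Opens B}
    (t : G.sections (U ⊓ W.compl)) (w : B) (q : Submodule ℂ (G.fiber w)) : Prop :=
  ∃ (U' : Opens B) (hU : U' ≤ U) (hw : w ∈ U') (g : G.sections U'),
    g.1 ⟨w, hw⟩ ∈ q ∧
    ∀ p : (U' ⊓ W.compl : Opens B),
      g.1 ⟨p, p.2.1⟩ = (chartAt ℂ w p - chartAt ℂ w w) • t.1 ⟨p, hU p.2.1, p.2.2⟩

/-- A holomorphic section of `G` over `U ∖ W` extends holomorphically across `w`. -/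
def ExtendsAcross (W : Closeds B) (G : HolBundle.{u, v} 2 B) {U : Opens B}
    (t : G.sections (U ⊓ W.compl)) (w : B) : Prop :=
  ∃ (U' : Opens B) (hU : U' ≤ U) (_ : w ∈ U') (g : G.sections U'),
    ∀ p : (U' ⊓ W.compl : Opens B), g.1 ⟨p, p.2.1⟩ = t.1 ⟨p, hU p.2.1, p.2.2⟩

/-- An isomorphism `(E, p) ≅ elm⁺_W (G, q)`, where `q` and `p` are families of directions in the
fibres of `G` and `E` over the points of `W`. The bundle `elm⁺_W (G, q)` is the one whose sections
over `U` are the sections of `G` over `U ∖ W` with at most a simple pole at each `w ∈ U ∩ W`, with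
polar part in `q w`; its new direction over `w` is the image of the fibre `G_w`, i.e. it consists
of the values at `w` of those of its sections that come from holomorphic sections of `G`. -/
structure PositiveElmIso (W : Closeds B)
    (G : HolBundle.{u, v} 2 B) (q : ∀ w : W, Submodule ℂ (G.fiber w))
    (E : HolBundle.{u, v'} 2 B) (p : ∀ w : W, Submodule ℂ (E.fiber w)) where
  toSections : ∀ U : Opens B, E.sections U →ₗ[ℂ] G.sections (U ⊓ W.compl)
  map_smul : ∀ (U : Opens B) (f : C^ω⟮𝓘(ℂ), U; 𝓘(ℂ), ℂ⟯) (s : E.sections U)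
    (b : (U ⊓ W.compl : Opens B)),
    (toSections U (E.smulSection f s)).1 b = f ⟨b, b.2.1⟩ • (toSections U s).1 b
  map_restrict : ∀ (U U' : Opens B) (hU : U' ≤ U) (s : E.sections U)
    (b : (U' ⊓ W.compl : Opens B)),
    (toSections U' (E.restrict hU s)).1 b = (toSections U s).1 ⟨b, hU b.2.1, b.2.2⟩
  injective : ∀ U : Opens B, Function.Injective (toSections U)
  mem_range : ∀ (U : Opens B) (t : G.sections (U ⊓ W.compl)),
    t ∈ LinearMap.range (toSections U) ↔
      ∀ w : W, (w : B) ∈ U → HasSimplePoleAlong W G t w (q w)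
  direction : ∀ w : W, p w = Submodule.span ℂ
    {e | ∃ (U : Opens B) (hw : (w : B) ∈ U) (s : E.sections U),
      ExtendsAcross W G (toSections U s) w ∧ s.1 ⟨w, hw⟩ = e}

end ElementaryTransformations

/-! ### Genus two curves and hyperelliptic descent -/

section Hyperelliptic


/-- `F(x) = x (x - 1) (x - r) (x - s) (x - t)`. -/
def quintic (r s t x : ℂ) : ℂ := x * (x - 1) * (x - r) * (x - s) * (x - t)

/-- `X` is the compact Riemann surface given in an affine chart by `y² = F(x)`, with `0, 1, r, s, t`
pairwise distinct: the holomorphic map `(x, y) = (π, y) : X → ℙ¹ × ℙ¹` is injective, and its image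
is the affine curve together with the point `(∞, ∞)`. The hyperelliptic involution `ι` is
`(x, y) ↦ (x, -y)`. -/
structure GenusTwoCurve (r s t : ℂ) (X : Type u) [TopologicalSpace X] [ChartedSpace ℂ X] where
  nodup : [0, 1, r, s, t].Nodup
  π : C^ω⟮𝓘(ℂ), X; 𝓘(ℂ), OnePoint ℂ⟯
  y : C^ω⟮𝓘(ℂ), X; 𝓘(ℂ), OnePoint ℂ⟯
  injective : Function.Injective fun p => (π p, y p)
  range_eq : range (fun p => (π p, y p)) =
    {z | ∃ a b : ℂ, b ^ 2 = quintic r s t a ∧ z = ((a : OnePoint ℂ), (b : OnePoint ℂ))} ∪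
      {(OnePoint.infty, OnePoint.infty)}
  ι : C^ω⟮𝓘(ℂ), X; 𝓘(ℂ), X⟯
  π_ι : ∀ p, π (ι p) = π p
  y_ι : ∀ p, y (ι p) = (y p).map fun b => -b

variable {r s t : ℂ} {X : Type u} [TopologicalSpace X] [ChartedSpace ℂ X]

namespace GenusTwoCurve

/-- The set `W` of Weierstrass points, i.e. of fixed points of the hyperelliptic involution. -/
def weierstrass [T2Space X] (C : GenusTwoCurve r s t X) : Closeds X :=
  ⟨{p | C.ι p = p}, isClosed_eq C.ι.contMDiff.continuous continuous_id⟩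

/-- `π⁻¹(V)`. -/
def preimage (C : GenusTwoCurve r s t X) (V : Opens (OnePoint ℂ)) : Opens X :=
  ⟨C.π ⁻¹' V, V.2.preimage C.π.contMDiff.continuous⟩

theorem ι_mem_preimage (C : GenusTwoCurve r s t X) {V : Opens (OnePoint ℂ)} {p : X}
    (hp : p ∈ C.preimage V) : C.ι p ∈ C.preimage V := by
  change C.π (C.ι p) ∈ V
  rw [C.π_ι]
  exact hp

variable [T2Space X]

/-- The automorphism of the Weierstrass fibre `E_w` induced by linear isomorphisms
`h_p : E_p ≃ E_{ι p}`. -/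
noncomputable def fiberEnd (C : GenusTwoCurve r s t X) (E : HolBundle.{u, v} 2 X)
    (h : ∀ p, E.fiber p ≃ₗ[ℂ] E.fiber (C.ι p)) (w : C.weierstrass) :
    Module.End ℂ (E.fiber w) :=
  ((h w).trans (LinearEquiv.cast (R := ℂ) (M := E.fiber) w.2)).toLinearMap

end GenusTwoCurve

variable [T2Space X]

/-- A bundle isomorphism `h : E → ι^* E` with `ι^* h ∘ h = id_E` such that, for each Weierstrass
point `w`, the induced automorphism of the fibre `E_w` has the two eigenvalues `1` and `-1`. -/
structure HyperellipticLift (C : GenusTwoCurve r s t X) (E : HolBundle.{u, v} 2 X) where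
  map : ∀ p, E.fiber p ≃ₗ[ℂ] E.fiber (C.ι p)
  holomorphic : ContMDiff (𝓘(ℂ).prod 𝓘(ℂ, Fin 2 → ℂ)) (𝓘(ℂ).prod 𝓘(ℂ, Fin 2 → ℂ)) ω
    (fun e : E.Total => (⟨C.ι e.1, map e.1 e.2⟩ : E.Total))
  involutive : ∀ (p : X) (e : E.fiber p),
    (⟨C.ι (C.ι p), map (C.ι p) (map p e)⟩ : E.Total) = ⟨p, e⟩
  hasEigenvalue_one : ∀ w : C.weierstrass, (C.fiberEnd E map w).HasEigenvalue 1
  hasEigenvalue_neg_one : ∀ w : C.weierstrass, (C.fiberEnd E map w).HasEigenvalue (-1)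

variable {C : GenusTwoCurve r s t X} {E : HolBundle.{u, v} 2 X}

/-- The `ε`-eigendirections of `h` in the Weierstrass fibres. For `ε = ± 1` this is the
quasi-parabolic structure `p^±` of `E`. -/
noncomputable def HyperellipticLift.eigendirection (h : HyperellipticLift C E) (ε : ℂ) (w : C.weierstrass) :
    Submodule ℂ (E.fiber w) :=
  Module.End.eigenspace (C.fiberEnd E h.map w) ε

/-- The hyperelliptic descent of `(E, h)` with sign `ε = ± 1`: a holomorphic vector bundle
`bundle` on `ℙ¹` with an isomorphism, linear over holomorphic functions and compatible with
restrictions, from its sheaf of sections to the subsheaf of `π_* E` on which `h` acts as `ε`. -/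
structure HyperellipticDescent (h : HyperellipticLift C E) (ε : ℂ) where
  bundle : HolBundle.{0, w} 2 (OnePoint ℂ)
  toSections : ∀ V : Opens (OnePoint ℂ), bundle.sections V →ₗ[ℂ] E.sections (C.preimage V)
  map_smul : ∀ (V : Opens (OnePoint ℂ)) (f : C^ω⟮𝓘(ℂ), V; 𝓘(ℂ), ℂ⟯) (σ : bundle.sections V)
    (p : C.preimage V),
    (toSections V (bundle.smulSection f σ)).1 p = f ⟨C.π p, p.2⟩ • (toSections V σ).1 p
  map_restrict : ∀ (V V' : Opens (OnePoint ℂ)) (hV : V' ≤ V) (σ : bundle.sections V)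
    (p : C.preimage V'),
    (toSections V' (bundle.restrict hV σ)).1 p = (toSections V σ).1 ⟨p, hV p.2⟩
  injective : ∀ V : Opens (OnePoint ℂ), Function.Injective (toSections V)
  mem_range : ∀ (V : Opens (OnePoint ℂ)) (τ : E.sections (C.preimage V)),
    τ ∈ LinearMap.range (toSections V) ↔
      ∀ p : C.preimage V, h.map p (τ.1 p) = ε • τ.1 ⟨C.ι p, C.ι_mem_preimage p.2⟩

/-- The natural direction of the descended bundle over `b ∈ ℙ¹` (used for branch points): the
values at `b` of those sections for which the corresponding section of `E` vanishes over `b`. -/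
def HyperellipticDescent.direction {h : HyperellipticLift C E} {ε : ℂ}
    (D : HyperellipticDescent.{u, v, w} h ε) (b : OnePoint ℂ) :
    Submodule ℂ (D.bundle.fiber b) :=
  Submodule.span ℂ
    {e | ∃ (V : Opens (OnePoint ℂ)) (hb : b ∈ V) (σ : D.bundle.sections V),
      (∀ p : C.preimage V, C.π p = b → (D.toSections V σ).1 p = 0) ∧ σ.1 ⟨b, hb⟩ = e}

end Hyperelliptic

/-! Let T be the operator σ ↦ h⁻¹ ∘ ι^*σ on families of vectors (`transfer`). It is an involution,
and for ε = ±1 the descent is the sheaf of its ε-eigensections on ι-stable open sets. The whole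
argument rests on local frames of this sheaf.

Over a point that is not a branch point, an ε-section is determined by its restriction to one sheet,
where it is arbitrary. Over a branch point π(w), extend an eigenbasis of E_w to a T-eigensection f₀
with sign ε and a T-eigensection g with sign -ε. Let η be the odd function, y or y/x³ according to
the affine patch of ℙ¹. An ε-section a f₀ + β g has β(w) = 0, and η is a local coordinate at w, so β
is divisible by η and (f₀, η g) is a frame. Coefficients in such frames are even, hence descend to
holomorphic functions on ℙ¹ (`IsDescentFrame.exists_coeff`). Changes of frame then give the cocycle
of a rank two bundle.

That η is a local coordinate on W, and π off W, is deduced from injectivity of (π, y) alone. The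
branch polynomial has simple zeros, so near w the value of η determines x, hence the point, and a
locally injective holomorphic function has nonzero derivative (`AnalyticAt.deriv_ne_zero_of_injOn`).

For an arbitrary descent D, linearity over functions turns the map on sections into linear maps
D_{π(p)} → E_p (`evalMap`). They are bijective off W. At w the frame (F₀, F₁) of D goes to (f₀, η
g), so the kernel is the line of F₁, which is the natural direction, and the image is the line of
f₀, the ε-eigenline. A section a f₀ + β g of E corresponds to a F₀ + (β/η) F₁, that is, to a simple
pole with polar part in the natural direction, and the argument reverses.

For the determinant, compare a trivialization of det E with its transform under h. The ratio is a
holomorphic function on the compact connected X, hence constant, and equals 1·(-1) = -1 at a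
Weierstrass point. So τ₁ ∧ τ₂ is an odd function for ε-sections τ₁, τ₂, equal to η K with K on ℙ¹. K
vanishes nowhere when τ₁, τ₂ is a frame. The relation y = x³ · (y/x³) between the two choices of η
makes K a section of 𝒪(-3). -/

set_option linter.unusedSectionVars false

/-! ### Locally injective holomorphic functions of one variable -/

open Filter Topology in
/-- An injective holomorphic function of one variable has nonzero derivative. -/
theorem AnalyticAt.deriv_ne_zero_of_injOn {f : ℂ → ℂ} {x : ℂ} (hf : AnalyticAt ℂ f x)
    {U : Set ℂ} (hU : U ∈ 𝓝 x) (hinj : InjOn f U) : deriv f x ≠ 0 := by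
  intro hd
  have hne : ¬ ∀ᶠ z in 𝓝 x, f z - f x = 0 := by
    intro h
    obtain ⟨z, ⟨hz, hzU⟩, hzx⟩ := (((h.and hU).filter_mono nhdsWithin_le_nhds).and
      (self_mem_nhdsWithin : {x}ᶜ ∈ 𝓝[≠] x)).exists
    exact hzx (hinj hzU (mem_of_mem_nhds hU) (sub_eq_zero.1 hz))
  obtain ⟨n, g, hg, hgx, hfg⟩ :=
    (hf.sub (analyticAt_const (v := f x))).exists_eventuallyEq_pow_smul_nonzero_iff.2 hne
  simp only [Pi.sub_apply, smul_eq_mul] at hfg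
  have hn0 : n ≠ 0 := by
    rintro rfl
    have := hfg.self_of_nhds
    simp at this
    exact hgx this.symm
  have hn1 : n ≠ 1 := by
    rintro rfl
    have h1 : HasDerivAt (fun z => f x + (z - x) ^ 1 * g z) (g x) x := by
      have := (((hasDerivAt_id x).sub_const x).mul hg.differentiableAt.hasDerivAt).const_add (f x)
      simpa using this
    have h2 : f =ᶠ[𝓝 x] fun z => f x + (z - x) ^ 1 * g z := by
      filter_upwards [hfg] with z hz
      rw [← hz]; ring
    exact hgx ((h1.congr_of_eventuallyEq h2).deriv.symm.trans hd)
  -- Now the order of vanishing n is at least 2. An analytic n-th root `r` of `g` is needed;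
  -- dividing by `g x` keeps the argument of the logarithm near 1, away from the branch cut.
  obtain ⟨c, hc⟩ := IsAlgClosed.exists_pow_nat_eq (g x) (Nat.pos_of_ne_zero hn0)
  have hc0 : c ≠ 0 := by
    rintro rfl
    rw [zero_pow hn0] at hc
    exact hgx hc.symm
  set r : ℂ → ℂ := fun z => c * Complex.exp (Complex.log (g z / g x) / n) with hr
  have hr_an : AnalyticAt ℂ r x := by
    have h1 : AnalyticAt ℂ (fun z => g z / g x) x := hg.div analyticAt_const hgx
    have h2 : AnalyticAt ℂ (fun z => Complex.log (g z / g x)) x :=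
      h1.clog (by simp [div_self hgx])
    exact analyticAt_const.mul (h2.div analyticAt_const (by exact_mod_cast hn0)).cexp
  have hrx : r x = c := by simp [hr, div_self hgx]
  have hrn : ∀ᶠ z in 𝓝 x, r z ^ n = g z := by
    filter_upwards [hg.continuousAt.eventually_ne hgx] with z hz
    rw [hr, mul_pow, ← Complex.exp_nat_mul, mul_div_cancel₀ _ (by exact_mod_cast hn0),
      Complex.exp_log (div_ne_zero hz hgx), hc, mul_div_cancel₀ _ hgx]
  -- In the local coordinate `φ` the function is `f x + φ ^ n`. Points with `φ`-values `t` and `ζ *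
  -- t`, for a primitive n-th root of unity `ζ`, have the same image, which contradicts injectivity.
  set φ : ℂ → ℂ := fun z => (z - x) * r z with hφ
  have hφ_an : AnalyticAt ℂ φ x := (analyticAt_id.sub analyticAt_const).mul hr_an
  have hφd : deriv φ x = c := by
    have := ((hasDerivAt_id x).sub_const x).mul hr_an.differentiableAt.hasDerivAt
    have h3 : HasDerivAt φ c x := by
      convert! this using 1
      simp [hrx]
    exact h3.deriv
  have hmap : map φ (𝓝 x) = 𝓝 0 := by
    have := hφ_an.hasStrictDerivAt.map_nhds_eq (by rw [hφd]; exact hc0)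
    simpa [hφ] using this
  have hV : ∀ᶠ z in 𝓝 x, z ∈ U ∧ f z = f x + φ z ^ n := by
    filter_upwards [hU, hfg, hrn] with z h1 h2 h3
    exact ⟨h1, by rw [hφ, mul_pow, h3, ← h2]; ring⟩
  have him : ∀ᶠ t in 𝓝 (0 : ℂ), ∃ z, (z ∈ U ∧ f z = f x + φ z ^ n) ∧ φ z = t := by
    rw [← hmap]
    exact hV.mono fun z hz => ⟨z, hz, rfl⟩
  set ζ := Complex.exp (2 * Real.pi * Complex.I / n)
  have hζ : IsPrimitiveRoot ζ n := Complex.isPrimitiveRoot_exp n hn0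
  have him2 : ∀ᶠ t in 𝓝 (0 : ℂ), ∃ z, (z ∈ U ∧ f z = f x + φ z ^ n) ∧ φ z = ζ * t := by
    have : Tendsto (fun t => ζ * t) (𝓝 0) (𝓝 (0 : ℂ)) := by
      simpa using (continuous_const_mul ζ).tendsto 0
    exact this.eventually him
  obtain ⟨t, ⟨⟨z₁, ⟨h1, h2⟩, h3⟩, ⟨z₂, ⟨h4, h5⟩, h6⟩⟩, ht⟩ :=
    (((him.and him2).filter_mono nhdsWithin_le_nhds).and
      (self_mem_nhdsWithin : {(0 : ℂ)}ᶜ ∈ 𝓝[≠] (0 : ℂ))).exists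
  have h7 : z₁ = z₂ := hinj h1 h4 (by rw [h2, h5, h3, h6, mul_pow, hζ.pow_eq_one, one_mul])
  rw [← h7, h3] at h6
  have h8 : ζ = 1 := by
    have : ζ * t = 1 * t := by rw [← h6, one_mul]
    exact mul_right_cancel₀ ht this
  exact hζ.ne_one (by omega) h8

/-! ### Holomorphic functions on Riemann surfaces: removable singularities, division, local inverses
-/

section HolomorphicFunctions

variable {B : Type u} [TopologicalSpace B] [ChartedSpace ℂ B]

/-- The function `f` is holomorphic at the point `p`. -/
abbrev HolFunAt (f : B → ℂ) (p : B) : Prop := ContMDiffAt 𝓘(ℂ) 𝓘(ℂ) ω f p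

open Filter Topology

/-- The local coordinate centred at `p`. -/
noncomputable def centredCoord (p q : B) : ℂ := chartAt ℂ p q - chartAt ℂ p p

theorem centredCoord_self (p : B) : centredCoord p p = 0 := sub_self _

theorem eventually_centredCoord_ne_zero (p : B) : ∀ᶠ q in 𝓝[≠] p, centredCoord p q ≠ 0 := by
  filter_upwards [nhdsWithin_le_nhds ((chartAt ℂ p).open_source.mem_nhds (mem_chart_source ℂ p)),
    self_mem_nhdsWithin] with q hq hne h
  exact hne ((chartAt ℂ p).injOn hq (mem_chart_source ℂ p) (sub_eq_zero.1 h))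

theorem tendsto_chart_symm (p : B) :
    Tendsto (chartAt ℂ p).symm (𝓝 (chartAt ℂ p p)) (𝓝 p) := by
  have := (chartAt ℂ p).symm.continuousAt (x := chartAt ℂ p p)
    (mem_chart_target ℂ p)
  rw [ContinuousAt, (chartAt ℂ p).left_inv (mem_chart_source ℂ p)] at this
  exact this

theorem tendsto_chart_symm_nhdsNE (p : B) :
    Tendsto (chartAt ℂ p).symm (𝓝[≠] (chartAt ℂ p p)) (𝓝[≠] p) := by
  refine tendsto_nhdsWithin_iff.2 ⟨(tendsto_chart_symm p).mono_left nhdsWithin_le_nhds, ?_⟩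
  filter_upwards [nhdsWithin_le_nhds
    ((chartAt ℂ p).open_target.mem_nhds (mem_chart_target ℂ p)), self_mem_nhdsWithin] with z hz hne h
  exact hne (by rw [mem_singleton_iff, ← (chartAt ℂ p).right_inv hz, mem_singleton_iff.1 h])

instance nhdsNE_neBot_of_chartedSpace_complex (p : B) : (𝓝[≠] p).NeBot :=
  (tendsto_chart_symm_nhdsNE p).neBot

theorem eventually_chart_left_inv (p : B) :
    ∀ᶠ q in 𝓝 p, (chartAt ℂ p).symm (chartAt ℂ p q) = q :=
  (chartAt ℂ p).eventually_left_inverse (mem_chart_source ℂ p)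

theorem HolFunAt.inv {f : B → ℂ} {p : B} (hf : HolFunAt f p) (h0 : f p ≠ 0) :
    HolFunAt (fun q => (f q)⁻¹) p :=
  ((contDiffAt_inv ℂ h0).contMDiffAt).comp p hf

theorem HolFunAt.mul' {f g : B → ℂ} {p : B} (hf : HolFunAt f p) (hg : HolFunAt g p) :
    HolFunAt (fun q => f q * g q) p :=
  ContMDiffAt.smul hf hg

/-- Two functions continuous at `p` that agree on a punctured neighbourhood agree at `p`. -/
theorem eq_of_eventuallyEq_nhdsNE {Y : Type*} [TopologicalSpace Y] [T2Space Y] {f g : B → Y} {p : B}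
    (hf : ContinuousAt f p) (hg : ContinuousAt g p) (h : ∀ᶠ q in 𝓝[≠] p, f q = g q) : f p = g p :=
  tendsto_nhds_unique_of_eventuallyEq (hf.mono_left nhdsWithin_le_nhds)
    (hg.mono_left nhdsWithin_le_nhds) h

variable [IsManifold 𝓘(ℂ) ω B]

theorem holFunAt_iff_of_mem_chart_source (f : B → ℂ) {p q : B} (hq : q ∈ (chartAt ℂ p).source) :
    HolFunAt f q ↔ AnalyticAt ℂ (f ∘ (chartAt ℂ p).symm) (chartAt ℂ p q) := by
  rw [HolFunAt, contMDiffAt_iff_source_of_mem_source hq]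
  simp only [modelWithCornersSelf_coe, range_id, mfld_simps, contMDiffWithinAt_univ,
    contMDiffAt_iff_contDiffAt]
  rw [← contDiffWithinAt_univ, contDiffWithinAt_omega_iff_analyticWithinAt,
    analyticWithinAt_univ]

theorem holFunAt_iff (f : B → ℂ) (p : B) :
    HolFunAt f p ↔ AnalyticAt ℂ (f ∘ (chartAt ℂ p).symm) (chartAt ℂ p p) :=
  holFunAt_iff_of_mem_chart_source f (mem_chart_source ℂ p)

theorem HolFunAt.eventually {f : B → ℂ} {p : B} (hf : HolFunAt f p) : ∀ᶠ q in 𝓝 p, HolFunAt f q :=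
  (contMDiffAt_iff_contMDiffAt_nhds (by simp)).1 hf

/-- Removable singularities on one-dimensional complex manifolds. -/
theorem holFunAt_of_continuousAt {f : B → ℂ} {p : B} (hc : ContinuousAt f p)
    (h : ∀ᶠ q in 𝓝[≠] p, HolFunAt f q) : HolFunAt f p := by
  rw [holFunAt_iff]
  refine Complex.analyticAt_of_differentiable_on_punctured_nhds_of_continuousAt ?_ ?_
  · filter_upwards [(tendsto_chart_symm_nhdsNE p).eventually h, nhdsWithin_le_nhds
      ((chartAt ℂ p).open_target.mem_nhds (mem_chart_target ℂ p))] with z hz hzt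
    rw [holFunAt_iff_of_mem_chart_source f ((chartAt ℂ p).map_target hzt),
      (chartAt ℂ p).right_inv hzt] at hz
    exact hz.differentiableAt
  · refine ContinuousAt.comp ?_ ?_
    · rwa [(chartAt ℂ p).left_inv (mem_chart_source ℂ p)]
    · exact (chartAt ℂ p).continuousAt_symm (mem_chart_target ℂ p)

theorem holFunAt_of_analyticAt_chart {g : ℂ → ℂ} {p : B} (hg : AnalyticAt ℂ g (chartAt ℂ p p)) :
    HolFunAt (fun q => g (chartAt ℂ p q)) p := by
  rw [holFunAt_iff]
  refine hg.congr ?_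
  filter_upwards [(chartAt ℂ p).open_target.mem_nhds (mem_chart_target ℂ p)] with z hz
  simp [(chartAt ℂ p).right_inv hz]

theorem holFunAt_centredCoord (p : B) : HolFunAt (centredCoord p) p :=
  holFunAt_of_analyticAt_chart (g := fun z => z - chartAt ℂ p p)
    (analyticAt_id.sub analyticAt_const)

/-- A holomorphic function vanishing at `p` is divisible by the local coordinate. -/
theorem HolFunAt.exists_eq_centredCoord_mul {f : B → ℂ} {p : B} (hf : HolFunAt f p) (h0 : f p = 0) :
    ∃ g : B → ℂ, HolFunAt g p ∧ (∀ᶠ q in 𝓝 p, f q = centredCoord p q * g q) ∧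
      g p = deriv (f ∘ (chartAt ℂ p).symm) (chartAt ℂ p p) := by
  have hf' := (holFunAt_iff f p).1 hf
  set F := f ∘ (chartAt ℂ p).symm
  set z₀ := chartAt ℂ p p
  have hF0 : F z₀ = 0 := by
    simp only [F, z₀, Function.comp, (chartAt ℂ p).left_inv (mem_chart_source ℂ p), h0]
  -- The quotient is the divided difference of the chart expression; its value at the centre is the
  -- derivative.
  have hG : AnalyticAt ℂ (dslope F z₀) z₀ := by
    obtain ⟨P, hP⟩ := hf'
    exact ⟨_, hP.has_fpower_series_dslope_fslope⟩
  refine ⟨fun q => dslope F z₀ (chartAt ℂ p q), holFunAt_of_analyticAt_chart hG, ?_,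
    dslope_same F z₀⟩
  filter_upwards [eventually_chart_left_inv p] with q hq
  have h1 := sub_smul_dslope F z₀ (chartAt ℂ p q)
  rw [hF0, sub_zero, smul_eq_mul] at h1
  simp only [centredCoord]
  rw [h1]
  simp only [F, Function.comp, hq]

theorem HolFunAt.deriv_chart_ne_zero {f : B → ℂ} {p : B} (hf : HolFunAt f p) {U : Set B}
    (hU : U ∈ 𝓝 p) (hinj : InjOn f U) :
    deriv (f ∘ (chartAt ℂ p).symm) (chartAt ℂ p p) ≠ 0 := by
  refine ((holFunAt_iff f p).1 hf).deriv_ne_zero_of_injOn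
    (U := (chartAt ℂ p).symm ⁻¹' U ∩ (chartAt ℂ p).target)
    (inter_mem (tendsto_chart_symm p hU)
      ((chartAt ℂ p).open_target.mem_nhds (mem_chart_target ℂ p))) ?_
  intro z hz z' hz' h
  exact (chartAt ℂ p).symm.injOn hz.2 hz'.2 (hinj hz.1 hz'.1 h)

/-- A locally injective holomorphic function vanishing at `p` is a unit times the local
coordinate. -/
theorem HolFunAt.exists_eq_centredCoord_mul_unit {f : B → ℂ} {p : B} (hf : HolFunAt f p)
    (h0 : f p = 0) {U : Set B} (hU : U ∈ 𝓝 p) (hinj : InjOn f U) :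
    ∃ g : B → ℂ, HolFunAt g p ∧ g p ≠ 0 ∧ ∀ᶠ q in 𝓝 p, f q = centredCoord p q * g q := by
  obtain ⟨g, hg, hfg, hgp⟩ := hf.exists_eq_centredCoord_mul h0
  exact ⟨g, hg, hgp ▸ hf.deriv_chart_ne_zero hU hinj, hfg⟩

/-- A holomorphic function vanishing at `p` is divisible by any holomorphic function that vanishes
at `p` and is locally injective there. -/
theorem HolFunAt.exists_eq_mul {f a : B → ℂ} {p : B} (hf : HolFunAt f p)
    (h0 : f p = 0) {U : Set B} (hU : U ∈ 𝓝 p) (hinj : InjOn f U) (ha : HolFunAt a p)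
    (ha0 : a p = 0) : ∃ g : B → ℂ, HolFunAt g p ∧ ∀ᶠ q in 𝓝 p, a q = f q * g q := by
  obtain ⟨g, hg, hgp, hfg⟩ := hf.exists_eq_centredCoord_mul_unit h0 hU hinj
  obtain ⟨k, hk, hak, -⟩ := ha.exists_eq_centredCoord_mul ha0
  refine ⟨fun q => k q * (g q)⁻¹, hk.mul' (hg.inv hgp), ?_⟩
  filter_upwards [hfg, hak, hg.continuousAt.eventually_ne hgp] with q h1 h2 h3
  rw [h1, h2]
  field_simp

/-- A locally injective holomorphic function has a holomorphic local inverse. -/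
theorem HolFunAt.exists_localInverse {f : B → ℂ} {p : B} (hf : HolFunAt f p) {U : Set B}
    (hU : U ∈ 𝓝 p) (hinj : InjOn f U) :
    ∃ s : ℂ → B, ContMDiffAt 𝓘(ℂ) 𝓘(ℂ) ω s (f p) ∧ s (f p) = p ∧ ∀ᶠ z in 𝓝 (f p), f (s z) = z := by
  have hd := hf.deriv_chart_ne_zero hU hinj
  have hF := (holFunAt_iff f p).1 hf
  set F := f ∘ (chartAt ℂ p).symm
  set z₀ := chartAt ℂ p p
  have hF0 : F z₀ = f p := by
    simp only [F, z₀, Function.comp, (chartAt ℂ p).left_inv (mem_chart_source ℂ p)]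
  have hr := hF.analyticAt_localInverse hd
  set r := hF.hasStrictDerivAt.localInverse _ _ _ hd
  have hr0 : r (F z₀) = z₀ := HasStrictFDerivAt.localInverse_apply_image ..
  have hinv : ∀ᶠ z in 𝓝 (F z₀), F (r z) = z := HasStrictDerivAt.eventually_right_inverse ..
  rw [hF0] at hr hr0 hinv
  refine ⟨fun z => (chartAt ℂ p).symm (r z), ?_, ?_, hinv⟩
  · have h1 : ContMDiffAt 𝓘(ℂ) 𝓘(ℂ) ω (chartAt ℂ p).symm (r (f p)) := by
      rw [hr0]
      exact contMDiffAt_symm_of_mem_maximalAtlas (IsManifold.chart_mem_maximalAtlas p) (mem_chart_target ℂ p)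
    exact h1.comp _ hr.contDiffAt.contMDiffAt
  · change (chartAt ℂ p).symm (r (f p)) = p
    rw [hr0]
    exact (chartAt ℂ p).left_inv (mem_chart_source ℂ p)

end HolomorphicFunctions

/-! ### The two affine coordinates of ℙ¹ -/

section SphereCoordinates

open Filter Topology

theorem affineCoord_coe (x : ℂ) : affineCoord (x : OnePoint ℂ) = x := rfl

theorem affineCoord_infty : affineCoord OnePoint.infty = 0 := rfl

theorem coe_affineCoord {p : OnePoint ℂ} (hp : p ≠ OnePoint.infty) :
    (affineCoord p : OnePoint ℂ) = p := by
  induction p using OnePoint.rec with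
  | infty => exact absurd rfl hp
  | coe x => rfl

theorem sphereChartZero_eq_affineCoord {p : OnePoint ℂ} (hp : p ≠ OnePoint.infty) :
    sphereChartZero p = affineCoord p := by
  rw [← coe_affineCoord hp, sphereChartZero_coe, affineCoord_coe]

theorem isOpen_lineBaseSet (i : Bool) : IsOpen (lineBaseSet i) :=
  (lineBundleCore 0).isOpen_baseSet i

theorem mem_lineBaseSet_true {p : OnePoint ℂ} :
    p ∈ lineBaseSet true ↔ p ≠ ((0 : ℂ) : OnePoint ℂ) :=
  Iff.rfl

/-- The coordinates `x` on `ℙ¹ ∖ {∞}` and `1 / x` on `ℙ¹ ∖ {0}`. -/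
noncomputable def patchCoord (i : Bool) (p : OnePoint ℂ) : ℂ :=
  if i then affineCoord (sphereInv p) else affineCoord p

theorem sphereInv_ne_infty {p : OnePoint ℂ} (hp : p ≠ ((0 : ℂ) : OnePoint ℂ)) :
    sphereInv p ≠ OnePoint.infty := fun h =>
  hp (by rw [← sphereInv_sphereInv p, h, sphereInv_infty])

theorem patchCoord_true_of_ne_infty {p : OnePoint ℂ} (hp : p ≠ OnePoint.infty) :
    patchCoord true p = (affineCoord p)⁻¹ := by
  induction p using OnePoint.rec with
  | infty => exact absurd rfl hp
  | coe x =>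
    by_cases hx : x = 0
    -- At 0 the identity holds by convention: `affineCoord` is 0 at infinity and `0⁻¹ = 0`.
    · subst hx
      simp [patchCoord, sphereInv_zero, affineCoord_infty, affineCoord_coe]
    · simp [patchCoord, sphereInv_coe hx, affineCoord_coe]

theorem patchCoord_true_infty : patchCoord true OnePoint.infty = 0 := rfl

theorem holFunAt_patchCoord {i : Bool} {p : OnePoint ℂ} (hp : p ∈ lineBaseSet i) :
    HolFunAt (patchCoord i) p := by
  cases i
  · have h2 : ContMDiffOn 𝓘(ℂ) 𝓘(ℂ) ω sphereChartZero sphereChartZero.source :=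
      contMDiffOn_of_mem_maximalAtlas (IsManifold.subset_maximalAtlas (Or.inl rfl))
    rw [sphereChartZero_source] at h2
    refine ((h2 p hp).contMDiffAt ((isOpen_lineBaseSet false).mem_nhds hp)).congr_of_eventuallyEq ?_
    filter_upwards [(isOpen_lineBaseSet false).mem_nhds hp] with q hq
    exact (sphereChartZero_eq_affineCoord hq).symm
  · have h2 : ContMDiffOn 𝓘(ℂ) 𝓘(ℂ) ω sphereChartInfty sphereChartInfty.source :=
      contMDiffOn_of_mem_maximalAtlas (IsManifold.subset_maximalAtlas (Or.inr rfl))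
    rw [sphereChartInfty_source] at h2
    refine ((h2 p hp).contMDiffAt ((isOpen_lineBaseSet true).mem_nhds hp)).congr_of_eventuallyEq ?_
    filter_upwards [(isOpen_lineBaseSet true).mem_nhds hp] with q hq
    exact (sphereChartZero_eq_affineCoord (sphereInv_ne_infty hq)).symm

theorem injOn_patchCoord (i : Bool) : InjOn (patchCoord i) (lineBaseSet i) := by
  cases i
  · intro p hp q hq h
    rw [← coe_affineCoord hp, ← coe_affineCoord hq]
    exact congrArg _ h
  · intro p hp q hq h
    rw [← sphereInv_sphereInv p, ← sphereInv_sphereInv q, ← coe_affineCoord (sphereInv_ne_infty hp),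
      ← coe_affineCoord (sphereInv_ne_infty hq)]
    exact congrArg _ (congrArg _ h)

theorem exists_mem_lineBaseSet (p : OnePoint ℂ) : ∃ i, p ∈ lineBaseSet i := by
  by_cases hp : p = OnePoint.infty
  · exact ⟨true, by rw [hp, mem_lineBaseSet_true]; exact OnePoint.infty_ne_coe 0⟩
  · exact ⟨false, hp⟩

end SphereCoordinates

/-! ### The branch polynomial in both patches and its simple zeros -/

/-- The polynomials `P` with `y² = P(x)`, respectively `(y / x³)² = P(1 / x)`. -/
def patchQuintic (r s t : ℂ) (i : Bool) (z : ℂ) : ℂ :=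
  if i then z * (1 - z) * (1 - r * z) * (1 - s * z) * (1 - t * z) else quintic r s t z

open Filter Topology in
theorem HasStrictDerivAt.exists_injOn {f : ℂ → ℂ} {f' a : ℂ} (hf : HasStrictDerivAt f f' a)
    (h : f' ≠ 0) : ∃ U ∈ 𝓝 a, InjOn f U := by
  refine ⟨_, HasStrictDerivAt.eventually_left_inverse (hf := hf) (hf' := h), ?_⟩
  intro z hz z' hz' e
  rw [← mem_ofPred.1 hz, ← mem_ofPred.1 hz', e]

-- By the product rule the derivative at the zero `a` of `L` is `l * Q a`, which is nonzero.
open Filter Topology in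
theorem exists_injOn_of_eq_mul {f L Q : ℂ → ℂ} {l a : ℂ} (hL : HasStrictDerivAt L l a)
    (hl : l ≠ 0) (ha : L a = 0) (hQ : AnalyticAt ℂ Q a) (hQa : Q a ≠ 0)
    (hf : ∀ z, f z = L z * Q z) : ∃ U ∈ 𝓝 a, InjOn f U := by
  have h := hL.mul hQ.hasStrictDerivAt
  rw [ha, zero_mul, add_zero] at h
  obtain rfl : f = L * Q := funext hf
  exact h.exists_injOn (mul_ne_zero hl hQa)

-- All zeros are simple because 0, 1, r, s, t are distinct; split off the linear factor vanishing at
-- `a`. This is what makes the odd function a local coordinate at the Weierstrass points.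
open Filter Topology in
theorem patchQuintic_locally_injective {r s t : ℂ} (h : [0, 1, r, s, t].Nodup) (i : Bool) {a : ℂ}
    (ha : patchQuintic r s t i a = 0) : ∃ U ∈ 𝓝 a, InjOn (patchQuintic r s t i) U := by
  simp only [List.nodup_cons, List.mem_cons, List.not_mem_nil, or_false, not_or] at h
  obtain ⟨⟨h01, h0r, h0s, h0t⟩, ⟨h1r, h1s, h1t⟩, ⟨hrs, hrt⟩, hst, -⟩ := h
  cases i
  · have d (c : ℂ) : HasStrictDerivAt (fun z : ℂ => z - c) 1 a := (hasStrictDerivAt_id a).sub_const c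
    have ha' : a = 0 ∨ a = 1 ∨ a = r ∨ a = s ∨ a = t := by
      simpa [patchQuintic, quintic, sub_eq_zero, or_assoc] using ha
    rcases ha' with h | h | h | h | h
    · refine exists_injOn_of_eq_mul (Q := fun z => (z - 1) * (z - r) * (z - s) * (z - t)) (d 0)
        one_ne_zero (by simp [h]) (by fun_prop) ?_ fun z => by simp [patchQuintic, quintic]; ring
      simp [h, Ne.symm h0r, Ne.symm h0s, Ne.symm h0t]
    · refine exists_injOn_of_eq_mul (Q := fun z => z * (z - r) * (z - s) * (z - t)) (d 1)
        one_ne_zero (by simp [h]) (by fun_prop) ?_ fun z => by simp [patchQuintic, quintic]; ring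
      simp [h, sub_eq_zero, h1r, h1s, h1t]
    · refine exists_injOn_of_eq_mul (Q := fun z => z * (z - 1) * (z - s) * (z - t)) (d r)
        one_ne_zero (by simp [h]) (by fun_prop) ?_ fun z => by simp [patchQuintic, quintic]; ring
      simp [h, sub_eq_zero, hrs, hrt, Ne.symm h0r, Ne.symm h1r]
    · refine exists_injOn_of_eq_mul (Q := fun z => z * (z - 1) * (z - r) * (z - t)) (d s)
        one_ne_zero (by simp [h]) (by fun_prop) ?_ fun z => by simp [patchQuintic, quintic]; ring
      simp [h, sub_eq_zero, Ne.symm hrs, hst, Ne.symm h0s, Ne.symm h1s]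
    · refine exists_injOn_of_eq_mul (Q := fun z => z * (z - 1) * (z - r) * (z - s)) (d t)
        one_ne_zero (by simp [h]) (by fun_prop) ?_ fun z => by simp [patchQuintic, quintic]; ring
      simp [h, sub_eq_zero, Ne.symm hrt, Ne.symm hst, Ne.symm h0t, Ne.symm h1t]
  · have d (c : ℂ) : HasStrictDerivAt (fun z : ℂ => 1 - c * z) (-c) a := by
      simpa using ((hasStrictDerivAt_id a).const_mul c).const_sub 1
    -- Two factors with different `c` have no common zero: subtracting gives `c * a = c' * a`, and
    -- `a` cannot be 0.
    have key : ∀ {c c' : ℂ}, 1 - c * a = 0 → c ≠ c' → 1 - c' * a ≠ 0 := by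
      intro c c' h h' h''
      have ha0 : a ≠ 0 := by
        rintro rfl
        simp at h
      exact h' (mul_right_cancel₀ ha0 (by linear_combination h'' - h))
    have ha' : a = 0 ∨ 1 - 1 * a = 0 ∨ 1 - r * a = 0 ∨ 1 - s * a = 0 ∨ 1 - t * a = 0 := by
      simpa only [patchQuintic, if_true, mul_eq_zero, or_assoc, one_mul] using ha
    have hne : ∀ {c : ℂ}, 1 - c * a = 0 → a ≠ 0 := by
      rintro c h rfl
      simp at h
    rcases ha' with h | h | h | h | h
    · refine exists_injOn_of_eq_mul
        (Q := fun z => (1 - 1 * z) * (1 - r * z) * (1 - s * z) * (1 - t * z)) (hasStrictDerivAt_id a)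
        one_ne_zero h (by fun_prop) ?_ fun z => by simp [patchQuintic]; ring
      simp [h]
    · refine exists_injOn_of_eq_mul
        (Q := fun z => z * (1 - r * z) * (1 - s * z) * (1 - t * z)) (d 1)
        (neg_ne_zero.2 one_ne_zero) h (by fun_prop) ?_ fun z => by simp [patchQuintic]; ring
      exact mul_ne_zero (mul_ne_zero (mul_ne_zero (hne h) (key h h1r)) (key h h1s)) (key h h1t)
    · refine exists_injOn_of_eq_mul
        (Q := fun z => z * (1 - 1 * z) * (1 - s * z) * (1 - t * z)) (d r)
        (neg_ne_zero.2 (Ne.symm h0r)) h (by fun_prop) ?_ fun z => by simp [patchQuintic]; ring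
      exact mul_ne_zero (mul_ne_zero (mul_ne_zero (hne h) (key h (Ne.symm h1r))) (key h hrs))
        (key h hrt)
    · refine exists_injOn_of_eq_mul
        (Q := fun z => z * (1 - 1 * z) * (1 - r * z) * (1 - t * z)) (d s)
        (neg_ne_zero.2 (Ne.symm h0s)) h (by fun_prop) ?_ fun z => by simp [patchQuintic]; ring
      exact mul_ne_zero (mul_ne_zero (mul_ne_zero (hne h) (key h (Ne.symm h1s)))
        (key h (Ne.symm hrs))) (key h hst)
    · refine exists_injOn_of_eq_mul
        (Q := fun z => z * (1 - 1 * z) * (1 - r * z) * (1 - s * z)) (d t)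
        (neg_ne_zero.2 (Ne.symm h0t)) h (by fun_prop) ?_ fun z => by simp [patchQuintic]; ring
      exact mul_ne_zero (mul_ne_zero (mul_ne_zero (hne h) (key h (Ne.symm h1t)))
        (key h (Ne.symm hrt))) (key h (Ne.symm hst))

/-! ### The curve: fibres of π, the odd function, local coordinates, Weierstrass points -/

namespace GenusTwoCurve

variable {r s t : ℂ} {X : Type u} [TopologicalSpace X] [ChartedSpace ℂ X]

open Filter Topology

theorem sq_or_infty (C : GenusTwoCurve r s t X) (p : X) :
    (∃ a b : ℂ, b ^ 2 = quintic r s t a ∧ C.π p = (a : OnePoint ℂ) ∧ C.y p = (b : OnePoint ℂ)) ∨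
      (C.π p = OnePoint.infty ∧ C.y p = OnePoint.infty) := by
  have h : (C.π p, C.y p) ∈ range (fun p => (C.π p, C.y p)) := ⟨p, rfl⟩
  rw [C.range_eq] at h
  rcases h with ⟨a, b, h1, h2⟩ | h
  · exact Or.inl ⟨a, b, h1, (Prod.ext_iff.1 h2).1, (Prod.ext_iff.1 h2).2⟩
  · exact Or.inr ⟨(Prod.ext_iff.1 h).1, (Prod.ext_iff.1 h).2⟩

theorem ext_of_eq (C : GenusTwoCurve r s t X) {p q : X} (h : C.π p = C.π q) (h' : C.y p = C.y q) :
    p = q :=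
  C.injective (Prod.ext h h')

theorem ι_ι (C : GenusTwoCurve r s t X) (p : X) : C.ι (C.ι p) = p := by
  refine C.ext_of_eq (by rw [C.π_ι, C.π_ι]) ?_
  rw [C.y_ι, C.y_ι]
  rcases C.sq_or_infty p with ⟨a, b, -, -, h⟩ | ⟨-, h⟩ <;> rw [h] <;> simp

theorem π_surjective (C : GenusTwoCurve r s t X) : Function.Surjective C.π := by
  intro z
  induction z using OnePoint.rec with
  | infty =>
    have h : ((OnePoint.infty, OnePoint.infty) : OnePoint ℂ × OnePoint ℂ) ∈
      range (fun p => (C.π p, C.y p)) := by rw [C.range_eq]; exact Or.inr rfl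
    obtain ⟨p, hp⟩ := h
    exact ⟨p, (Prod.ext_iff.1 hp).1⟩
  | coe a =>
    obtain ⟨b, hb⟩ := IsAlgClosed.exists_pow_nat_eq (quintic r s t a) (n := 2) (by norm_num)
    have h : ((a : OnePoint ℂ), (b : OnePoint ℂ)) ∈
      range (fun p => (C.π p, C.y p)) := by rw [C.range_eq]; exact Or.inl ⟨a, b, hb, rfl⟩
    obtain ⟨p, hp⟩ := h
    exact ⟨p, (Prod.ext_iff.1 hp).1⟩

/-- The equation y² = F(x) determines y up to sign, and there is a single point over infinity. -/
theorem eq_or_eq_ι (C : GenusTwoCurve r s t X) {p q : X} (h : C.π q = C.π p) :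
    q = p ∨ q = C.ι p := by
  rcases C.sq_or_infty p with ⟨a, b, h1, h2, h3⟩ | ⟨h2, h3⟩ <;>
  rcases C.sq_or_infty q with ⟨a', b', h1', h2', h3'⟩ | ⟨h2', h3'⟩
  · have haa : a' = a := by
      rw [h2, h2'] at h
      exact OnePoint.coe_injective h
    subst haa
    rcases sq_eq_sq_iff_eq_or_eq_neg.1 (h1'.trans h1.symm) with hb | hb
    · exact Or.inl (C.ext_of_eq h (by rw [h3, h3', hb]))
    · exact Or.inr (C.ext_of_eq (by rw [h, C.π_ι]) (by rw [C.y_ι, h3, h3', hb]; rfl))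
  · rw [h2, h2'] at h
    exact absurd h (OnePoint.infty_ne_coe _)
  · rw [h2, h2'] at h
    exact absurd h (OnePoint.coe_ne_infty _)
  · exact Or.inl (C.ext_of_eq h (by rw [h3, h3']))

/-- The functions `y` and `y / x³`, odd under the hyperelliptic involution. -/
noncomputable def oddFun (C : GenusTwoCurve r s t X) (i : Bool) (p : X) : ℂ :=
  if i then affineCoord (C.y p) / affineCoord (C.π p) ^ 3 else affineCoord (C.y p)

theorem oddFun_ι (C : GenusTwoCurve r s t X) (i : Bool) (p : X) :
    C.oddFun i (C.ι p) = - C.oddFun i p := by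
  have h : affineCoord (C.y (C.ι p)) = - affineCoord (C.y p) := by
    rw [C.y_ι]
    rcases C.sq_or_infty p with ⟨a, b, -, -, h⟩ | ⟨-, h⟩ <;> rw [h] <;>
      simp [affineCoord_coe, affineCoord_infty]
  cases i <;> simp [oddFun, h, C.π_ι, neg_div]

theorem oddFun_false_eq (C : GenusTwoCurve r s t X) {p : X} (hp : C.π p ∈ lineBaseSet true)
    (hp' : C.π p ∈ lineBaseSet false) :
    C.oddFun false p = affineCoord (C.π p) ^ 3 * C.oddFun true p := by
  have := affineCoord_ne_zero hp hp'
  simp [oddFun]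
  field_simp

theorem oddFun_sq (C : GenusTwoCurve r s t X) {i : Bool} {p : X} (hp : C.π p ∈ lineBaseSet i) :
    C.oddFun i p ^ 2 = patchQuintic r s t i (patchCoord i (C.π p)) := by
  rcases C.sq_or_infty p with ⟨a, b, h1, h2, h3⟩ | ⟨h2, h3⟩
  · cases i
    · simpa [oddFun, patchCoord, patchQuintic, h2, h3, affineCoord_coe] using h1
    · have ha : a ≠ 0 := by
        rintro rfl
        exact hp h2
      rw [h2, patchCoord_true_of_ne_infty (OnePoint.coe_ne_infty a)]
      simp only [oddFun, patchQuintic, h2, h3, affineCoord_coe, if_true, div_pow, h1, quintic]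
      field_simp
  · cases i
    · exact absurd h2 hp
    -- At the point at infinity the conventions make `oddFun true` equal to 0 / 0 = 0, which is also
    -- the correct limit of y / x³.
    · simp [oddFun, patchQuintic, h2, h3, affineCoord_infty, patchCoord_true_infty]

theorem continuous_π (C : GenusTwoCurve r s t X) : Continuous C.π := C.π.contMDiff.continuous

theorem continuous_ι (C : GenusTwoCurve r s t X) : Continuous C.ι := C.ι.contMDiff.continuous

/-- Only the point at infinity is delicate, since there y / x³ is a quotient of functions with
poles. Its square is a polynomial in 1/x and tends to 0, so the function is continuous there, and
the singularity is removable. -/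
theorem holFunAt_oddFun [IsManifold 𝓘(ℂ) ω X] (C : GenusTwoCurve r s t X) {i : Bool} {p : X}
    (hp : C.π p ∈ lineBaseSet i) : HolFunAt (C.oddFun i) p := by
  have hy : ∀ q : X, C.y q ≠ OnePoint.infty → HolFunAt (C.oddFun false) q := fun q hq =>
    (holFunAt_patchCoord (i := false) hq).comp q (C.y.contMDiff q)
  have hyx : ∀ q : X, C.π q ≠ OnePoint.infty → C.y q ≠ OnePoint.infty := by
    intro q hq
    rcases C.sq_or_infty q with ⟨a, b, h1, h2, h3⟩ | ⟨h2, h3⟩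
    · rw [h3]; exact OnePoint.coe_ne_infty b
    · exact absurd h2 hq
  cases i
  · exact hy p (hyx p hp)
  · have hfin : ∀ q : X, C.π q ∈ lineBaseSet true → C.π q ≠ OnePoint.infty →
        HolFunAt (C.oddFun true) q := by
      intro q h1 h2
      have hx : HolFunAt (fun q => affineCoord (C.π q)) q :=
        (holFunAt_patchCoord (i := false) h2).comp q (C.π.contMDiff q)
      have h3 : HolFunAt (fun q => affineCoord (C.π q) ^ 3) q := hx.pow 3
      have h4 := (hy q (hyx q h2)).mul' (h3.inv (pow_ne_zero 3 (affineCoord_ne_zero h1 h2)))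
      exact h4
    by_cases hinf : C.π p = OnePoint.infty
    · refine holFunAt_of_continuousAt ?_ ?_
      · have hp0 : C.oddFun true p = 0 := by simp [oddFun, hinf, affineCoord_infty]
        have hc : Tendsto (fun q => patchQuintic r s t true (patchCoord true (C.π q))) (𝓝 p)
            (𝓝 0) := by
          have h1 : ContinuousAt (patchCoord true) (C.π p) := (holFunAt_patchCoord hp).continuousAt
          have h2 : Continuous (patchQuintic r s t true) := by
            have : patchQuintic r s t true =
                fun z => z * (1 - z) * (1 - r * z) * (1 - s * z) * (1 - t * z) := rfl
            rw [this]
            fun_prop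
          have h3 := h2.continuousAt.comp (h1.comp C.continuous_π.continuousAt)
          have h4 : Tendsto (fun q => patchQuintic r s t true (patchCoord true (C.π q))) (𝓝 p)
            (𝓝 (patchQuintic r s t true (patchCoord true (C.π p)))) := h3
          rw [hinf, patchCoord_true_infty] at h4
          have h6 : patchQuintic r s t true 0 = 0 := by simp [patchQuintic]
          rwa [h6] at h4
        have h5 : Tendsto (fun q => ‖C.oddFun true q‖ ^ 2) (𝓝 p) (𝓝 0) := by
          have := hc.norm
          rw [norm_zero] at this
          refine this.congr' ?_
          filter_upwards [C.continuous_π.continuousAt ((isOpen_lineBaseSet true).mem_nhds hp)]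
            with q hq
          rw [← C.oddFun_sq hq, norm_pow]
        rw [ContinuousAt, hp0, tendsto_zero_iff_norm_tendsto_zero]
        have h6 := h5.sqrt
        simpa using h6
      · filter_upwards [self_mem_nhdsWithin, nhdsWithin_le_nhds
          (C.continuous_π.continuousAt ((isOpen_lineBaseSet true).mem_nhds hp))] with q hq hq'
        refine hfin q hq' fun h => hq ?_
        rcases C.eq_or_eq_ι (h.trans hinf.symm) with h | h
        · exact h
        · rw [h]
          refine C.ext_of_eq (C.π_ι p) ?_
          rw [C.y_ι]
          rcases C.sq_or_infty p with ⟨a, b, -, h2, h3⟩ | ⟨h2, h3⟩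
          · rw [hinf] at h2
            exact absurd h2 (OnePoint.infty_ne_coe a)
          · rw [h3]; rfl
    · exact hfin p hp hinf

theorem eq_of_oddFun_eq (C : GenusTwoCurve r s t X) {i : Bool} {p q : X}
    (hp : C.π p ∈ lineBaseSet i) (h : C.π q = C.π p) (h' : C.oddFun i q = C.oddFun i p) : q = p := by
  rcases C.sq_or_infty p with ⟨a, b, -, h2, h3⟩ | ⟨h2, h3⟩ <;>
  rcases C.sq_or_infty q with ⟨a', b', -, h2', h3'⟩ | ⟨h2', h3'⟩
  · refine C.ext_of_eq h ?_
    have haa : a' = a := by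
      rw [h2, h2'] at h
      exact OnePoint.coe_injective h
    subst haa
    rw [h3, h3']
    cases i
    · simpa [oddFun, h3, h3', affineCoord_coe] using h'
    · have ha : a' ≠ 0 := by
        rintro rfl
        exact hp h2
      simp only [oddFun, h2, h2', h3, h3', affineCoord_coe, if_true] at h'
      rw [div_left_inj' (pow_ne_zero 3 ha)] at h'
      rw [h']
  · rw [h2, h2'] at h
    exact absurd h (OnePoint.infty_ne_coe _)
  · rw [h2, h2'] at h
    exact absurd h (OnePoint.coe_ne_infty _)
  · exact C.ext_of_eq h (by rw [h3, h3'])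

/-- The involution changes the sign of the odd function, which separates the points of a fibre of π.
-/
theorem oddFun_eq_zero_iff (C : GenusTwoCurve r s t X) {i : Bool} {p : X}
    (hp : C.π p ∈ lineBaseSet i) : C.oddFun i p = 0 ↔ C.ι p = p := by
  constructor
  · intro h
    exact C.eq_of_oddFun_eq hp (C.π_ι p) (by rw [C.oddFun_ι, h, neg_zero])
  · intro h
    have := C.oddFun_ι i p
    rw [h] at this
    exact self_eq_neg.1 this

theorem eventually_π_mem_lineBaseSet (C : GenusTwoCurve r s t X) {i : Bool} {p : X}
    (hp : C.π p ∈ lineBaseSet i) : ∀ᶠ q in 𝓝 p, C.π q ∈ lineBaseSet i :=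
  C.continuous_π.continuousAt ((isOpen_lineBaseSet i).mem_nhds hp)

/-- Off the Weierstrass points, `π` is locally injective. -/
theorem exists_injOn_π [IsManifold 𝓘(ℂ) ω X] (C : GenusTwoCurve r s t X) {p : X} (hp : C.ι p ≠ p) :
    ∃ U ∈ 𝓝 p, InjOn C.π U := by
  obtain ⟨i, hi⟩ := exists_mem_lineBaseSet (C.π p)
  have h0 : C.oddFun i p ≠ 0 := fun h => hp ((C.oddFun_eq_zero_iff hi).1 h)
  have hc : ContinuousAt (fun z : ℂ × ℂ => z.1 + z.2) (C.oddFun i p, C.oddFun i p) := by fun_prop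
  have hodd := (C.holFunAt_oddFun hi).continuousAt
  -- Two points with the same image under π have equal or opposite odd values. Opposite values are
  -- excluded near `p`, where the sum of two values stays close to twice the nonzero value at `p`.
  have h1 : ∀ᶠ z : X × X in 𝓝 p ×ˢ 𝓝 p, C.oddFun i z.1 + C.oddFun i z.2 ≠ 0 := by
    have h2 : Tendsto (fun z : X × X => C.oddFun i z.1 + C.oddFun i z.2) (𝓝 p ×ˢ 𝓝 p)
        (𝓝 (C.oddFun i p + C.oddFun i p)) :=
      (hodd.tendsto.comp tendsto_fst).add (hodd.tendsto.comp tendsto_snd)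
    exact h2.eventually_ne (by simpa [← two_mul] using h0)
  obtain ⟨U, hU, hUU⟩ := (eventually_prod_self_iff (r := fun q q' => C.oddFun i q + C.oddFun i q' ≠ 0)).1 h1
  refine ⟨_, inter_mem hU (C.eventually_π_mem_lineBaseSet hi), ?_⟩
  intro q hq q' hq' h
  refine C.eq_of_oddFun_eq hq'.2 h ?_
  have h3 : C.oddFun i q ^ 2 = C.oddFun i q' ^ 2 := by
    rw [C.oddFun_sq hq.2, C.oddFun_sq hq'.2, h]
  rcases sq_eq_sq_iff_eq_or_eq_neg.1 h3 with h4 | h4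
  · exact h4
  · exact absurd (by rw [h4]; ring) (hUU q hq.1 q' hq'.1)

/-- At the Weierstrass points, the odd function is locally injective. -/
theorem exists_injOn_oddFun (C : GenusTwoCurve r s t X) {i : Bool}
    {p : X} (hi : C.π p ∈ lineBaseSet i) (hp : C.ι p = p) :
    ∃ U ∈ 𝓝 p, InjOn (C.oddFun i) U := by
  have h0 : patchQuintic r s t i (patchCoord i (C.π p)) = 0 := by
    rw [← C.oddFun_sq hi, (C.oddFun_eq_zero_iff hi).2 hp, zero_pow two_ne_zero]
  obtain ⟨U, hU, hinj⟩ := patchQuintic_locally_injective C.nodup i h0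
  have hc : ContinuousAt (fun q => patchCoord i (C.π q)) p :=
    ((holFunAt_patchCoord hi).continuousAt).comp C.continuous_π.continuousAt
  refine ⟨_, inter_mem (hc hU) (C.eventually_π_mem_lineBaseSet hi), ?_⟩
  intro q hq q' hq' h
  refine C.eq_of_oddFun_eq hq'.2 ?_ h
  -- Equal odd values have equal squares, that is, equal values of the branch polynomial, which is
  -- injective near its zero; so the points lie in one fibre of π.
  refine injOn_patchCoord i hq.2 hq'.2 (hinj hq.1 hq'.1 ?_)
  rw [← C.oddFun_sq hq.2, ← C.oddFun_sq hq'.2, h]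

/-- Being locally injective off W, π has holomorphic local inverses there; these carry functions on
X down to ℙ¹. -/
theorem exists_local_section [IsManifold 𝓘(ℂ) ω X] (C : GenusTwoCurve r s t X) {p : X}
    (hp : C.ι p ≠ p) : ∃ σ : OnePoint ℂ → X, ContMDiffAt 𝓘(ℂ) 𝓘(ℂ) ω σ (C.π p) ∧ σ (C.π p) = p ∧
      ∀ᶠ b in 𝓝 (C.π p), C.π (σ b) = b := by
  obtain ⟨i, hi⟩ := exists_mem_lineBaseSet (C.π p)
  obtain ⟨U, hU, hinj⟩ := C.exists_injOn_π hp
  have hf : HolFunAt (fun q => patchCoord i (C.π q)) p :=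
    (holFunAt_patchCoord hi).comp p (C.π.contMDiff p)
  obtain ⟨σ, hσ, hσp, hinv⟩ := hf.exists_localInverse
    (inter_mem hU (C.eventually_π_mem_lineBaseSet hi))
    (fun q hq q' hq' h => hinj hq.1 hq'.1 (injOn_patchCoord i hq.2 hq'.2 h))
  have hz := holFunAt_patchCoord hi
  refine ⟨fun b => σ (patchCoord i b), hσ.comp _ hz, hσp, ?_⟩
  have h1 : ContinuousAt (fun b => C.π (σ (patchCoord i b))) (C.π p) :=
    C.continuous_π.continuousAt.comp ((hσ.continuousAt).comp hz.continuousAt)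
  have h2 : ∀ᶠ b in 𝓝 (C.π p), C.π (σ (patchCoord i b)) ∈ lineBaseSet i := by
    refine h1 ((isOpen_lineBaseSet i).mem_nhds ?_)
    simpa only [hσp] using hi
  filter_upwards [hz.continuousAt.eventually hinv, h2, (isOpen_lineBaseSet i).mem_nhds hi]
    with b h3 h4 h5
  exact injOn_patchCoord i h4 h5 h3

theorem isClosedMap_π [CompactSpace X] (C : GenusTwoCurve r s t X) : IsClosedMap C.π :=
  C.continuous_π.isClosedMap

/-- Compactness makes π a closed map, so every neighbourhood of a fibre contains the preimage of a
neighbourhood of `b`. This turns statements near each point of a fibre into statements over a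
neighbourhood in ℙ¹. -/
theorem eventually_fiber [CompactSpace X] (C : GenusTwoCurve r s t X) {P : X → Prop}
    {b : OnePoint ℂ} (H : ∀ p, C.π p = b → ∀ᶠ q in 𝓝 p, P q) :
    ∀ᶠ c in 𝓝 b, ∀ q, C.π q = c → P q :=
  C.isClosedMap_π.eventually_nhds_fiber b H

/-- A point is fixed exactly when y = -y, so y is 0 or ∞: the zeros of F and the point at infinity.
-/
theorem weierstrass_eq [T2Space X] (C : GenusTwoCurve r s t X) :
    (fun p => (C.π p, C.y p)) '' (C.weierstrass : Set X) =
      (fun a : ℂ => ((a : OnePoint ℂ), ((0 : ℂ) : OnePoint ℂ))) '' {0, 1, r, s, t} ∪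
        {(OnePoint.infty, OnePoint.infty)} := by
  have key : ∀ p, C.ι p = p ↔ C.y p = OnePoint.infty ∨ C.y p = ((0 : ℂ) : OnePoint ℂ) := by
    intro p
    constructor
    · intro h
      have h1 := C.y_ι p
      rw [h] at h1
      rcases C.sq_or_infty p with ⟨a, b, -, h2, h3⟩ | ⟨h2, h3⟩
      · right
        rw [h3] at h1 ⊢
        have h4 : b = -b := OnePoint.coe_injective h1
        rw [self_eq_neg.1 h4]
      · exact Or.inl h3
    · intro h
      refine C.ext_of_eq (C.π_ι p) ?_
      rw [C.y_ι]
      rcases h with h | h <;> rw [h] <;> simp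
  have hroot : ∀ a : ℂ, quintic r s t a = 0 ↔ a ∈ ({0, 1, r, s, t} : Set ℂ) := by
    intro a
    simp only [quintic, mul_eq_zero, sub_eq_zero, mem_insert_iff, mem_singleton_iff, or_assoc]
  ext z
  constructor
  · rintro ⟨p, hp, rfl⟩
    rcases C.sq_or_infty p with ⟨a, b, h1, h2, h3⟩ | ⟨h2, h3⟩
    · left
      rcases (key p).1 hp with h | h
      · rw [h3] at h
        exact absurd h (OnePoint.coe_ne_infty b)
      · have hb : b = 0 := OnePoint.coe_injective (h3.symm.trans h)
        subst hb
        refine ⟨a, (hroot a).1 (by rw [← h1]; simp), ?_⟩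
        simp only [h2, h3]
    · right
      simp only [h2, h3, mem_singleton_iff]
  · intro hz
    have hz' : z ∈ range (fun p => (C.π p, C.y p)) := by
      rw [C.range_eq]
      rcases hz with ⟨a, ha, rfl⟩ | hz
      · exact Or.inl ⟨a, 0, by rw [(hroot a).2 ha]; simp, rfl⟩
      · exact Or.inr hz
    obtain ⟨p, rfl⟩ := hz'
    refine ⟨p, (key p).2 ?_, rfl⟩
    rcases hz with ⟨a, ha, h⟩ | h
    · exact Or.inr (Prod.ext_iff.1 h).2.symm
    · exact Or.inl (Prod.ext_iff.1 h).2

theorem ncard_weierstrass [T2Space X] (C : GenusTwoCurve r s t X) :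
    (C.weierstrass : Set X).ncard = 6 := by
  rw [← ncard_image_of_injective _ C.injective, weierstrass_eq, union_comm, singleton_union,
    ncard_insert_of_notMem, ncard_image_of_injective]
  · have hn := C.nodup
    have h5 : ({0, 1, r, s, t} : Set ℂ) = (([0, 1, r, s, t] : List ℂ).toFinset : Set ℂ) := by
      simp
    rw [h5, ncard_coe_finset, List.toFinset_card_of_nodup hn]
    rfl
  · intro a a' h
    exact OnePoint.coe_injective (Prod.ext_iff.1 h).1
  · rintro ⟨a, -, h⟩
    exact OnePoint.coe_ne_infty a (Prod.ext_iff.1 h).1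

end GenusTwoCurve

/-! ### Descent of even and odd functions to ℙ¹ -/

namespace GenusTwoCurve

open Filter Topology

section Descent

variable {r s t : ℂ} {X : Type u} [TopologicalSpace X] [T2Space X] [CompactSpace X]
  [ChartedSpace ℂ X] [IsManifold 𝓘(ℂ) ω X]

/-- Weierstrass points are isolated, as zeros of the locally injective odd function. -/
theorem eventually_ι_ne (C : GenusTwoCurve r s t X) (p : X) : ∀ᶠ q in 𝓝[≠] p, C.ι q ≠ q := by
  by_cases hp : C.ι p = p
  · obtain ⟨i, hi⟩ := exists_mem_lineBaseSet (C.π p)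
    obtain ⟨U, hU, hinj⟩ := C.exists_injOn_oddFun hi hp
    filter_upwards [nhdsWithin_le_nhds hU, self_mem_nhdsWithin,
      nhdsWithin_le_nhds (C.eventually_π_mem_lineBaseSet hi)] with q hq hne hqi h
    refine hne (hinj hq (mem_of_mem_nhds hU) ?_)
    rw [(C.oddFun_eq_zero_iff hi).2 hp, (C.oddFun_eq_zero_iff hqi).2 h]
  · have h : ∀ᶠ q in 𝓝 p, C.ι q ≠ q :=
      (isOpen_ne_fun C.continuous_ι continuous_id).mem_nhds hp
    exact h.filter_mono nhdsWithin_le_nhds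

theorem eventually_eventually_fiber (C : GenusTwoCurve r s t X) {P : X → Prop}
    {b : OnePoint ℂ} (H : ∀ᶠ c in 𝓝 b, ∀ q, C.π q = c → P q) {p : X} (hp : C.π p = b) :
    ∀ᶠ q in 𝓝 p, P q := by
  subst hp
  filter_upwards [C.continuous_π.continuousAt.eventually H] with q hq
  exact hq q rfl

theorem eq_of_π_eq (C : GenusTwoCurve r s t X) {p q : X} (hp : C.ι p = p) (h : C.π q = C.π p) :
    q = p := by
  rcases C.eq_or_eq_ι h with h | h
  · exact h
  · rw [h, hp]

theorem ι_ne (C : GenusTwoCurve r s t X) {p q : X} (hp : C.ι p ≠ p) (h : C.π q = C.π p) :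
    C.ι q ≠ q := fun hq => by
  have := C.eq_of_π_eq hq h.symm
  rw [this] at hp
  exact hp hq

/-- Off the branch points, compose with a local section of π. At a branch point, `A` is continuous
because π is closed and has a single point in the fibre, and it is holomorphic nearby, so the
singularity is removable. -/
theorem holFunAt_descend (C : GenusTwoCurve r s t X) {a : X → ℂ} {A : OnePoint ℂ → ℂ}
    {b : OnePoint ℂ} (ha : ∀ p, C.π p = b → HolFunAt a p)
    (hA : ∀ᶠ c in 𝓝 b, ∀ q, C.π q = c → a q = A c) : HolFunAt A b := by
  have key : ∀ p, C.ι p ≠ p → HolFunAt a p → (∀ᶠ q in 𝓝 p, a q = A (C.π q)) →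
      HolFunAt A (C.π p) := by
    intro p hp hap hev
    obtain ⟨σ, hσ, hσp, hσπ⟩ := C.exists_local_section hp
    have h1 : HolFunAt (fun c => a (σ c)) (C.π p) := by
      refine ContMDiffAt.comp (C.π p) ?_ hσ
      rwa [hσp]
    refine h1.congr_of_eventuallyEq ?_
    have h2 : Tendsto σ (𝓝 (C.π p)) (𝓝 p) := by
      have := hσ.continuousAt.tendsto
      rwa [hσp] at this
    filter_upwards [h2.eventually hev, hσπ] with c h3 h4
    rw [h3, h4]
  have hA' : ∀ᶠ c in 𝓝 b, ∀ q, C.π q = c → a q = A (C.π q) :=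
    hA.mono fun c hc q hq => by rw [hc q hq, hq]
  obtain ⟨p, rfl⟩ := C.π_surjective b
  by_cases hp : C.ι p = p
  · refine holFunAt_of_continuousAt ?_ ?_
    · rw [ContinuousAt, tendsto_def]
      intro N hN
      rw [← hA.self_of_nhds p rfl] at hN
      have h1 := C.eventually_fiber (P := fun q => a q ∈ N) (b := C.π p) (by
        intro q hq
        rw [C.eq_of_π_eq hp hq]
        exact (ha p rfl).continuousAt hN)
      filter_upwards [h1, hA] with c h2 h3
      obtain ⟨q, rfl⟩ := C.π_surjective c
      rw [mem_preimage, ← h3 q rfl]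
      exact h2 q rfl
    · have h1 := C.eventually_fiber
        (P := fun q => (q ≠ p → C.ι q ≠ q) ∧ HolFunAt a q ∧ ∀ᶠ q' in 𝓝 q, a q' = A (C.π q'))
        (b := C.π p) (by
        intro q hq
        rw [C.eq_of_π_eq hp hq]
        exact (eventually_nhdsWithin_iff.1 (C.eventually_ι_ne p)).and ((ha p rfl).eventually.and
          (C.eventually_eventually_fiber hA' rfl).eventually_nhds))
      filter_upwards [nhdsWithin_le_nhds h1, self_mem_nhdsWithin] with c h2 h3
      obtain ⟨q, rfl⟩ := C.π_surjective c
      obtain ⟨h4, h5, h6⟩ := h2 q rfl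
      refine key q (h4 ?_) h5 h6
      rintro rfl
      exact h3 rfl
  · exact key p hp (ha p rfl) (C.eventually_eventually_fiber hA' rfl)

/-- Even holomorphic functions on `X` descend to `ℙ¹`. -/
theorem exists_descend_even (C : GenusTwoCurve r s t X) {a : X → ℂ}
    {b : OnePoint ℂ} (ha : ∀ p, C.π p = b → HolFunAt a p)
    (heven : ∀ᶠ c in 𝓝 b, ∀ q, C.π q = c → a (C.ι q) = a q) :
    ∃ A : OnePoint ℂ → ℂ, HolFunAt A b ∧ ∀ᶠ c in 𝓝 b, ∀ q, C.π q = c → a q = A c := by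
  have h : ∀ᶠ c in 𝓝 b, ∀ q, C.π q = c → a q = a (Function.surjInv C.π_surjective c) := by
    filter_upwards [heven] with c hc q hq
    rcases C.eq_or_eq_ι ((Function.surjInv_eq C.π_surjective c).trans hq.symm) with h | h
    · rw [h]
    · rw [h, hc q hq]
  exact ⟨_, C.holFunAt_descend ha h, h⟩

/-- A fibre has one or two points; two points have disjoint neighbourhoods on which local solutions
are patched. The property `K` may depend only on the germ, which is the hypothesis `hK`. -/
theorem exists_glue (C : GenusTwoCurve r s t X) {Y : X → Type*} {K : X → (∀ q, Y q) → Prop}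
    {b : OnePoint ℂ} (hK : ∀ p a a', (∀ᶠ q in 𝓝 p, a q = a' q) → K p a → K p a')
    (H : ∀ p, C.π p = b → ∃ a, K p a) : ∃ a, ∀ p, C.π p = b → K p a := by
  classical
  obtain ⟨p, rfl⟩ := C.π_surjective b
  obtain ⟨a, ha⟩ := H p rfl
  by_cases hp : C.ι p = p
  · exact ⟨a, fun q hq => by rwa [C.eq_of_π_eq hp hq]⟩
  · obtain ⟨a', ha'⟩ := H (C.ι p) (C.π_ι p)
    obtain ⟨U, V, hU, hV, hpU, hpV, hUV⟩ := t2_separation hp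
    refine ⟨fun q => if q ∈ V then a q else a' q, fun q hq => ?_⟩
    rcases C.eq_or_eq_ι hq with rfl | rfl
    · refine hK _ _ _ ?_ ha
      filter_upwards [hV.mem_nhds hpV] with q hq
      rw [if_pos hq]
    · refine hK _ _ _ ?_ ha'
      filter_upwards [hU.mem_nhds hpU] with q hq
      rw [if_neg (disjoint_left.1 hUV hq)]

theorem oddFun_ne_zero (C : GenusTwoCurve r s t X) {i : Bool} {p : X}
    (hi : C.π p ∈ lineBaseSet i) (hp : C.ι p ≠ p) : C.oddFun i p ≠ 0 :=
  fun h => hp ((C.oddFun_eq_zero_iff hi).1 h)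

/-- Odd holomorphic functions on `X` are multiples of the odd function by functions on `ℙ¹`. -/
theorem exists_descend_odd (C : GenusTwoCurve r s t X) {k : X → ℂ}
    {b : OnePoint ℂ} {i : Bool} (hi : b ∈ lineBaseSet i) (hk : ∀ p, C.π p = b → HolFunAt k p)
    (hodd : ∀ᶠ c in 𝓝 b, ∀ q, C.π q = c → k (C.ι q) = - k q) :
    ∃ A : OnePoint ℂ → ℂ, HolFunAt A b ∧
      ∀ᶠ c in 𝓝 b, ∀ q, C.π q = c → k q = C.oddFun i q * A c := by
  -- First divide on X: at a Weierstrass point `k` vanishes and is divisible by the odd function,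
  -- elsewhere the odd function is a unit. The quotient of two odd functions is even off W, and
  -- evenness is trivial at fixed points, so it descends.
  obtain ⟨a, ha⟩ := C.exists_glue (Y := fun _ => ℂ) (b := b)
    (K := fun p a => HolFunAt a p ∧ ∀ᶠ q in 𝓝 p, k q = C.oddFun i q * a q)
    (fun p a a' h hK => ⟨hK.1.congr_of_eventuallyEq (h.mono fun _ h => h.symm), by
      filter_upwards [h, hK.2] with q h1 h2
      rw [h2, h1]⟩)
    (fun p hp => by
      subst hp
      have hhol := C.holFunAt_oddFun hi
      by_cases h : C.ι p = p
      · obtain ⟨U, hU, hinj⟩ := C.exists_injOn_oddFun hi h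
        refine hhol.exists_eq_mul ((C.oddFun_eq_zero_iff hi).2 h) hU hinj (hk p rfl) ?_
        have := hodd.self_of_nhds p rfl
        rw [h] at this
        exact self_eq_neg.1 this
      · have h0 := C.oddFun_ne_zero hi h
        refine ⟨fun q => k q * (C.oddFun i q)⁻¹, (hk p rfl).mul' (hhol.inv h0), ?_⟩
        filter_upwards [hhol.continuousAt.eventually_ne h0] with q hq
        field_simp)
  obtain ⟨A, hA, hA'⟩ := C.exists_descend_even (fun p hp => (ha p hp).1) (by
    have h1 := C.eventually_fiber (b := b) (fun p hp => (ha p hp).2)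
    filter_upwards [h1, hodd, (isOpen_lineBaseSet i).mem_nhds hi] with c h2 h3 h4 q hq
    by_cases h : C.ι q = q
    · rw [h]
    · subst hq
      have h5 := h2 (C.ι q) (C.π_ι q)
      rw [h3 q rfl, h2 q rfl, C.oddFun_ι] at h5
      have h6 := C.oddFun_ne_zero h4 h
      have h7 : C.oddFun i q * a q = C.oddFun i q * a (C.ι q) := by linear_combination -h5
      exact (mul_left_cancel₀ h6 h7).symm)
  refine ⟨A, hA, ?_⟩
  filter_upwards [C.eventually_fiber (b := b) (fun p hp => (ha p hp).2), hA'] with c h1 h2 q hq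
  rw [h1 q hq, h2 q hq]

end Descent

end GenusTwoCurve

/-! ### Germs of holomorphic sections and frames in rank two -/

namespace HolBundle

open Filter Topology

section Germs

variable {n : ℕ} {B : Type u} [TopologicalSpace B] [ChartedSpace ℂ B]

/-- A family of vectors `s q ∈ E_q` is holomorphic at the point `p`. -/
def HolAt (E : HolBundle.{u, v} n B) (s : ∀ q, E.fiber q) (p : B) : Prop :=
  ContMDiffAt 𝓘(ℂ) (𝓘(ℂ).prod 𝓘(ℂ, Fin n → ℂ)) ω (fun q => (⟨q, s q⟩ : E.Total)) p

/-- The coordinates of a family of vectors in the trivialization at `p`. -/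
noncomputable def trivCoord (E : HolBundle.{u, v} n B) (p : B) (s : ∀ q, E.fiber q) (q : B) :
    Fin n → ℂ :=
  (trivializationAt (Fin n → ℂ) E.fiber p ⟨q, s q⟩).2

/-- The trivialization at `p`, as a linear isomorphism on the fibre over `q`. -/
noncomputable def trivEquiv (E : HolBundle.{u, v} n B) {p q : B}
    (hq : q ∈ (trivializationAt (Fin n → ℂ) E.fiber p).baseSet) :
    E.fiber q ≃ₗ[ℂ] (Fin n → ℂ) :=
  (trivializationAt (Fin n → ℂ) E.fiber p).linearEquivAt ℂ q hq

theorem trivCoord_eq (E : HolBundle.{u, v} n B) {p q : B}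
    (hq : q ∈ (trivializationAt (Fin n → ℂ) E.fiber p).baseSet) (s : ∀ q, E.fiber q) :
    E.trivCoord p s q = E.trivEquiv hq (s q) := rfl

theorem holAt_iff (E : HolBundle.{u, v} n B) (s : ∀ q, E.fiber q) (p : B) :
    E.HolAt s p ↔ ContMDiffAt 𝓘(ℂ) 𝓘(ℂ, Fin n → ℂ) ω (E.trivCoord p s) p := by
  rw [HolAt, Bundle.contMDiffAt_section]
  rfl

theorem eventually_mem_baseSet' (E : HolBundle.{u, v} n B) (p : B) :
    ∀ᶠ q in 𝓝 p, q ∈ (trivializationAt (Fin n → ℂ) E.fiber p).baseSet :=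
  (trivializationAt (Fin n → ℂ) E.fiber p).open_baseSet.mem_nhds
    (FiberBundle.mem_baseSet_trivializationAt' p)

theorem self_mem_baseSet (E : HolBundle.{u, v} n B) (p : B) :
    p ∈ (trivializationAt (Fin n → ℂ) E.fiber p).baseSet :=
  FiberBundle.mem_baseSet_trivializationAt' p

variable {E : HolBundle.{u, v} n B} {s s' : ∀ q, E.fiber q} {p : B}

theorem HolAt.congr (hs : E.HolAt s p) (h : ∀ᶠ q in 𝓝 p, s' q = s q) : E.HolAt s' p :=
  ContMDiffAt.congr_of_eventuallyEq hs (h.mono fun q hq => by simp only [hq])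

theorem HolAt.add (hs : E.HolAt s p) (hs' : E.HolAt s' p) : E.HolAt (fun q => s q + s' q) p := by
  rw [holAt_iff] at *
  refine (ContMDiffAt.add hs hs').congr_of_eventuallyEq ?_
  filter_upwards [E.eventually_mem_baseSet' p] with q hq
  simp only [E.trivCoord_eq hq, map_add, Pi.add_apply]

theorem HolAt.smul {f : B → ℂ} (hf : HolFunAt f p) (hs : E.HolAt s p) :
    E.HolAt (fun q => f q • s q) p := by
  rw [holAt_iff] at *
  refine (ContMDiffAt.smul hf hs).congr_of_eventuallyEq ?_
  filter_upwards [E.eventually_mem_baseSet' p] with q hq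
  simp only [E.trivCoord_eq hq, map_smul, Pi.smul_apply']

theorem holAt_zero : E.HolAt (fun q => (0 : E.fiber q)) p := by
  rw [holAt_iff]
  refine (contMDiffAt_const (c := (0 : Fin n → ℂ))).congr_of_eventuallyEq ?_
  filter_upwards [E.eventually_mem_baseSet' p] with q hq
  simp only [E.trivCoord_eq hq, map_zero]

theorem HolAt.const_smul (c : ℂ) (hs : E.HolAt s p) : E.HolAt (fun q => c • s q) p :=
  hs.smul contMDiffAt_const

theorem holAt_sum {ι : Type*} [DecidableEq ι] (S : Finset ι) {σ : ι → ∀ q, E.fiber q}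
    (h : ∀ i, E.HolAt (σ i) p) : E.HolAt (fun q => ∑ i ∈ S, σ i q) p := by
  induction S using Finset.induction_on with
  | empty => simpa using holAt_zero
  | insert i S hi ih => simpa [Finset.sum_insert hi] using (h i).add ih

theorem exists_holAt_eq (E : HolBundle.{u, v} n B) (p : B) (e : E.fiber p) :
    ∃ s : ∀ q, E.fiber q, E.HolAt s p ∧ s p = e := by
  classical
  refine ⟨fun q => if hq : q ∈ (trivializationAt (Fin n → ℂ) E.fiber p).baseSet then
    (E.trivEquiv hq).symm (E.trivEquiv (E.self_mem_baseSet p) e) else 0, ?_, ?_⟩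
  · rw [holAt_iff]
    refine (contMDiffAt_const (c := E.trivEquiv (E.self_mem_baseSet p) e)).congr_of_eventuallyEq ?_
    filter_upwards [E.eventually_mem_baseSet' p] with q hq
    rw [E.trivCoord_eq hq, dif_pos hq, LinearEquiv.apply_symm_apply]
  · simp only
    rw [dif_pos (E.self_mem_baseSet p), LinearEquiv.symm_apply_apply]

theorem finrank_fiber (E : HolBundle.{u, v} n B) (p : B) : Module.finrank ℂ (E.fiber p) = n := by
  rw [(E.trivEquiv (E.self_mem_baseSet p)).finrank_eq]
  simp

theorem finiteDimensional_fiber (E : HolBundle.{u, v} n B) (p : B) :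
    FiniteDimensional ℂ (E.fiber p) :=
  Module.Finite.equiv (E.trivEquiv (E.self_mem_baseSet p)).symm

/-- Holomorphic families that agree near `p` except possibly at `p` agree at `p`. -/
theorem HolAt.eq_of_eventuallyEq (hs : E.HolAt s p) (hs' : E.HolAt s' p)
    (h : ∀ᶠ q in 𝓝[≠] p, s q = s' q) : s p = s' p := by
  rw [holAt_iff] at hs hs'
  have h1 := eq_of_eventuallyEq_nhdsNE hs.continuousAt hs'.continuousAt (h.mono fun q hq => by
    simp only [trivCoord, hq])
  rwa [E.trivCoord_eq (E.self_mem_baseSet p), E.trivCoord_eq (E.self_mem_baseSet p),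
    EmbeddingLike.apply_eq_iff_eq] at h1

variable [IsManifold 𝓘(ℂ) ω B]

theorem HolAt.eventually (hs : E.HolAt s p) : ∀ᶠ q in 𝓝 p, E.HolAt s q :=
  (contMDiffAt_iff_contMDiffAt_nhds (by simp)).1 hs

end Germs

section RankTwo

variable {B : Type u} [TopologicalSpace B] [ChartedSpace ℂ B]
variable {E : HolBundle.{u, v} 2 B} {e₁ e₂ s : ∀ q, E.fiber q} {p : B}

/-- Two holomorphic families independent at `p` form a holomorphic frame near `p`. -/
theorem HolAt.exists_coeff (h₁ : E.HolAt e₁ p) (h₂ : E.HolAt e₂ p)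
    (hli : LinearIndependent ℂ ![e₁ p, e₂ p]) (hs : E.HolAt s p) :
    ∃ a b : B → ℂ, HolFunAt a p ∧ HolFunAt b p ∧ ∀ᶠ q in 𝓝 p, s q = a q • e₁ q + b q • e₂ q := by
  rw [holAt_iff] at h₁ h₂ hs
  have hc : ∀ {σ : B → Fin 2 → ℂ} (_ : ContMDiffAt 𝓘(ℂ) 𝓘(ℂ, Fin 2 → ℂ) ω σ p) (k : Fin 2),
      HolFunAt (fun q => σ q k) p := fun hσ k => contMDiffAt_pi_space.1 hσ k
  -- Cramer's rule in the trivialization at `p`, with `D` the determinant of the coordinates of `e₁`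
  -- and `e₂`.
  set D : B → ℂ := fun q => E.trivCoord p e₁ q 0 * E.trivCoord p e₂ q 1 -
    E.trivCoord p e₁ q 1 * E.trivCoord p e₂ q 0 with hD
  have hDhol : HolFunAt D p :=
    ((hc h₁ 0).mul' (hc h₂ 1)).sub ((hc h₁ 1).mul' (hc h₂ 0))
  have hDp : D p ≠ 0 := by
    have h1 := hli.map' (E.trivEquiv (E.self_mem_baseSet p)).toLinearMap (LinearEquiv.ker _)
    have h2 : (E.trivEquiv (E.self_mem_baseSet p)).toLinearMap ∘ ![e₁ p, e₂ p] =
        Matrix.of ![E.trivCoord p e₁ p, E.trivCoord p e₂ p] := by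
      funext k
      fin_cases k <;> rfl
    rw [h2] at h1
    have h3 := (Matrix.linearIndependent_rows_iff_isUnit
      (A := Matrix.of ![E.trivCoord p e₁ p, E.trivCoord p e₂ p])).1 h1
    rw [Matrix.isUnit_iff_isUnit_det, Matrix.det_fin_two, isUnit_iff_ne_zero] at h3
    exact h3
  refine ⟨fun q => (E.trivCoord p s q 0 * E.trivCoord p e₂ q 1 -
      E.trivCoord p s q 1 * E.trivCoord p e₂ q 0) * (D q)⁻¹,
    fun q => (E.trivCoord p e₁ q 0 * E.trivCoord p s q 1 -
      E.trivCoord p e₁ q 1 * E.trivCoord p s q 0) * (D q)⁻¹,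
    HolFunAt.mul' (((hc hs 0).mul' (hc h₂ 1)).sub ((hc hs 1).mul' (hc h₂ 0))) (hDhol.inv hDp),
    HolFunAt.mul' (((hc h₁ 0).mul' (hc hs 1)).sub ((hc h₁ 1).mul' (hc hs 0))) (hDhol.inv hDp), ?_⟩
  filter_upwards [E.eventually_mem_baseSet' p, hDhol.continuousAt.eventually_ne hDp] with q hq hDq
  apply (E.trivEquiv hq).injective
  rw [map_add, map_smul, map_smul, ← E.trivCoord_eq hq, ← E.trivCoord_eq hq, ← E.trivCoord_eq hq]
  funext k
  fin_cases k
  · simp only [Fin.zero_eta, Pi.add_apply, Pi.smul_apply, smul_eq_mul]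
    field_simp
    simp only [hD]
    ring
  · simp only [Fin.mk_one, Pi.add_apply, Pi.smul_apply, smul_eq_mul]
    field_simp
    simp only [hD]
    ring

/-- Independence is nonvanishing of the determinant of the coordinates, which is continuous. -/
theorem HolAt.eventually_linearIndependent (h₁ : E.HolAt e₁ p) (h₂ : E.HolAt e₂ p)
    (hli : LinearIndependent ℂ ![e₁ p, e₂ p]) :
    ∀ᶠ q in 𝓝 p, LinearIndependent ℂ ![e₁ q, e₂ q] := by
  rw [holAt_iff] at h₁ h₂
  have hc : ContinuousAt (fun q => (Matrix.of ![E.trivCoord p e₁ q, E.trivCoord p e₂ q]).det) p := by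
    simp only [Matrix.det_fin_two]
    have h1 := fun k => (continuousAt_pi.1 h₁.continuousAt) k
    have h2 := fun k => (continuousAt_pi.1 h₂.continuousAt) k
    exact ((h1 0).mul (h2 1)).sub ((h2 0).mul (h1 1) |>.congr (by
      filter_upwards with q
      simp [mul_comm]))
  have key : ∀ q (hq : q ∈ (trivializationAt (Fin 2 → ℂ) E.fiber p).baseSet),
      LinearIndependent ℂ ![e₁ q, e₂ q] ↔
        (Matrix.of ![E.trivCoord p e₁ q, E.trivCoord p e₂ q]).det ≠ 0 := by
    intro q hq
    rw [← LinearMap.linearIndependent_iff (E.trivEquiv hq).toLinearMap (LinearEquiv.ker _),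
      ← isUnit_iff_ne_zero, ← Matrix.isUnit_iff_isUnit_det,
      ← Matrix.linearIndependent_rows_iff_isUnit]
    have h2 : (E.trivEquiv hq).toLinearMap ∘ ![e₁ q, e₂ q] =
        Matrix.of ![E.trivCoord p e₁ q, E.trivCoord p e₂ q] := by
      funext k
      fin_cases k <;> rfl
    rw [h2]
    rfl
  filter_upwards [hc.eventually_ne ((key p (E.self_mem_baseSet p)).1 hli),
    E.eventually_mem_baseSet' p] with q h1 h2
  exact (key q h2).2 h1

end RankTwo

section Sections

variable {n : ℕ} {B : Type u} [TopologicalSpace B] [ChartedSpace ℂ B]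

open Classical in
/-- The extension by zero of a family of vectors over `U`. -/
noncomputable def extend (E : HolBundle.{u, v} n B) {U : Opens B} (s : ∀ q : U, E.fiber q) (q : B) :
    E.fiber q :=
  if hq : q ∈ U then s ⟨q, hq⟩ else 0

theorem extend_apply (E : HolBundle.{u, v} n B) {U : Opens B} (s : ∀ q : U, E.fiber q) {q : B}
    (hq : q ∈ U) : E.extend s q = s ⟨q, hq⟩ := dif_pos hq

theorem isHolSection_restrict_iff (E : HolBundle.{u, v} n B) (U : Opens B) (s : ∀ q, E.fiber q) :
    E.IsHolSection U (fun q => s q) ↔ ∀ p ∈ U, E.HolAt s p := by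
  rw [IsHolSection]
  constructor
  · intro h p hp
    exact (contMDiffAt_subtype_iff (U := U) (f := fun q => (⟨q, s q⟩ : E.Total))).1 (h ⟨p, hp⟩)
  · intro h p
    exact (contMDiffAt_subtype_iff (U := U) (f := fun q => (⟨q, s q⟩ : E.Total))).2 (h p p.2)

theorem isHolSection_iff_extend (E : HolBundle.{u, v} n B) {U : Opens B} (s : ∀ q : U, E.fiber q) :
    E.IsHolSection U s ↔ ∀ p ∈ U, E.HolAt (E.extend s) p := by
  rw [← isHolSection_restrict_iff]
  have : s = fun q : U => E.extend s q := by
    funext q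
    exact (E.extend_apply s q.2).symm
  rw [← this]

theorem holAt_extend (E : HolBundle.{u, v} n B) {U : Opens B} (s : E.sections U) {p : B}
    (hp : p ∈ U) : E.HolAt (E.extend s.1) p :=
  (E.isHolSection_iff_extend s.1).1 s.2 p hp

/-- The holomorphic section over `U` given by a family holomorphic at the points of `U`. -/
def mkSection (E : HolBundle.{u, v} n B) (U : Opens B) (s : ∀ q, E.fiber q)
    (hs : ∀ p ∈ U, E.HolAt s p) : E.sections U :=
  ⟨fun q => s q, (E.isHolSection_restrict_iff U s).2 hs⟩

theorem contMDiff_restrict_iff {U : Opens B} {f : B → ℂ} :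
    ContMDiff 𝓘(ℂ) 𝓘(ℂ) ω (fun q : U => f q) ↔ ∀ p ∈ U, HolFunAt f p :=
  ⟨fun h p hp => contMDiffAt_subtype_iff.1 (h ⟨p, hp⟩),
    fun h p => contMDiffAt_subtype_iff.2 (h p p.2)⟩

/-- The holomorphic function on `U` given by a function holomorphic at the points of `U`. -/
def mkFun (U : Opens B) (f : B → ℂ) (hf : ∀ p ∈ U, HolFunAt f p) : C^ω⟮𝓘(ℂ), U; 𝓘(ℂ), ℂ⟯ :=
  ⟨fun q => f q, contMDiff_restrict_iff.2 hf⟩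

theorem holAt_pullback {B' : Type u'} [TopologicalSpace B'] [ChartedSpace ℂ B']
    {E : HolBundle.{u, v} n B} {f : C^ω⟮𝓘(ℂ), B'; 𝓘(ℂ), B⟯} {s : ∀ q, E.fiber q} {p : B'}
    (hs : E.HolAt s (f p)) : (E.pullback f).HolAt (fun q => s (f q)) p := by
  rw [holAt_iff] at hs
  have h : ContMDiffAt 𝓘(ℂ) 𝓘(ℂ, Fin n → ℂ) ω (E.trivCoord (f p) s ∘ f) p :=
    ContMDiffAt.comp p hs (f.contMDiff p)
  exact (holAt_iff _ _ _).2 h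

end Sections

end HolBundle

/-! ### Pairs of vectors in a plane and eigenlines with eigenvalues ±1 -/

section LinearAlgebra

variable {V V' : Type*} [AddCommGroup V] [Module ℂ V] [AddCommGroup V'] [Module ℂ V']

theorem linearIndependent_pair_map {x y : V} (h : LinearIndependent ℂ ![x, y]) (φ : V ≃ₗ[ℂ] V') :
    LinearIndependent ℂ ![φ x, φ y] := by
  rw [LinearIndependent.pair_iff] at *
  intro a b hab
  refine h a b (φ.injective ?_)
  simpa using hab

theorem linearIndependent_pair_smul_iff {x y : V} {c : ℂ} (hc : c ≠ 0) :
    LinearIndependent ℂ ![x, c • y] ↔ LinearIndependent ℂ ![x, y] := by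
  simp only [LinearIndependent.pair_iff]
  constructor
  · intro h a b hab
    have h1 := h a (b * c⁻¹) (by rw [smul_smul, mul_assoc, inv_mul_cancel₀ hc, mul_one, hab])
    exact ⟨h1.1, (mul_eq_zero.1 h1.2).resolve_right (inv_ne_zero hc)⟩
  · intro h a b hab
    have h1 := h a (b * c) (by rw [← smul_smul, hab])
    exact ⟨h1.1, (mul_eq_zero.1 h1.2).resolve_right hc⟩

theorem eq_and_eq_of_linearIndependent_pair {x y : V} (h : LinearIndependent ℂ ![x, y])
    {a b a' b' : ℂ} (hab : a • x + b • y = a' • x + b' • y) : a = a' ∧ b = b' := by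
  rw [LinearIndependent.pair_iff] at h
  have := h (a - a') (b - b') (by
    rw [sub_smul, sub_smul]
    linear_combination (norm := module) hab)
  exact ⟨sub_eq_zero.1 this.1, sub_eq_zero.1 this.2⟩

theorem exists_coeff_of_linearIndependent_pair (hV : Module.finrank ℂ V = 2) {x y : V}
    (h : LinearIndependent ℂ ![x, y]) (z : V) : ∃ a b : ℂ, z = a • x + b • y := by
  have : FiniteDimensional ℂ V := Module.finite_of_finrank_pos (by omega)
  have h1 := h.span_eq_top_of_card_eq_finrank (by simp [hV])
  have h2 : z ∈ Submodule.span ℂ (range ![x, y]) := h1 ▸ Submodule.mem_top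
  rw [Matrix.range_cons, Matrix.range_cons, Matrix.range_empty, union_empty,
    singleton_union, Submodule.mem_span_pair] at h2
  obtain ⟨a, b, h⟩ := h2
  exact ⟨a, b, h.symm⟩

/-- Ordering the eigenvectors as (ε, -ε) rather than (1, -1) lets both descents be treated at once.
-/
theorem exists_eigenvector_pair {M : Module.End ℂ V} {ε : ℂ} (hε : ε = 1 ∨ ε = -1)
    (h1 : M.HasEigenvalue 1) (h2 : M.HasEigenvalue (-1)) :
    ∃ x y : V, LinearIndependent ℂ ![x, y] ∧ M x = ε • x ∧ M y = -ε • y := by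
  have key : ∀ ε : ℂ, ε ≠ 0 → M.HasEigenvalue ε → M.HasEigenvalue (-ε) →
      ∃ x y : V, LinearIndependent ℂ ![x, y] ∧ M x = ε • x ∧ M y = -ε • y := by
    intro ε h0 h1 h2
    obtain ⟨x, hx⟩ := h1.exists_hasEigenvector
    obtain ⟨y, hy⟩ := h2.exists_hasEigenvector
    refine ⟨x, y, ?_, hx.apply_eq_smul, hy.apply_eq_smul⟩
    rw [LinearIndependent.pair_iff]
    intro a b hab
    have h3 := congrArg M hab
    rw [map_add, map_smul, map_smul, map_zero, hx.apply_eq_smul, hy.apply_eq_smul] at h3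
    have h4 : (2 * ε * a) • x = 0 := by
      linear_combination (norm := module) ε • hab + h3
    have h5 : (2 * ε * b) • y = 0 := by
      linear_combination (norm := module) ε • hab - h3
    constructor
    · simpa [h0, hx.2] using h4
    · simpa [h0, hy.2] using h5
  rcases hε with rfl | rfl
  · exact key 1 one_ne_zero h1 h2
  · exact key (-1) (neg_ne_zero.2 one_ne_zero) h2 (by rwa [neg_neg])

theorem eigenspace_eq_span_singleton (hV : Module.finrank ℂ V = 2) {M : Module.End ℂ V} {ε : ℂ}
    (hε : ε ≠ 0) {x y : V} (hxy : LinearIndependent ℂ ![x, y]) (hx : M x = ε • x)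
    (hy : M y = -ε • y) : Module.End.eigenspace M ε = Submodule.span ℂ {x} := by
  ext z
  rw [Module.End.mem_eigenspace_iff, Submodule.mem_span_singleton]
  constructor
  · intro hz
    obtain ⟨a, b, rfl⟩ := exists_coeff_of_linearIndependent_pair hV hxy z
    rw [map_add, map_smul, map_smul, hx, hy] at hz
    have h1 : (a * ε) • x + (-(b * ε)) • y = (a * ε) • x + (b * ε) • y := by
      linear_combination (norm := module) hz
    have h2 := (eq_and_eq_of_linearIndependent_pair hxy h1).2
    have h3 : b = 0 := by
      have h4 : b * ε = 0 := by linear_combination - h2 / 2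
      exact (mul_eq_zero.1 h4).resolve_right hε
    exact ⟨a, by simp [h3]⟩
  · rintro ⟨a, rfl⟩
    rw [map_smul, hx, smul_comm]

end LinearAlgebra

/-! ### The involution on families of vectors induced by the lift -/

namespace HyperellipticLift

open Filter Topology

variable {r s t : ℂ} {X : Type u} [TopologicalSpace X] [T2Space X]
  [ChartedSpace ℂ X] {C : GenusTwoCurve r s t X} {E : HolBundle.{u, v} 2 X}

/-- The action of the lift on families of vectors: `σ ↦ h⁻¹ ∘ ι^* σ`. -/
noncomputable def transfer (h : HyperellipticLift C E) (σ : ∀ q, E.fiber q) (q : X) : E.fiber q :=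
  (h.map q).symm (σ (C.ι q))

/-- The equality lives in the total space because ι(ι q) is not definitionally q. It rewrites h⁻¹ ∘
ι^* through h itself, so that holomorphy of h suffices for `holAt_transfer`. -/
theorem map_mk_ι (h : HyperellipticLift C E) (σ : ∀ q, E.fiber q) (q : X) :
    (⟨C.ι (C.ι q), h.map (C.ι q) (σ (C.ι q))⟩ : E.Total) = ⟨q, h.transfer σ q⟩ := by
  have := h.involutive q (h.transfer σ q)
  rwa [transfer, LinearEquiv.apply_symm_apply] at this

theorem transfer_ι (h : HyperellipticLift C E) (σ : ∀ q, E.fiber q) (q : X) :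
    h.transfer σ (C.ι q) = h.map q (σ q) := by
  have h1 := h.map_mk_ι σ (C.ι q)
  have h2 : (⟨C.ι (C.ι (C.ι q)), h.map (C.ι (C.ι q)) (σ (C.ι (C.ι q)))⟩ : E.Total) =
      ⟨C.ι q, h.map q (σ q)⟩ :=
    congrArg (fun q' => (⟨C.ι q', h.map q' (σ q')⟩ : E.Total)) (C.ι_ι q)
  rw [h2] at h1
  exact (Bundle.TotalSpace.mk_injective _ h1).symm

theorem transfer_transfer (h : HyperellipticLift C E) (σ : ∀ q, E.fiber q) (q : X) :
    h.transfer (h.transfer σ) q = σ q := by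
  change (h.map q).symm (h.transfer σ (C.ι q)) = σ q
  rw [transfer_ι, LinearEquiv.symm_apply_apply]

theorem transfer_add (h : HyperellipticLift C E) (σ τ : ∀ q, E.fiber q) (q : X) :
    h.transfer (fun q => σ q + τ q) q = h.transfer σ q + h.transfer τ q :=
  map_add _ _ _

theorem transfer_smul (h : HyperellipticLift C E) (f : X → ℂ) (σ : ∀ q, E.fiber q) (q : X) :
    h.transfer (fun q => f q • σ q) q = f (C.ι q) • h.transfer σ q :=
  map_smul _ _ _

theorem holAt_transfer (h : HyperellipticLift C E) {σ : ∀ q, E.fiber q} {p : X}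
    (hσ : E.HolAt σ (C.ι p)) : E.HolAt (h.transfer σ) p := by
  have h1 : ContMDiffAt 𝓘(ℂ) (𝓘(ℂ).prod 𝓘(ℂ, Fin 2 → ℂ)) ω
      (fun q => (⟨C.ι q, σ (C.ι q)⟩ : E.Total)) p :=
    ContMDiffAt.comp (g := fun q => (⟨q, σ q⟩ : E.Total)) p hσ (C.ι.contMDiff p)
  have h2 := (h.holomorphic ⟨C.ι p, σ (C.ι p)⟩).comp p h1
  refine ContMDiffAt.congr_of_eventuallyEq h2 (Eventually.of_forall fun q => ?_)
  exact (h.map_mk_ι σ q).symm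

/-- As ε is its own inverse, the defining condition of the descent says that the family is an
ε-eigenvector of `transfer`. -/
theorem map_eq_iff (h : HyperellipticLift C E) {ε : ℂ} (hε : ε * ε = 1) (σ : ∀ q, E.fiber q)
    (p : X) : h.map p (σ p) = ε • σ (C.ι p) ↔ h.transfer σ p = ε • σ p := by
  rw [transfer, LinearEquiv.symm_apply_eq, map_smul]
  constructor
  · intro h1
    rw [h1, smul_smul, hε, one_smul]
  · intro h1
    rw [h1, smul_smul, hε, one_smul]

theorem fiberEnd_apply (h : HyperellipticLift C E) (w : C.weierstrass) (σ : ∀ q, E.fiber q) :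
    C.fiberEnd E h.map w (σ w) = h.transfer σ w := by
  -- The cast along ι w = w is removed by generalizing the endpoint; evaluating a family at both
  -- ends makes this possible.
  have key : ∀ (q q' : X) (e : q = q') (τ : ∀ q, E.fiber q),
      LinearEquiv.cast (R := ℂ) (M := E.fiber) e (τ q) = τ q' := by
    rintro q _ rfl τ
    rfl
  change LinearEquiv.cast (R := ℂ) (M := E.fiber) w.2 (h.map w (σ w)) = _
  rw [← h.transfer_ι]
  exact key _ _ w.2 (h.transfer σ)

end HyperellipticLift

/-! ### Local frames of the sheaf of equivariant sections -/

/-- The index of the preferred affine chart of `ℙ¹` around a point. -/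
def patchIndex (b : OnePoint ℂ) : Bool := b.elim true fun _ => false

theorem mem_lineBaseSet_patchIndex (b : OnePoint ℂ) : b ∈ lineBaseSet (patchIndex b) :=
  (lineBundleCore 0).mem_baseSet_at b

section Frames

open Filter Topology

variable {r s t : ℂ} {X : Type u} [TopologicalSpace X] [T2Space X] [CompactSpace X]
  [ChartedSpace ℂ X] [IsManifold 𝓘(ℂ) ω X]
  {C : GenusTwoCurve r s t X} {E : HolBundle.{u, v} 2 X} {h : HyperellipticLift C E} {ε : ℂ}

/-- A pair of equivariant families that is, near the point `b` of `ℙ¹`, a frame of the sheaf of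
equivariant sections of `π_* E`. -/
structure IsDescentFrame (h : HyperellipticLift C E) (ε : ℂ) (f : Fin 2 → ∀ q, E.fiber q)
    (b : OnePoint ℂ) : Prop where
  hol : ∀ p, C.π p = b → ∀ k, E.HolAt (f k) p
  equivariant : ∀ᶠ c in 𝓝 b, ∀ q, C.π q = c → ∀ k, h.transfer (f k) q = ε • f k q
  linearIndependent : ∀ᶠ c in 𝓝 b, ∀ q, C.π q = c → C.ι q ≠ q →
    LinearIndependent ℂ ![f 0 q, f 1 q]
  branch : ∀ p, C.π p = b → C.ι p = p → ∃ g : ∀ q, E.fiber q, E.HolAt g p ∧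
    (∀ᶠ q in 𝓝 p, f 1 q = C.oddFun (patchIndex b) q • g q) ∧
    LinearIndependent ℂ ![f 0 p, g p] ∧ h.transfer g p = -ε • g p

theorem GenusTwoCurve.eventually_fiber_ι_ne (C : GenusTwoCurve r s t X) (b : OnePoint ℂ) :
    ∀ᶠ c in 𝓝[≠] b, ∀ q, C.π q = c → C.ι q ≠ q := by
  rw [eventually_nhdsWithin_iff]
  have h1 := C.eventually_fiber (b := b) (P := fun q => C.π q ≠ b → C.ι q ≠ q) (by
    intro p hp
    filter_upwards [eventually_nhdsWithin_iff.1 (C.eventually_ι_ne p)] with q hq hne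
    refine hq ?_
    rintro rfl
    exact hne hp)
  filter_upwards [h1] with c h2 hc q hq
  exact h2 q hq (by rwa [hq])

namespace IsDescentFrame

/-- Branch points are isolated, so at nearby points other than `b` the `branch` clause is vacuous.
-/
theorem eventually {f : Fin 2 → ∀ q, E.fiber q} {b : OnePoint ℂ} (hf : IsDescentFrame h ε f b) :
    ∀ᶠ c in 𝓝 b, IsDescentFrame h ε f c := by
  have h1 := C.eventually_fiber (b := b) (P := fun q => ∀ k, E.HolAt (f k) q)
    fun p hp => eventually_all.2 fun k => (hf.hol p hp k).eventually
  have h2 := eventually_nhdsWithin_iff.1 (C.eventually_fiber_ι_ne b)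
  filter_upwards [h1, h2, hf.equivariant.eventually_nhds, hf.linearIndependent.eventually_nhds]
    with c h3 h4 h5 h6
  refine ⟨h3, h5, h6, fun p hp hι => ?_⟩
  by_cases hc : c = b
  · subst hc
    exact hf.branch p hp hι
  · exact absurd hι (h4 hc p hp)

/-- An equivariant section is a combination of the frame with coefficients from `ℙ¹`. -/
theorem exists_coeff (hε : ε = 1 ∨ ε = -1) {f : Fin 2 → ∀ q, E.fiber q} {b : OnePoint ℂ}
    (hf : IsDescentFrame h ε f b) {τ : ∀ q, E.fiber q} (hτ : ∀ p, C.π p = b → E.HolAt τ p)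
    (heq : ∀ᶠ c in 𝓝 b, ∀ q, C.π q = c → h.transfer τ q = ε • τ q) :
    ∃ A : Fin 2 → OnePoint ℂ → ℂ, (∀ k, HolFunAt (A k) b) ∧
      ∀ᶠ c in 𝓝 b, ∀ q, C.π q = c → τ q = A 0 c • f 0 q + A 1 c • f 1 q := by
  have hε0 : ε ≠ 0 := by rcases hε with rfl | rfl <;> simp
  obtain ⟨a, ha⟩ := C.exists_glue (Y := fun _ => ℂ × ℂ) (b := b)
    (K := fun p a => (HolFunAt (fun q => (a q).1) p ∧ HolFunAt (fun q => (a q).2) p) ∧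
      ∀ᶠ q in 𝓝 p, τ q = (a q).1 • f 0 q + (a q).2 • f 1 q)
    (fun p a a' h hK => ⟨⟨hK.1.1.congr_of_eventuallyEq (h.mono fun _ h => by simp only [h]),
        hK.1.2.congr_of_eventuallyEq (h.mono fun _ h => by simp only [h])⟩, by
      filter_upwards [h, hK.2] with q h1 h2
      rw [h2, h1]⟩)
    (fun p hp => by
      subst hp
      by_cases hι : C.ι p = p
      · obtain ⟨g, hg, hfg, hli, hTg⟩ := hf.branch p rfl hι
        obtain ⟨a, β, hahol, hβhol, hτa⟩ := (hf.hol p rfl 0).exists_coeff hg hli (hτ p rfl)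
        -- On the fibre over the fixed point, `transfer` multiplies `f 0` by ε and `g` by -ε, so an
        -- ε-eigenvector has no `g`-component.
        have hβ0 : β p = 0 := by
          have h1 := heq.self_of_nhds p rfl
          have h2 := hf.equivariant.self_of_nhds p rfl 0
          have h3 := hτa.self_of_nhds
          have h4 : h.transfer τ p = a p • h.transfer (f 0) p + β p • h.transfer g p := by
            have h5 : τ (C.ι p) = a p • f 0 (C.ι p) + β p • g (C.ι p) := by
              rw [hι]; exact h3
            rw [HyperellipticLift.transfer, h5, map_add, map_smul, map_smul]
            rfl
          rw [h1, h2, hTg, h3] at h4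
          have h6 : (a p) • f 0 p + (β p) • g p = (a p) • f 0 p + (-β p) • g p := by
            apply smul_right_injective _ hε0
            simp only
            rw [h4]
            module
          have h7 := (eq_and_eq_of_linearIndependent_pair hli h6).2
          exact self_eq_neg.1 h7
        -- Since `β` vanishes at `p`, it is divisible by the odd function, and the factor turns `g`
        -- into `f 1`.
        obtain ⟨U, hU, hinj⟩ := C.exists_injOn_oddFun (mem_lineBaseSet_patchIndex (C.π p)) hι
        obtain ⟨b', hb', hβb'⟩ := (C.holFunAt_oddFun (mem_lineBaseSet_patchIndex _)).exists_eq_mul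
          ((C.oddFun_eq_zero_iff (mem_lineBaseSet_patchIndex _)).2 hι) hU hinj hβhol hβ0
        refine ⟨fun q => (a q, b' q), ⟨hahol, hb'⟩, ?_⟩
        filter_upwards [hτa, hβb', hfg] with q h1 h2 h3
        rw [h1, h2, h3, smul_smul, mul_comm]
      · obtain ⟨a, b, h1, h2, h3⟩ := (hf.hol p rfl 0).exists_coeff (hf.hol p rfl 1)
          (hf.linearIndependent.self_of_nhds p rfl hι) (hτ p rfl)
        exact ⟨fun q => (a q, b q), ⟨h1, h2⟩, h3⟩)
  -- Applying `transfer` to the expansion replaces `a q` by `a (ι q)`; uniqueness of coefficients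
  -- off W gives evenness.
  have heven : ∀ᶠ c in 𝓝 b, ∀ q, C.π q = c → a (C.ι q) = a q := by
    filter_upwards [C.eventually_fiber (b := b) (fun p hp => (ha p hp).2), heq, hf.equivariant,
      hf.linearIndependent] with c h1 h2 h3 h4 q hq
    by_cases hι : C.ι q = q
    · rw [hι]
    · subst hq
      have h5 : h.transfer τ q =
          (a (C.ι q)).1 • h.transfer (f 0) q + (a (C.ι q)).2 • h.transfer (f 1) q := by
        rw [HyperellipticLift.transfer, h1 (C.ι q) (C.π_ι q), map_add, map_smul, map_smul]
        rfl
      rw [h2 q rfl, h3 q rfl, h3 q rfl, h1 q rfl] at h5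
      have h6 : (a q).1 • f 0 q + (a q).2 • f 1 q =
          (a (C.ι q)).1 • f 0 q + (a (C.ι q)).2 • f 1 q := by
        apply smul_right_injective _ hε0
        simp only
        rw [h5]
        module
      have h7 := eq_and_eq_of_linearIndependent_pair (h4 q rfl hι) h6
      exact (Prod.ext h7.1 h7.2).symm
  obtain ⟨A, hA, hA'⟩ := C.exists_descend_even (fun p hp => (ha p hp).1.1)
    (heven.mono fun c hc q hq => by rw [hc q hq])
  obtain ⟨A₁, hA₁, hA₁'⟩ := C.exists_descend_even (fun p hp => (ha p hp).1.2)
    (heven.mono fun c hc q hq => by rw [hc q hq])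
  refine ⟨![A, A₁], fun k => by fin_cases k <;> assumption, ?_⟩
  filter_upwards [C.eventually_fiber (b := b) (fun p hp => (ha p hp).2), hA', hA₁']
    with c h1 h2 h3 q hq
  simp only [Matrix.cons_val_zero, Matrix.cons_val_one]
  rw [h1 q hq, h2 q hq, h3 q hq]

/-- At a branch point the frame vectors are dependent in E, so coefficients are compared at nearby
points, where they are unique, and equality at `b` follows by continuity. -/
theorem coeff_unique {f : Fin 2 → ∀ q, E.fiber q} {b : OnePoint ℂ}
    (hf : IsDescentFrame h ε f b) {A A' : Fin 2 → OnePoint ℂ → ℂ} (hA : ∀ k, HolFunAt (A k) b)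
    (hA' : ∀ k, HolFunAt (A' k) b)
    (heq : ∀ᶠ c in 𝓝 b, ∀ q, C.π q = c →
      A 0 c • f 0 q + A 1 c • f 1 q = A' 0 c • f 0 q + A' 1 c • f 1 q) (k : Fin 2) :
    A k b = A' k b := by
  refine eq_of_eventuallyEq_nhdsNE (hA k).continuousAt (hA' k).continuousAt ?_
  filter_upwards [C.eventually_fiber_ι_ne b, nhdsWithin_le_nhds heq,
    nhdsWithin_le_nhds hf.linearIndependent] with c h1 h2 h3
  obtain ⟨q, rfl⟩ := C.π_surjective c
  have h4 := eq_and_eq_of_linearIndependent_pair (h3 q rfl (h1 q rfl)) (h2 q rfl)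
  fin_cases k
  · exact h4.1
  · exact h4.2

end IsDescentFrame

/-- For an involution T and ε² = 1, the operator 1 + εT has values in the ε-eigenspace. The scalar
is left free: 1 suits sections supported on one sheet, 1/2 keeps the value of an eigenvector at a
fixed point. -/
theorem HyperellipticLift.transfer_average (h : HyperellipticLift C E) (hε : ε * ε = 1) (c : ℂ)
    (σ : ∀ q, E.fiber q) (q : X) :
    h.transfer (fun q => c • (σ q + ε • h.transfer σ q)) q =
      ε • c • (σ q + ε • h.transfer σ q) := by
  rw [h.transfer_smul (fun _ => c), h.transfer_add, h.transfer_smul (fun _ => ε),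
    h.transfer_transfer, smul_comm ε c, smul_add ε, smul_smul ε ε, hε, one_smul, add_comm (h.transfer σ q)]

theorem HyperellipticLift.holAt_average (h : HyperellipticLift C E) (c : ℂ) {σ : ∀ q, E.fiber q}
    {p : X} (hσ : E.HolAt σ p) (hσ' : E.HolAt σ (C.ι p)) :
    E.HolAt (fun q => c • (σ q + ε • h.transfer σ q)) p :=
  (hσ.add ((h.holAt_transfer hσ').const_smul ε)).const_smul c

/-- Take a frame of E near `p`, extend it by zero near ι p, and average with scalar 1: near `p`
nothing changes, and the values on the other sheet are then forced. -/
theorem exists_isDescentFrame_of_ι_ne (h : HyperellipticLift C E) (hε : ε = 1 ∨ ε = -1) {p : X}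
    (hp : C.ι p ≠ p) : ∃ f, IsDescentFrame h ε f (C.π p) := by
  classical
  have hεε : ε * ε = 1 := by rcases hε with rfl | rfl <;> simp
  have hε0 : ε ≠ 0 := by rintro rfl; simp at hεε
  obtain ⟨B⟩ : Nonempty (Module.Basis (Fin 2) ℂ (E.fiber p)) :=
    ⟨(Pi.basisFun ℂ (Fin 2)).map (E.trivEquiv (E.self_mem_baseSet p)).symm⟩
  have hs : ∀ k, ∃ σ : ∀ q, E.fiber q, E.HolAt σ p ∧ σ p = B k := fun k => E.exists_holAt_eq p (B k)
  choose e he hep using hs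
  have hσ : ∀ k, ∃ σ : ∀ q, E.fiber q, ∀ p', C.π p' = C.π p → E.HolAt σ p' ∧
      ∀ᶠ q in 𝓝 p', σ q = if p' = p then e k q else 0 := by
    intro k
    refine C.exists_glue (Y := E.fiber) (b := C.π p) (K := fun p' σ => E.HolAt σ p' ∧
      ∀ᶠ q in 𝓝 p', σ q = if p' = p then e k q else 0) ?_ ?_
    · intro p' a a' haa hK
      refine ⟨hK.1.congr (haa.mono fun q hq => hq.symm), ?_⟩
      filter_upwards [haa, hK.2] with q h1 h2
      rw [← h1, h2]
    · intro p' hp'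
      by_cases hpp : p' = p
      · subst hpp
        exact ⟨e k, he k, by simp⟩
      · exact ⟨fun q => 0, HolBundle.holAt_zero, by simp [hpp]⟩
  choose σ hσ using hσ
  set f : Fin 2 → ∀ q, E.fiber q := fun k q => (1 : ℂ) • (σ k q + ε • h.transfer (σ k) q) with hf
  have hι : Tendsto C.ι (𝓝 p) (𝓝 (C.ι p)) := C.continuous_ι.continuousAt
  have hfe : ∀ k, ∀ᶠ q in 𝓝 p, f k q = e k q := by
    intro k
    filter_upwards [(hσ k p rfl).2, hι.eventually (hσ k (C.ι p) (C.π_ι p)).2] with q h1 h2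
    rw [if_pos rfl] at h1
    rw [if_neg hp] at h2
    simp only [hf, HyperellipticLift.transfer]
    rw [h1, h2, map_zero, smul_zero, add_zero, one_smul]
  have heq : ∀ q k, h.transfer (f k) q = ε • f k q := fun q k => h.transfer_average hεε 1 (σ k) q
  have hep' : ![e 0 p, e 1 p] = B := by
    funext k
    fin_cases k
    · exact hep 0
    · exact hep 1
  have hli : ∀ᶠ q in 𝓝 p, LinearIndependent ℂ ![f 0 q, f 1 q] := by
    have h1 := (he 0).eventually_linearIndependent (he 1) (by
      rw [hep']
      exact B.linearIndependent)
    filter_upwards [h1, hfe 0, hfe 1] with q h2 h3 h4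
    rwa [h3, h4]
  -- Equivariance expresses the values at `q` through those at ι q by one linear isomorphism, so
  -- independence passes to the other sheet.
  have hliι : ∀ q, LinearIndependent ℂ ![f 0 (C.ι q), f 1 (C.ι q)] →
      LinearIndependent ℂ ![f 0 q, f 1 q] := by
    intro q hq
    have h1 : ∀ k, f k q = ((h.map q).symm.trans (LinearEquiv.smulOfNeZero ℂ _ ε hε0)) (f k (C.ι q)) := by
      intro k
      have h2 : ε • h.transfer (f k) q = f k q := by rw [heq, smul_smul, hεε, one_smul]
      exact h2.symm
    rw [h1 0, h1 1]
    exact linearIndependent_pair_map hq _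
  refine ⟨f, ?_, Eventually.of_forall fun c q _ k => heq q k, ?_, ?_⟩
  · intro p' hp' k
    exact h.holAt_average 1 (hσ k p' hp').1 (hσ k (C.ι p') (by rw [C.π_ι, hp'])).1
  · have h1 := C.eventually_fiber (b := C.π p) (P := fun q => LinearIndependent ℂ ![f 0 q, f 1 q]) (by
      intro p' hp'
      rcases C.eq_or_eq_ι hp' with rfl | rfl
      · exact hli
      · have h2 : Tendsto C.ι (𝓝 (C.ι p)) (𝓝 p) := by
          have := C.continuous_ι.tendsto (C.ι p)
          rwa [C.ι_ι] at this
        exact (h2.eventually hli).mono hliι)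
    filter_upwards [h1] with c h2 q hq _
    exact h2 q hq
  · intro p' hp' hι
    exact absurd hι (C.ι_ne hp hp')

/-- Averaging extensions of an eigenbasis with signs ε and -ε keeps the values at `p` and gives `f₀`
equivariant and `g` anti-equivariant; multiplying `g` by the odd function repairs its sign. -/
theorem exists_isDescentFrame_of_ι_eq (h : HyperellipticLift C E) (hε : ε = 1 ∨ ε = -1) {p : X}
    (hp : C.ι p = p) : ∃ f, IsDescentFrame h ε f (C.π p) ∧ ∀ q k, h.transfer (f k) q = ε • f k q := by
  have hεε : ε * ε = 1 := by rcases hε with rfl | rfl <;> simp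
  obtain ⟨x, y, hxy, hx, hy⟩ := exists_eigenvector_pair hε (h.hasEigenvalue_one ⟨p, hp⟩)
    (h.hasEigenvalue_neg_one ⟨p, hp⟩)
  obtain ⟨e₁, he₁, he₁p⟩ := E.exists_holAt_eq p x
  obtain ⟨e₂, he₂, he₂p⟩ := E.exists_holAt_eq p y
  set f₀ : ∀ q, E.fiber q := fun q => (1 / 2 : ℂ) • (e₁ q + ε • h.transfer e₁ q) with hf₀
  set g : ∀ q, E.fiber q := fun q => (1 / 2 : ℂ) • (e₂ q + (-ε) • h.transfer e₂ q) with hg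
  set i := patchIndex (C.π p)
  have hi : C.π p ∈ lineBaseSet i := mem_lineBaseSet_patchIndex _
  set f₁ : ∀ q, E.fiber q := fun q => C.oddFun i q • g q with hf₁
  have hT : ∀ e : ∀ q, E.fiber q, h.transfer e p = C.fiberEnd E h.map ⟨p, hp⟩ (e p) := fun e =>
    (h.fiberEnd_apply ⟨p, hp⟩ e).symm
  have hf₀p : f₀ p = x := by
    simp only [hf₀, hT, he₁p, hx, smul_smul, hεε]
    module
  have hgp : g p = y := by
    simp only [hg, hT, he₂p, hy, smul_smul, neg_mul_neg, hεε]
    module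
  have hf₀hol : E.HolAt f₀ p := h.holAt_average _ he₁ (by rwa [hp])
  have hghol : E.HolAt g p := h.holAt_average _ he₂ (by rwa [hp])
  have hTf₀ : ∀ q, h.transfer f₀ q = ε • f₀ q := h.transfer_average hεε _ e₁
  have hTg : ∀ q, h.transfer g q = -ε • g q := h.transfer_average (by rw [neg_mul_neg, hεε]) _ e₂
  have hTf₁ : ∀ q, h.transfer f₁ q = ε • f₁ q := by
    intro q
    rw [hf₁, h.transfer_smul, hTg, C.oddFun_ι]
    module
  have hli : ∀ᶠ q in 𝓝 p, LinearIndependent ℂ ![f₀ q, g q] :=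
    hf₀hol.eventually_linearIndependent hghol (by rwa [hf₀p, hgp])
  have hT' : ∀ q k, h.transfer (![f₀, f₁] k) q = ε • ![f₀, f₁] k q := by
    intro q k
    fin_cases k
    · exact hTf₀ q
    · exact hTf₁ q
  refine ⟨![f₀, f₁], ⟨?_, ?_, ?_, ?_⟩, hT'⟩
  · intro p' hp' k
    rw [C.eq_of_π_eq hp hp']
    fin_cases k
    · exact hf₀hol
    · exact hghol.smul (C.holFunAt_oddFun hi)
  · exact Eventually.of_forall fun c q _ k => hT' q k
  · have h1 := C.eventually_fiber (b := C.π p) (P := fun q => LinearIndependent ℂ ![f₀ q, g q] ∧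
        C.π q ∈ lineBaseSet i) (by
      intro p' hp'
      rw [C.eq_of_π_eq hp hp']
      exact hli.and (C.eventually_π_mem_lineBaseSet hi))
    filter_upwards [h1] with c h2 q hq hι
    exact (linearIndependent_pair_smul_iff (C.oddFun_ne_zero (h2 q hq).2 hι)).2 (h2 q hq).1
  · intro p' hp' hι
    obtain rfl := C.eq_of_π_eq hp hp'
    exact ⟨g, hghol, Eventually.of_forall fun q => rfl, by
      change LinearIndependent ℂ ![f₀ p', g p']
      rwa [hf₀p, hgp], hTg p'⟩

/-- Frames of the sheaf of equivariant sections exist around every point of `ℙ¹`. -/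
theorem exists_isDescentFrame (h : HyperellipticLift C E) (hε : ε = 1 ∨ ε = -1) (b : OnePoint ℂ) :
    ∃ f, IsDescentFrame h ε f b := by
  obtain ⟨p, rfl⟩ := C.π_surjective b
  by_cases hp : C.ι p = p
  · obtain ⟨f, hf, -⟩ := exists_isDescentFrame_of_ι_eq h hε hp
    exact ⟨f, hf⟩
  · exact exists_isDescentFrame_of_ι_ne h hε hp

end Frames

/-! ### Coefficients of equivariant sections in a frame -/

section Coefficients

open Filter Topology

variable {r s t : ℂ} {X : Type u} [TopologicalSpace X] [T2Space X] [CompactSpace X]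
  [ChartedSpace ℂ X] [IsManifold 𝓘(ℂ) ω X]
  {C : GenusTwoCurve r s t X} {E : HolBundle.{u, v} 2 X} {h : HyperellipticLift C E} {ε : ℂ}

/-- A family holomorphic over `b` and equivariant over a neighbourhood of `b`. -/
def IsEquivariantGerm (h : HyperellipticLift C E) (ε : ℂ) (τ : ∀ q, E.fiber q) (b : OnePoint ℂ) :
    Prop :=
  (∀ p, C.π p = b → E.HolAt τ p) ∧ ∀ᶠ c in 𝓝 b, ∀ q, C.π q = c → h.transfer τ q = ε • τ q

theorem IsDescentFrame.isEquivariantGerm {f : Fin 2 → ∀ q, E.fiber q} {b : OnePoint ℂ}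
    (hf : IsDescentFrame h ε f b) (k : Fin 2) : IsEquivariantGerm h ε (f k) b :=
  ⟨fun p hp => hf.hol p hp k, hf.equivariant.mono fun _ hc q hq => hc q hq k⟩

/-- Near `b`, the family `τ` is the combination of `f` with the holomorphic coefficients `A`. -/
def HasCoeff (C : GenusTwoCurve r s t X) {E : HolBundle.{u, v} 2 X} (f : Fin 2 → ∀ q, E.fiber q)
    (τ : ∀ q, E.fiber q) (A : Fin 2 → OnePoint ℂ → ℂ) (b : OnePoint ℂ) : Prop :=
  (∀ k, HolFunAt (A k) b) ∧
    ∀ᶠ c in 𝓝 b, ∀ q, C.π q = c → τ q = A 0 c • f 0 q + A 1 c • f 1 q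

theorem HasCoeff.eventually {f : Fin 2 → ∀ q, E.fiber q} {τ : ∀ q, E.fiber q}
    {A : Fin 2 → OnePoint ℂ → ℂ} {b : OnePoint ℂ} (hA : HasCoeff C f τ A b) :
    ∀ᶠ c in 𝓝 b, HasCoeff C f τ A c :=
  (eventually_all.2 fun k => (hA.1 k).eventually).and hA.2.eventually_nhds

theorem IsDescentFrame.exists_hasCoeff {f : Fin 2 → ∀ q, E.fiber q} {b : OnePoint ℂ}
    (hf : IsDescentFrame h ε f b) (hε : ε = 1 ∨ ε = -1) {τ : ∀ q, E.fiber q}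
    (hτ : IsEquivariantGerm h ε τ b) : ∃ A, HasCoeff C f τ A b :=
  hf.exists_coeff hε hτ.1 hτ.2

open Classical in
/-- The values at `b` of the coefficients of `τ` with respect to the frame `f`. -/
noncomputable def coeffAt (C : GenusTwoCurve r s t X) {E : HolBundle.{u, v} 2 X}
    (f : Fin 2 → ∀ q, E.fiber q) (τ : ∀ q, E.fiber q) (b : OnePoint ℂ) : Fin 2 → ℂ :=
  if H : ∃ A, HasCoeff C f τ A b then fun k => H.choose k b else 0

/-- The arbitrary choice in `coeffAt` is harmless because coefficients are unique, even over a
branch point. -/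
theorem IsDescentFrame.coeffAt_eq {f : Fin 2 → ∀ q, E.fiber q} {b : OnePoint ℂ}
    (hf : IsDescentFrame h ε f b) {τ : ∀ q, E.fiber q} {A : Fin 2 → OnePoint ℂ → ℂ}
    (hA : HasCoeff C f τ A b) (k : Fin 2) : coeffAt C f τ b k = A k b := by
  have H : ∃ A, HasCoeff C f τ A b := ⟨A, hA⟩
  rw [coeffAt, dif_pos H]
  refine hf.coeff_unique H.choose_spec.1 hA.1 ?_ k
  filter_upwards [H.choose_spec.2, hA.2] with c h1 h2 q hq
  rw [← h1 q hq, ← h2 q hq]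

theorem IsDescentFrame.eventually_coeffAt_eq {f : Fin 2 → ∀ q, E.fiber q} {b : OnePoint ℂ}
    (hf : IsDescentFrame h ε f b) {τ : ∀ q, E.fiber q} {A : Fin 2 → OnePoint ℂ → ℂ}
    (hA : HasCoeff C f τ A b) : ∀ᶠ c in 𝓝 b, ∀ k, coeffAt C f τ c k = A k c := by
  filter_upwards [hf.eventually, hA.eventually] with c h1 h2 k
  exact h1.coeffAt_eq h2 k

theorem IsDescentFrame.holFunAt_coeffAt {f : Fin 2 → ∀ q, E.fiber q} {b : OnePoint ℂ}
    (hf : IsDescentFrame h ε f b) (hε : ε = 1 ∨ ε = -1) {τ : ∀ q, E.fiber q}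
    (hτ : IsEquivariantGerm h ε τ b) (k : Fin 2) : HolFunAt (fun c => coeffAt C f τ c k) b := by
  obtain ⟨A, hA⟩ := hf.exists_hasCoeff hε hτ
  exact (hA.1 k).congr_of_eventuallyEq ((hf.eventually_coeffAt_eq hA).mono fun c hc => hc k)

theorem IsDescentFrame.eq_sum_coeffAt {f : Fin 2 → ∀ q, E.fiber q} {b : OnePoint ℂ}
    (hf : IsDescentFrame h ε f b) (hε : ε = 1 ∨ ε = -1) {τ : ∀ q, E.fiber q}
    (hτ : IsEquivariantGerm h ε τ b) {p : X} (hp : C.π p = b) :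
    τ p = ∑ k, coeffAt C f τ b k • f k p := by
  obtain ⟨A, hA⟩ := hf.exists_hasCoeff hε hτ
  rw [Fin.sum_univ_two, hf.coeffAt_eq hA, hf.coeffAt_eq hA]
  exact hA.2.self_of_nhds p hp

theorem IsDescentFrame.coeffAt_self {f : Fin 2 → ∀ q, E.fiber q} {b : OnePoint ℂ}
    (hf : IsDescentFrame h ε f b) (k l : Fin 2) :
    coeffAt C f (f k) b l = if k = l then 1 else 0 := by
  refine hf.coeffAt_eq (A := fun l _ => if k = l then 1 else 0)
    ⟨fun l => contMDiffAt_const, Eventually.of_forall fun c q _ => ?_⟩ l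
  fin_cases k <;> simp

/-- Expand `τ` in `f` and each `f k` in `g`. Taken for `τ` in a third frame, this is the cocycle
condition. -/
theorem IsDescentFrame.coeffAt_trans {f g : Fin 2 → ∀ q, E.fiber q} {b : OnePoint ℂ}
    (hf : IsDescentFrame h ε f b) (hg : IsDescentFrame h ε g b) (hε : ε = 1 ∨ ε = -1)
    {τ : ∀ q, E.fiber q} (hτ : IsEquivariantGerm h ε τ b) (l : Fin 2) :
    ∑ k, coeffAt C f τ b k * coeffAt C g (f k) b l = coeffAt C g τ b l := by
  obtain ⟨A, hA⟩ := hf.exists_hasCoeff hε hτ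
  have hB := fun k => hg.exists_hasCoeff hε (hf.isEquivariantGerm k)
  choose B hB using hB
  rw [hg.coeffAt_eq (A := fun l c => A 0 c * B 0 l c + A 1 c * B 1 l c) (τ := τ) ⟨?_, ?_⟩,
    Fin.sum_univ_two, hf.coeffAt_eq hA, hf.coeffAt_eq hA, hg.coeffAt_eq (hB 0),
    hg.coeffAt_eq (hB 1)]
  · intro l
    exact ((hA.1 0).mul' ((hB 0).1 l)).add ((hA.1 1).mul' ((hB 1).1 l))
  · filter_upwards [hA.2, (hB 0).2, (hB 1).2] with c h1 h2 h3 q hq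
    rw [h1 q hq, h2 q hq, h3 q hq]
    module

end Coefficients

/-! ### Construction of the descended bundle from the frame cocycle -/

section Existence

open Filter Topology

variable {r s t : ℂ} {X : Type u} [TopologicalSpace X] [T2Space X] [CompactSpace X]
  [ChartedSpace ℂ X] [IsManifold 𝓘(ℂ) ω X]
  {C : GenusTwoCurve r s t X} {E : HolBundle.{u, v} 2 X} (h : HyperellipticLift C E) {ε : ℂ}
  (hε : ε = 1 ∨ ε = -1)

/-- A chosen frame of the sheaf of equivariant sections around `b`. -/
noncomputable def descentFrame (b : OnePoint ℂ) : Fin 2 → ∀ q, E.fiber q :=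
  (exists_isDescentFrame h hε b).choose

theorem isDescentFrame_descentFrame (b : OnePoint ℂ) :
    IsDescentFrame h ε (descentFrame h hε b) b :=
  (exists_isDescentFrame h hε b).choose_spec

/-- The linear map whose matrix has the rows `R k`. -/
noncomputable def rowsCLM (R : Fin 2 → Fin 2 → ℂ) : (Fin 2 → ℂ) →L[ℂ] (Fin 2 → ℂ) :=
  ∑ k, (ContinuousLinearMap.proj (R := ℂ) (φ := fun _ : Fin 2 => ℂ) k).smulRight (R k)

theorem rowsCLM_apply (R : Fin 2 → Fin 2 → ℂ) (x : Fin 2 → ℂ) (l : Fin 2) :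
    rowsCLM R x l = ∑ k, x k * R k l := by
  simp [rowsCLM]

theorem contMDiffAt_rowsCLM {R : Fin 2 → Fin 2 → OnePoint ℂ → ℂ} {b : OnePoint ℂ}
    (hR : ∀ k l, HolFunAt (R k l) b) :
    ContMDiffAt 𝓘(ℂ) 𝓘(ℂ, (Fin 2 → ℂ) →L[ℂ] (Fin 2 → ℂ)) ω
      (fun c => rowsCLM fun k l => R k l c) b := by
  have h1 : ∀ k, ContMDiffAt 𝓘(ℂ) 𝓘(ℂ, (Fin 2 → ℂ) →L[ℂ] (Fin 2 → ℂ)) ω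
      (fun c => (ContinuousLinearMap.proj (R := ℂ) (φ := fun _ : Fin 2 => ℂ) k).smulRight
        (fun l => R k l c)) b := by
    intro k
    have h2 : ContMDiffAt 𝓘(ℂ) 𝓘(ℂ, Fin 2 → ℂ) ω (fun c l => R k l c) b :=
      contMDiffAt_pi_space.2 fun l => hR k l
    exact ((ContinuousLinearMap.smulRightL ℂ (Fin 2 → ℂ) (Fin 2 → ℂ)
      (ContinuousLinearMap.proj (R := ℂ) (φ := fun _ : Fin 2 => ℂ) k)).contMDiff
        (n := ω)).contMDiffAt.comp b h2
  have h3 := (h1 0).add (h1 1)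
  refine h3.congr_of_eventuallyEq (Eventually.of_forall fun c => ?_)
  simp [rowsCLM, Fin.sum_univ_two]

/-- The transition functions of the descended bundle. -/
noncomputable def descentCoordChange (i j b : OnePoint ℂ) : (Fin 2 → ℂ) →L[ℂ] (Fin 2 → ℂ) :=
  rowsCLM fun k => coeffAt C (descentFrame h hε j) (descentFrame h hε i k) b

theorem contMDiffOn_descentCoordChange (i j : OnePoint ℂ) :
    ContMDiffOn 𝓘(ℂ) 𝓘(ℂ, (Fin 2 → ℂ) →L[ℂ] (Fin 2 → ℂ)) ω (descentCoordChange h hε i j)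
      ({b | IsDescentFrame h ε (descentFrame h hε i) b} ∩
        {b | IsDescentFrame h ε (descentFrame h hε j) b}) := by
  rintro b ⟨hi, hj⟩
  refine ContMDiffAt.contMDiffWithinAt ?_
  exact contMDiffAt_rowsCLM fun k l => IsDescentFrame.holFunAt_coeffAt hj hε
    (IsDescentFrame.isEquivariantGerm hi k) l

/-- The cocycle of the descended bundle. -/
noncomputable def descentCore : VectorBundleCore ℂ (OnePoint ℂ) (Fin 2 → ℂ) (OnePoint ℂ) where
  baseSet i := {b | IsDescentFrame h ε (descentFrame h hε i) b}
  isOpen_baseSet i := isOpen_iff_mem_nhds.2 fun b hb => IsDescentFrame.eventually hb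
  -- Each point carries its own chosen frame, so a vector over `b` is a pair of coefficients in the
  -- frame at `b`.
  indexAt b := b
  mem_baseSet_at b := isDescentFrame_descentFrame h hε b
  coordChange := descentCoordChange h hε
  coordChange_self i b hb x := by
    funext l
    rw [descentCoordChange, rowsCLM_apply]
    simp [IsDescentFrame.coeffAt_self hb]
  continuousOn_coordChange i j := (contMDiffOn_descentCoordChange h hε i j).continuousOn
  coordChange_comp i j l b hb x := by
    obtain ⟨⟨hi, hj⟩, hl⟩ := hb
    funext n
    simp only [descentCoordChange, rowsCLM_apply]
    simp_rw [← IsDescentFrame.coeffAt_trans hj hl hε (IsDescentFrame.isEquivariantGerm hi _) n]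
    simp only [Fin.sum_univ_two]
    ring

instance descentCore_isContMDiff : (descentCore h hε).IsContMDiff 𝓘(ℂ) ω :=
  ⟨contMDiffOn_descentCoordChange h hε⟩

/-- The descended bundle. -/
noncomputable def descentBundle : HolBundle.{0, 0} 2 (OnePoint ℂ) where
  fiber := (descentCore h hε).Fiber

theorem trivCoord_descentBundle (b : OnePoint ℂ) (σ : ∀ c, (descentBundle h hε).fiber c)
    (c : OnePoint ℂ) :
    (descentBundle h hε).trivCoord b σ c = descentCoordChange h hε c b c (σ c) := rfl

/-- The vector of `E_p` given by a vector of the descended bundle over `π p`. -/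
noncomputable def descentEval (p : X) : (descentBundle h hε).fiber (C.π p) →ₗ[ℂ] E.fiber p :=
  Fintype.linearCombination ℂ (fun k => descentFrame h hε (C.π p) k p)

theorem descentEval_apply (p : X) (x : Fin 2 → ℂ) :
    descentEval h hε p x = ∑ k, x k • descentFrame h hε (C.π p) k p := rfl

/-- The value does not depend on the frame used; near a given point this replaces the frame that
moves with `p` by a fixed one. -/
theorem descentEval_eq {p : X} {b : OnePoint ℂ}
    (hb : IsDescentFrame h ε (descentFrame h hε b) (C.π p)) (x : Fin 2 → ℂ) :
    descentEval h hε p x =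
      ∑ k, descentCoordChange h hε (C.π p) b (C.π p) x k • descentFrame h hε b k p := by
  rw [descentEval_apply]
  have h1 := fun k => hb.eq_sum_coeffAt hε
    ((isDescentFrame_descentFrame h hε (C.π p)).isEquivariantGerm k) (p := p) rfl
  rw [Fin.sum_univ_two, h1 0, h1 1]
  simp only [Fin.sum_univ_two, descentCoordChange, rowsCLM_apply]
  module

theorem holAt_descentEval {σ : ∀ c, (descentBundle h hε).fiber c} {p : X}
    (hσ : (descentBundle h hε).HolAt σ (C.π p)) :
    E.HolAt (fun q => descentEval h hε q (σ (C.π q))) p := by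
  rw [HolBundle.holAt_iff] at hσ
  have hA : ∀ k, HolFunAt (fun c => (descentBundle h hε).trivCoord (C.π p) σ c k) (C.π p) :=
    fun k => contMDiffAt_pi_space.1 hσ k
  have hf := isDescentFrame_descentFrame h hε (C.π p)
  have h1 : E.HolAt (fun q => ∑ k, (descentBundle h hε).trivCoord (C.π p) σ (C.π q) k •
      descentFrame h hε (C.π p) k q) p :=
    HolBundle.holAt_sum _ fun k =>
      HolBundle.HolAt.smul ((hA k).comp p (C.π.contMDiff p)) (hf.hol p rfl k)
  refine h1.congr ?_
  filter_upwards [C.continuous_π.continuousAt.eventually hf.eventually] with q hq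
  exact descentEval_eq h hε hq (σ (C.π q))

theorem transfer_descentEval (σ : ∀ c, (descentBundle h hε).fiber c) (q : X) :
    h.transfer (fun q => descentEval h hε q (σ (C.π q))) q =
      ε • descentEval h hε q (σ (C.π q)) := by
  -- The base point is generalized because π(ι q) and π q are only propositionally equal.
  have h1 : ∀ b, b = C.π q → ∀ x : Fin 2 → ℂ,
      (h.map q).symm (∑ k, x k • descentFrame h hε b k (C.ι q)) =
        ε • ∑ k, x k • descentFrame h hε b k q := by
    rintro _ rfl x
    have h2 := (isDescentFrame_descentFrame h hε (C.π q)).equivariant.self_of_nhds q rfl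
    rw [map_sum, Finset.smul_sum]
    refine Finset.sum_congr rfl fun k _ => ?_
    rw [map_smul, smul_comm, ← h2 k]
    rfl
  have h3 : ∀ b (hb : b = C.π q), (h.map q).symm
      (∑ k, (show Fin 2 → ℂ from σ b) k • descentFrame h hε b k (C.ι q)) =
        ε • ∑ k, (show Fin 2 → ℂ from σ (C.π q)) k • descentFrame h hε (C.π q) k q := by
    rintro _ rfl
    exact h1 _ rfl _
  exact h3 (C.π (C.ι q)) (C.π_ι q)

/-- The frame moves with `c`, but in the trivialization at `b` the vector becomes the coefficients
in the fixed frame at `b`, which are holomorphic. -/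
theorem holAt_coeffAt {τ : ∀ q, E.fiber q} {b : OnePoint ℂ} (hτ : IsEquivariantGerm h ε τ b)
    (hev : ∀ᶠ c in 𝓝 b, IsEquivariantGerm h ε τ c) :
    (descentBundle h hε).HolAt (fun c => coeffAt C (descentFrame h hε c) τ c) b := by
  have hf := isDescentFrame_descentFrame h hε b
  have h1 : ContMDiffAt 𝓘(ℂ) 𝓘(ℂ, Fin 2 → ℂ) ω
      (fun c => coeffAt C (descentFrame h hε b) τ c) b :=
    contMDiffAt_pi_space.2 fun k => hf.holFunAt_coeffAt hε hτ k
  refine ((descentBundle h hε).holAt_iff _ b).2 (h1.congr_of_eventuallyEq ?_)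
  filter_upwards [hf.eventually, hev] with c h2 h3
  change descentCoordChange h hε c b c (coeffAt C (descentFrame h hε c) τ c) = _
  funext l
  rw [descentCoordChange, rowsCLM_apply]
  exact (isDescentFrame_descentFrame h hε c).coeffAt_trans h2 hε h3 l

theorem isEquivariantGerm_extend {V : Opens (OnePoint ℂ)} (τ : E.sections (C.preimage V))
    (hεε : ε * ε = 1)
    (hτ : ∀ p : C.preimage V, h.map p (τ.1 p) = ε • τ.1 ⟨C.ι p, C.ι_mem_preimage p.2⟩)
    {b : OnePoint ℂ} (hb : b ∈ V) : IsEquivariantGerm h ε (E.extend τ.1) b := by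
  refine ⟨fun p hp => E.holAt_extend τ (by subst hp; exact hb), ?_⟩
  filter_upwards [V.2.mem_nhds hb] with c hc q hq
  subst hq
  rw [← h.map_eq_iff hεε, E.extend_apply τ.1 (q := q) hc,
    E.extend_apply τ.1 (q := C.ι q) (C.ι_mem_preimage (V := V) (p := q) hc)]
  exact hτ ⟨q, hc⟩

theorem map_eq_of_isEquivariantGerm {V : Opens (OnePoint ℂ)} (τ : E.sections (C.preimage V))
    (hεε : ε * ε = 1) (p : C.preimage V)
    (hτ : h.transfer (E.extend τ.1) p = ε • E.extend τ.1 p) :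
    h.map p (τ.1 p) = ε • τ.1 ⟨C.ι p, C.ι_mem_preimage p.2⟩ := by
  rw [← h.map_eq_iff hεε, E.extend_apply τ.1 p.2,
    E.extend_apply τ.1 (q := C.ι p) (C.ι_mem_preimage p.2)] at hτ
  exact hτ

/-- The section of `E` given by a section of the descended bundle. -/
noncomputable def descentToSections (V : Opens (OnePoint ℂ)) :
    (descentBundle h hε).sections V →ₗ[ℂ] E.sections (C.preimage V) where
  toFun σ := ⟨fun p => descentEval h hε p (σ.1 ⟨C.π p, p.2⟩), by
    refine (HolBundle.isHolSection_iff_extend _ _).2 fun p hp => ?_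
    refine (holAt_descentEval h hε ((descentBundle h hε).holAt_extend σ (p := C.π p) hp)).congr ?_
    filter_upwards [(C.preimage V).2.mem_nhds hp] with q hq
    rw [E.extend_apply _ hq, HolBundle.extend_apply _ σ.1 (q := C.π q) hq]⟩
  map_add' σ τ := Subtype.ext (funext fun p => map_add (descentEval h hε (p : X)) _ _)
  map_smul' c σ := Subtype.ext (funext fun p => map_smul (descentEval h hε (p : X)) c _)

theorem descentToSections_apply (V : Opens (OnePoint ℂ)) (σ : (descentBundle h hε).sections V)
    (p : C.preimage V) :
    (descentToSections h hε V σ).1 p = descentEval h hε p (σ.1 ⟨C.π p, p.2⟩) := rfl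

/-- Over a branch point the map on fibres has a kernel, so injectivity holds only for sections:
their coefficients vanish off the branch points, hence everywhere by continuity (`coeff_unique`). -/
theorem descentToSections_injective (V : Opens (OnePoint ℂ)) :
    Function.Injective (descentToSections h hε V) := by
  rw [injective_iff_map_eq_zero]
  intro σ hσ
  refine Subtype.ext (funext fun b => ?_)
  have h0 : ∀ q (hq : C.π q ∈ V), descentEval h hε q (σ.1 ⟨C.π q, hq⟩) = 0 := fun q hq =>
    congrFun (congrArg Subtype.val hσ) ⟨q, hq⟩
  have hf := isDescentFrame_descentFrame h hε b
  have hσb := (descentBundle h hε).holAt_extend σ b.2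
  rw [HolBundle.holAt_iff] at hσb
  have hA : ∀ k, HolFunAt (fun c => (descentBundle h hε).trivCoord b
      ((descentBundle h hε).extend σ.1) c k) b := fun k => contMDiffAt_pi_space.1 hσb k
  have h1 := hf.coeff_unique (A' := fun _ _ => 0) hA (fun _ => contMDiffAt_const) (by
    filter_upwards [hf.eventually, V.2.mem_nhds b.2] with c h2 h3 q hq
    subst hq
    have h4 := descentEval_eq h hε h2 (σ.1 ⟨C.π q, h3⟩)
    rw [h0 q h3, Fin.sum_univ_two] at h4
    simp only [trivCoord_descentBundle, zero_smul, add_zero]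
    rw [HolBundle.extend_apply _ σ.1 (q := C.π q) h3]
    exact h4.symm)
  have h5 : (descentBundle h hε).trivCoord b ((descentBundle h hε).extend σ.1) b = 0 :=
    funext h1
  rw [HolBundle.trivCoord_eq _ (HolBundle.self_mem_baseSet _ (b : OnePoint ℂ)),
    LinearEquiv.map_eq_zero_iff, HolBundle.extend_apply _ σ.1 b.2] at h5
  exact h5

/-- The hyperelliptic descent exists. -/
noncomputable def hyperellipticDescent : HyperellipticDescent.{u, v, 0} h ε where
  bundle := descentBundle h hε
  toSections := descentToSections h hε
  map_smul V f σ p := map_smul (descentEval h hε (p : X)) _ _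
  map_restrict V V' hV σ p := rfl
  injective := descentToSections_injective h hε
  mem_range V τ := by
    have hεε : ε * ε = 1 := by rcases hε with rfl | rfl <;> simp
    constructor
    · rintro ⟨σ, rfl⟩ p
      refine map_eq_of_isEquivariantGerm h _ hεε p ?_
      have h1 : ∀ q (hq : C.π q ∈ V), E.extend (descentToSections h hε V σ).1 q =
          descentEval h hε q ((descentBundle h hε).extend σ.1 (C.π q)) := by
        intro q hq
        rw [E.extend_apply _ (q := q) (U := C.preimage V) hq,
          HolBundle.extend_apply _ σ.1 (q := C.π q) hq]
        rfl
      rw [HyperellipticLift.transfer, h1 _ (C.ι_mem_preimage p.2), h1 _ p.2]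
      exact transfer_descentEval h hε _ _
    · intro hτ
      have h1 : ∀ b ∈ V, IsEquivariantGerm h ε (E.extend τ.1) b := fun b hb =>
        isEquivariantGerm_extend h τ hεε hτ hb
      refine ⟨(descentBundle h hε).mkSection V
        (fun c => coeffAt C (descentFrame h hε c) (E.extend τ.1) c) fun b hb =>
          holAt_coeffAt h hε (h1 b hb) (Filter.mem_of_superset (V.2.mem_nhds hb) h1), ?_⟩
      refine Subtype.ext (funext fun p => ?_)
      rw [descentToSections_apply, ← E.extend_apply τ.1 p.2]
      exact ((isDescentFrame_descentFrame h hε (C.π p)).eq_sum_coeffAt hε (h1 _ p.2) rfl).symm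

end Existence

/-! ### An arbitrary descent: its frames and its maps to the fibres of E -/

open Filter Topology in
theorem exists_opens_of_eventually {Y : Type*} [TopologicalSpace Y] {U : Opens Y} {p : Y}
    (hp : p ∈ U) {P : Y → Prop} (h : ∀ᶠ q in 𝓝 p, P q) :
    ∃ U' : Opens Y, U' ≤ U ∧ p ∈ U' ∧ ∀ q ∈ U', P q := by
  obtain ⟨S, hS, hSo, hpS⟩ := _root_.eventually_nhds_iff.1 h
  exact ⟨⟨S, hSo⟩ ⊓ U, inf_le_right, ⟨hpS, hp⟩, fun q hq => hS q hq.1⟩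

namespace HyperellipticDescent

open Filter Topology

variable {r s t : ℂ} {X : Type u} [TopologicalSpace X] [T2Space X] [CompactSpace X]
  [ChartedSpace ℂ X] [IsManifold 𝓘(ℂ) ω X]
  {C : GenusTwoCurve r s t X} {E : HolBundle.{u, v} 2 X} {h : HyperellipticLift C E} {ε : ℂ}
  (D : HyperellipticDescent.{u, v, w} h ε) (hε : ε = 1 ∨ ε = -1)

/-- The open set on which the chosen frame around `b` is a frame. -/
noncomputable def frameSet (h : HyperellipticLift C E) (hε : ε = 1 ∨ ε = -1) (b : OnePoint ℂ) :
    Opens (OnePoint ℂ) :=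
  ⟨(descentCore h hε).baseSet b, (descentCore h hε).isOpen_baseSet b⟩

theorem mem_frameSet (h : HyperellipticLift C E) (hε : ε = 1 ∨ ε = -1) (b : OnePoint ℂ) :
    b ∈ frameSet h hε b := (descentCore h hε).mem_baseSet_at b

theorem isEquivariantGerm_toSections {V : Opens (OnePoint ℂ)} (σ : D.bundle.sections V)
    (hεε : ε * ε = 1) {b : OnePoint ℂ} (hb : b ∈ V) :
    IsEquivariantGerm h ε (E.extend (D.toSections V σ).1) b :=
  isEquivariantGerm_extend h _ hεε ((D.mem_range V _).1 ⟨σ, rfl⟩) hb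

theorem exists_toSections_eq {V : Opens (OnePoint ℂ)} {τ : ∀ q, E.fiber q} (hεε : ε * ε = 1)
    (hτ : ∀ b ∈ V, IsEquivariantGerm h ε τ b) :
    ∃ σ : D.bundle.sections V, ∀ p : C.preimage V, (D.toSections V σ).1 p = τ p := by
  obtain ⟨σ, hσ⟩ := (D.mem_range V (E.mkSection (C.preimage V) τ
    fun p hp => (hτ _ hp).1 p rfl)).2 (fun p =>
      (h.map_eq_iff hεε τ p).2 ((hτ _ p.2).2.self_of_nhds p rfl))
  exact ⟨σ, fun p => by rw [hσ]; rfl⟩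

theorem exists_frameSection (b : OnePoint ℂ) (k : Fin 2) :
    ∃ σ : D.bundle.sections (frameSet h hε b), ∀ p : C.preimage (frameSet h hε b),
      (D.toSections _ σ).1 p = descentFrame h hε b k p :=
  D.exists_toSections_eq (by rcases hε with rfl | rfl <;> simp)
    fun c hc => IsDescentFrame.isEquivariantGerm hc k

/-- The sections of the descended bundle given by the chosen frame around `b`, extended by zero. -/
noncomputable def frame (b : OnePoint ℂ) (k : Fin 2) : ∀ c, D.bundle.fiber c :=
  D.bundle.extend (D.exists_frameSection hε b k).choose.1

theorem holAt_frame {b c : OnePoint ℂ} (hc : c ∈ frameSet h hε b) (k : Fin 2) :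
    D.bundle.HolAt (D.frame hε b k) c :=
  D.bundle.holAt_extend _ hc

/-- The expansion of the image of `σ` in E holds already in the descended bundle, because the map on
sections is injective, compatible with restriction and linear over functions on ℙ¹. -/
theorem exists_coeff_frame {V : Opens (OnePoint ℂ)} (σ : D.bundle.sections V) {b : OnePoint ℂ}
    (hb : b ∈ V) : ∃ A : Fin 2 → OnePoint ℂ → ℂ,
      HasCoeff C (descentFrame h hε b) (E.extend (D.toSections V σ).1) A b ∧
      ∀ᶠ c in 𝓝 b, D.bundle.extend σ.1 c =
        A 0 c • D.frame hε b 0 c + A 1 c • D.frame hε b 1 c := by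
  have hεε : ε * ε = 1 := by rcases hε with rfl | rfl <;> simp
  obtain ⟨A, hA⟩ := (isDescentFrame_descentFrame h hε b).exists_hasCoeff hε
    (D.isEquivariantGerm_toSections σ hεε hb)
  refine ⟨A, hA, ?_⟩
  obtain ⟨V', hV', hbV', hV'A⟩ := exists_opens_of_eventually
    (U := V ⊓ frameSet h hε b) ⟨hb, mem_frameSet h hε b⟩ hA.eventually
  have h1 := fun k => (D.exists_frameSection hε b k).choose_spec
  set σ' := fun k => (D.exists_frameSection hε b k).choose
  have hle : V' ≤ frameSet h hε b := hV'.trans inf_le_right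
  have h2 : D.bundle.restrict (hV'.trans inf_le_left) σ =
      D.bundle.smulSection (HolBundle.mkFun V' (A 0) fun c hc => (hV'A c hc).1 0)
        (D.bundle.restrict hle (σ' 0)) +
      D.bundle.smulSection (HolBundle.mkFun V' (A 1) fun c hc => (hV'A c hc).1 1)
        (D.bundle.restrict hle (σ' 1)) := by
    apply D.injective V'
    refine Subtype.ext (funext fun p => ?_)
    rw [map_add]
    change _ = (D.toSections V' _).1 p + (D.toSections V' _).1 p
    rw [D.map_restrict, D.map_smul, D.map_smul, D.map_restrict, D.map_restrict, h1 0, h1 1]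
    have h3 := (hV'A _ p.2).2.self_of_nhds p rfl
    rw [E.extend_apply _ (U := C.preimage V) (q := (p : X)) (hV' p.2).1] at h3
    exact h3
  filter_upwards [V'.2.mem_nhds hbV'] with c hc
  have h4 := congrFun (congrArg Subtype.val h2) ⟨c, hc⟩
  rw [frame, frame, HolBundle.extend_apply _ _ (hV' hc).1, HolBundle.extend_apply _ _ (hle hc),
    HolBundle.extend_apply _ _ (hle hc)]
  exact h4

theorem exists_section_eq {n : ℕ} {B : Type u} [TopologicalSpace B] [ChartedSpace ℂ B]
    [IsManifold 𝓘(ℂ) ω B] (G : HolBundle.{u, v} n B) {b : B} (e : G.fiber b) :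
    ∃ (V : Opens B) (_ : b ∈ V) (σ : G.sections V), G.extend σ.1 b = e := by
  obtain ⟨σ, hσ, rfl⟩ := G.exists_holAt_eq b e
  obtain ⟨V, -, hbV, hV⟩ := exists_opens_of_eventually (U := ⊤) (Opens.mem_top b) hσ.eventually
  exact ⟨V, hbV, G.mkSection V σ hV, G.extend_apply _ hbV⟩

/-- Every vector of the fibre is the value of a local section, hence a combination of the two frame
vectors; two vectors spanning a plane are independent. -/
theorem linearIndependent_frame (b : OnePoint ℂ) :
    LinearIndependent ℂ ![D.frame hε b 0 b, D.frame hε b 1 b] := by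
  have := D.bundle.finiteDimensional_fiber b
  refine linearIndependent_of_top_le_span_of_card_eq_finrank ?_ (by
    rw [D.bundle.finrank_fiber]; simp)
  intro e _
  obtain ⟨V, hbV, σ, rfl⟩ := exists_section_eq D.bundle e
  obtain ⟨A, -, hA⟩ := D.exists_coeff_frame hε σ hbV
  rw [hA.self_of_nhds]
  refine Submodule.add_mem _ (Submodule.smul_mem _ _ (Submodule.subset_span ⟨0, rfl⟩))
    (Submodule.smul_mem _ _ (Submodule.subset_span ⟨1, rfl⟩))

/-- By the common expansion in frames, the value at `p` of the image of `σ` depends only on `σ` at π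
p, linearly. The map is defined by sending frame to frame. -/
theorem exists_evalMap (hε : ε = 1 ∨ ε = -1) :
    ∃ φ : ∀ p, D.bundle.fiber (C.π p) →ₗ[ℂ] E.fiber p,
    ∀ (V : Opens (OnePoint ℂ)) (σ : D.bundle.sections V) (p : X), C.π p ∈ V →
      E.extend (D.toSections V σ).1 p = φ p (D.bundle.extend σ.1 (C.π p)) := by
  have hli := fun p => D.linearIndependent_frame hε (C.π p)
  let B := fun p => basisOfLinearIndependentOfCardEqFinrank (hli p) (by
    rw [D.bundle.finrank_fiber]; simp)
  have hB : ∀ p k, B p k = D.frame hε (C.π p) k (C.π p) := by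
    intro p k
    rw [coe_basisOfLinearIndependentOfCardEqFinrank]
    fin_cases k <;> rfl
  refine ⟨fun p => (B p).constr ℂ fun k => descentFrame h hε (C.π p) k p, fun V σ p hp => ?_⟩
  obtain ⟨A, hA, hA'⟩ := D.exists_coeff_frame hε σ hp
  rw [hA.2.self_of_nhds p rfl, hA'.self_of_nhds, map_add, _root_.map_smul, _root_.map_smul, ← hB, ← hB,
    Module.Basis.constr_basis, Module.Basis.constr_basis]

/-- The linear map between the fibres of the descended bundle and of `E` over a point of `X`. -/
noncomputable def evalMap (p : X) : D.bundle.fiber (C.π p) →ₗ[ℂ] E.fiber p :=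
  (D.exists_evalMap hε).choose p

theorem extend_toSections {V : Opens (OnePoint ℂ)} (σ : D.bundle.sections V) {p : X}
    (hp : C.π p ∈ V) :
    E.extend (D.toSections V σ).1 p = D.evalMap hε p (D.bundle.extend σ.1 (C.π p)) :=
  (D.exists_evalMap hε).choose_spec V σ p hp

theorem toSections_apply {V : Opens (OnePoint ℂ)} (σ : D.bundle.sections V) (p : C.preimage V) :
    (D.toSections V σ).1 p = D.evalMap hε p (σ.1 ⟨C.π p, p.2⟩) := by
  rw [← E.extend_apply (D.toSections V σ).1 p.2, D.extend_toSections hε σ p.2,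
    HolBundle.extend_apply _ _ (q := C.π p) p.2]

theorem evalMap_frame {b : OnePoint ℂ} {p : X} (hp : C.π p ∈ frameSet h hε b) (k : Fin 2) :
    D.evalMap hε p (D.frame hε b k (C.π p)) = descentFrame h hε b k p := by
  rw [frame, ← D.extend_toSections hε _ hp, E.extend_apply _ (U := C.preimage (frameSet h hε b)) hp]
  exact (D.exists_frameSection hε b k).choose_spec ⟨p, hp⟩

theorem exists_eq_frame_add {p : X} (x : D.bundle.fiber (C.π p)) :
    ∃ a b : ℂ, x = a • D.frame hε (C.π p) 0 (C.π p) + b • D.frame hε (C.π p) 1 (C.π p) :=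
  exists_coeff_of_linearIndependent_pair (D.bundle.finrank_fiber _)
    (D.linearIndependent_frame hε (C.π p)) x

theorem evalMap_frame_add {p : X} (a b : ℂ) :
    D.evalMap hε p (a • D.frame hε (C.π p) 0 (C.π p) + b • D.frame hε (C.π p) 1 (C.π p)) =
      a • descentFrame h hε (C.π p) 0 p + b • descentFrame h hε (C.π p) 1 p := by
  rw [map_add, _root_.map_smul, _root_.map_smul, D.evalMap_frame hε (mem_frameSet h hε _),
    D.evalMap_frame hε (mem_frameSet h hε _)]

theorem evalMap_bijective {p : X} (hp : C.ι p ≠ p) : Function.Bijective (D.evalMap hε p) := by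
  have hli := (isDescentFrame_descentFrame h hε (C.π p)).linearIndependent.self_of_nhds p rfl hp
  constructor
  · rw [injective_iff_map_eq_zero]
    intro x hx
    obtain ⟨a, b, rfl⟩ := D.exists_eq_frame_add hε x
    rw [evalMap_frame_add] at hx
    have h1 := LinearIndependent.pair_iff.1 hli a b hx
    simp [h1.1, h1.2]
  · intro y
    obtain ⟨a, b, rfl⟩ := exists_coeff_of_linearIndependent_pair (E.finrank_fiber p) hli y
    exact ⟨_, D.evalMap_frame_add hε a b⟩

theorem descentFrame_one_eq_zero (h : HyperellipticLift C E) (hε : ε = 1 ∨ ε = -1) {p : X}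
    (hp : C.ι p = p) : descentFrame h hε (C.π p) 1 p = 0 := by
  obtain ⟨g, -, hg, -⟩ := (isDescentFrame_descentFrame h hε (C.π p)).branch p rfl hp
  rw [hg.self_of_nhds, (C.oddFun_eq_zero_iff (mem_lineBaseSet_patchIndex _)).2 hp, zero_smul]

theorem descentFrame_zero_ne_zero (h : HyperellipticLift C E) (hε : ε = 1 ∨ ε = -1) {p : X}
    (hp : C.ι p = p) : descentFrame h hε (C.π p) 0 p ≠ 0 := by
  obtain ⟨g, -, -, hli, -⟩ := (isDescentFrame_descentFrame h hε (C.π p)).branch p rfl hp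
  exact hli.ne_zero 0

/-- At a Weierstrass point the frame of the descent goes to `descentFrame 0`, which is nonzero, and
to `descentFrame 1`, which carries the factor `oddFun` and vanishes. -/
theorem ker_evalMap {p : X} (hp : C.ι p = p) :
    LinearMap.ker (D.evalMap hε p) = Submodule.span ℂ {D.frame hε (C.π p) 1 (C.π p)} := by
  ext x
  rw [LinearMap.mem_ker, Submodule.mem_span_singleton]
  constructor
  · intro hx
    obtain ⟨a, b, rfl⟩ := D.exists_eq_frame_add hε x
    rw [evalMap_frame_add, descentFrame_one_eq_zero h hε hp, smul_zero, add_zero,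
      smul_eq_zero_iff_left (descentFrame_zero_ne_zero h hε hp)] at hx
    exact ⟨b, by simp [hx]⟩
  · rintro ⟨b, rfl⟩
    rw [_root_.map_smul, D.evalMap_frame hε (mem_frameSet h hε _), descentFrame_one_eq_zero h hε hp,
      smul_zero]

theorem range_evalMap {p : X} (hp : C.ι p = p) :
    LinearMap.range (D.evalMap hε p) = Submodule.span ℂ {descentFrame h hε (C.π p) 0 p} := by
  ext y
  rw [LinearMap.mem_range, Submodule.mem_span_singleton]
  constructor
  · rintro ⟨x, rfl⟩
    obtain ⟨a, b, rfl⟩ := D.exists_eq_frame_add hε x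
    rw [evalMap_frame_add, descentFrame_one_eq_zero h hε hp, smul_zero, add_zero]
    exact ⟨a, rfl⟩
  · rintro ⟨a, rfl⟩
    exact ⟨a • D.frame hε (C.π p) 0 (C.π p), by
      rw [_root_.map_smul, D.evalMap_frame hε (mem_frameSet h hε _)]⟩

/-- Only one point lies over a branch point, so vanishing over it is the single condition that
`evalMap` kills the value; every vector is such a value, so the set is already a subspace. -/
theorem direction_eq_ker {p : X} (hp : C.ι p = p) :
    D.direction (C.π p) = LinearMap.ker (D.evalMap hε p) := by
  have h1 : {e | ∃ (V : Opens (OnePoint ℂ)) (hb : C.π p ∈ V) (σ : D.bundle.sections V),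
      (∀ q : C.preimage V, C.π q = C.π p → (D.toSections V σ).1 q = 0) ∧
        σ.1 ⟨C.π p, hb⟩ = e} = ((LinearMap.ker (D.evalMap hε p) : Submodule ℂ (D.bundle.fiber (C.π p))) :
        Set (D.bundle.fiber (C.π p))) := by
    ext e
    constructor
    · rintro ⟨V, hb, σ, hσ, rfl⟩
      rw [SetLike.mem_coe, LinearMap.mem_ker, ← D.toSections_apply hε σ ⟨p, hb⟩]
      exact hσ ⟨p, hb⟩ rfl
    · intro he
      obtain ⟨V, hb, σ, rfl⟩ := exists_section_eq D.bundle e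
      refine ⟨V, hb, σ, fun q hq => ?_, (D.bundle.extend_apply _ hb).symm⟩
      obtain ⟨q, hqV⟩ := q
      obtain rfl := C.eq_of_π_eq hp hq
      rw [D.toSections_apply hε σ ⟨q, hqV⟩]
      rw [SetLike.mem_coe, LinearMap.mem_ker, D.bundle.extend_apply _ hb] at he
      exact he
  rw [direction, h1, Submodule.span_eq]

theorem finrank_direction (hε : ε = 1 ∨ ε = -1) {p : X} (hp : C.ι p = p) :
    Module.finrank ℂ (D.direction (C.π p)) = 1 := by
  rw [D.direction_eq_ker hε hp, D.ker_evalMap hε hp]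
  exact finrank_span_singleton ((D.linearIndependent_frame hε (C.π p)).ne_zero 1)

/-- Both are the line of `descentFrame 0`: the vectors `descentFrame 0` and `g` form an eigenbasis
with eigenvalues ε and -ε. -/
theorem eigendirection_eq_range (p : C.weierstrass) :
    h.eigendirection ε p = LinearMap.range (D.evalMap hε p) := by
  have hε0 : ε ≠ 0 := by rcases hε with rfl | rfl <;> simp
  have hp : C.ι p = p := p.2
  rw [D.range_evalMap hε hp]
  have hf := isDescentFrame_descentFrame h hε (C.π p)
  obtain ⟨g, -, -, hli, hg⟩ := hf.branch p rfl hp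
  refine eigenspace_eq_span_singleton (E.finrank_fiber p) hε0 hli ?_ ?_
  · rw [h.fiberEnd_apply]
    exact hf.equivariant.self_of_nhds p rfl 0
  · rw [h.fiberEnd_apply, hg]

theorem finrank_eigendirection (D : HyperellipticDescent.{u, v, w} h ε)
    (hε : ε = 1 ∨ ε = -1) (p : C.weierstrass) :
    Module.finrank ℂ (h.eigendirection ε p) = 1 := by
  rw [D.eigendirection_eq_range hε p, D.range_evalMap hε p.2]
  exact finrank_span_singleton (descentFrame_zero_ne_zero h hε p.2)

/-! ### The positive elementary transformation -/

/-- The pullback of the descended bundle to `X`. -/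
noncomputable abbrev pullbackBundle : HolBundle.{u, w} 2 X := D.bundle.pullback C.π

/-- The pullback to `X` of the chosen frame around `b`. -/
noncomputable def pullbackFrame (b : OnePoint ℂ) (k : Fin 2) (q : X) : D.pullbackBundle.fiber q :=
  D.frame hε b k (C.π q)

/-- The linear map `π^* D → E` of bundles on `X`. -/
noncomputable def pullbackEval (q : X) : D.pullbackBundle.fiber q →ₗ[ℂ] E.fiber q :=
  D.evalMap hε q

theorem holAt_pullbackFrame {b : OnePoint ℂ} {p : X} (hp : C.π p ∈ frameSet h hε b) (k : Fin 2) :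
    D.pullbackBundle.HolAt (D.pullbackFrame hε b k) p :=
  HolBundle.holAt_pullback (f := C.π) (D.holAt_frame hε hp k)

theorem linearIndependent_pullbackFrame (p : X) :
    LinearIndependent ℂ ![D.pullbackFrame hε (C.π p) 0 p, D.pullbackFrame hε (C.π p) 1 p] :=
  D.linearIndependent_frame hε (C.π p)

theorem pullbackEval_pullbackFrame {b : OnePoint ℂ} {p : X} (hp : C.π p ∈ frameSet h hε b)
    (k : Fin 2) : D.pullbackEval hε p (D.pullbackFrame hε b k p) = descentFrame h hε b k p :=
  D.evalMap_frame hε hp k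

theorem eventually_mem_frameSet (h : HyperellipticLift C E) (hε : ε = 1 ∨ ε = -1) (p : X) :
    ∀ᶠ q in 𝓝 p, C.π q ∈ frameSet h hε (C.π p) :=
  C.continuous_π.continuousAt.eventually
    ((frameSet h hε (C.π p)).2.mem_nhds (mem_frameSet h hε (C.π p)))

theorem exists_coeff_pullbackFrame {t : ∀ q, D.pullbackBundle.fiber q} {p : X}
    (ht : D.pullbackBundle.HolAt t p) :
    ∃ a b : X → ℂ, HolFunAt a p ∧ HolFunAt b p ∧ ∀ᶠ q in 𝓝 p,
      t q = a q • D.pullbackFrame hε (C.π p) 0 q + b q • D.pullbackFrame hε (C.π p) 1 q ∧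
      D.pullbackEval hε q (t q) =
        a q • descentFrame h hε (C.π p) 0 q + b q • descentFrame h hε (C.π p) 1 q := by
  obtain ⟨a, b, ha, hb, hab⟩ := (D.holAt_pullbackFrame hε (mem_frameSet h hε (C.π p)) 0).exists_coeff
    (D.holAt_pullbackFrame hε (mem_frameSet h hε (C.π p)) 1)
    (D.linearIndependent_pullbackFrame hε p) ht
  refine ⟨a, b, ha, hb, ?_⟩
  filter_upwards [hab, eventually_mem_frameSet h hε p] with q h1 h2
  refine ⟨h1, ?_⟩
  rw [h1, map_add, _root_.map_smul, _root_.map_smul, D.pullbackEval_pullbackFrame hε h2,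
    D.pullbackEval_pullbackFrame hε h2]

theorem holAt_pullbackEval {t : ∀ q, D.pullbackBundle.fiber q} {p : X}
    (ht : D.pullbackBundle.HolAt t p) : E.HolAt (fun q => D.pullbackEval hε q (t q)) p := by
  obtain ⟨a, b, ha, hb, hab⟩ := D.exists_coeff_pullbackFrame hε ht
  have hf := (isDescentFrame_descentFrame h hε (C.π p)).hol p rfl
  exact (((hf 0).smul ha).add ((hf 1).smul hb)).congr (hab.mono fun q hq => hq.2)

open Classical in
/-- The inverse of `π^* D → E` off the Weierstrass points. -/
noncomputable def pullbackInv (q : X) : E.fiber q →ₗ[ℂ] D.pullbackBundle.fiber q :=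
  if hq : C.ι q ≠ q then
    (LinearEquiv.ofBijective (D.pullbackEval hε q) (D.evalMap_bijective hε hq)).symm.toLinearMap
  else 0

theorem pullbackEval_pullbackInv {q : X} (hq : C.ι q ≠ q) (e : E.fiber q) :
    D.pullbackEval hε q (D.pullbackInv hε q e) = e := by
  rw [pullbackInv, dif_pos hq]
  exact (LinearEquiv.ofBijective (D.pullbackEval hε q)
    (D.evalMap_bijective hε hq)).apply_symm_apply e

theorem pullbackInv_pullbackEval {q : X} (hq : C.ι q ≠ q) (e : D.pullbackBundle.fiber q) :
    D.pullbackInv hε q (D.pullbackEval hε q e) = e := by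
  rw [pullbackInv, dif_pos hq]
  exact (LinearEquiv.ofBijective (D.pullbackEval hε q)
    (D.evalMap_bijective hε hq)).symm_apply_apply e

theorem holAt_pullbackInv {σ : ∀ q, E.fiber q} {p : X} (hσ : E.HolAt σ p) (hp : C.ι p ≠ p) :
    D.pullbackBundle.HolAt (fun q => D.pullbackInv hε q (σ q)) p := by
  have hf := isDescentFrame_descentFrame h hε (C.π p)
  obtain ⟨a, b, ha, hb, hab⟩ := (hf.hol p rfl 0).exists_coeff (hf.hol p rfl 1)
    (hf.linearIndependent.self_of_nhds p rfl hp) hσ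
  refine (((D.holAt_pullbackFrame hε (mem_frameSet h hε (C.π p)) 0).smul ha).add
    ((D.holAt_pullbackFrame hε (mem_frameSet h hε (C.π p)) 1).smul hb)).congr ?_
  filter_upwards [hab, eventually_mem_frameSet h hε p,
    (isOpen_ne_fun C.continuous_ι continuous_id).mem_nhds hp] with q h1 h2 h3
  rw [h1, ← D.pullbackEval_pullbackFrame hε h2, ← D.pullbackEval_pullbackFrame hε h2,
    ← _root_.map_smul, ← _root_.map_smul, ← map_add]
  exact D.pullbackInv_pullbackEval hε h3 _

/-- The restriction of sections of `E` to `U ∖ W`, as sections of `π^* D`. -/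
noncomputable def elmToSections (U : Opens X) :
    E.sections U →ₗ[ℂ] D.pullbackBundle.sections (U ⊓ C.weierstrass.compl) where
  toFun σ := ⟨fun p => D.pullbackInv hε p (σ.1 ⟨p, p.2.1⟩),
    (HolBundle.isHolSection_iff_extend _ _).2 fun p hp => by
      refine (D.holAt_pullbackInv hε (E.holAt_extend σ hp.1) hp.2).congr ?_
      filter_upwards [(U ⊓ C.weierstrass.compl).2.mem_nhds hp] with q hq
      rw [HolBundle.extend_apply _ _ hq, E.extend_apply σ.1 (q := q) hq.1]⟩
  map_add' σ τ := Subtype.ext (funext fun p => map_add (D.pullbackInv hε (p : X)) _ _)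
  map_smul' c σ := Subtype.ext (funext fun p => _root_.map_smul (D.pullbackInv hε (p : X)) c _)

theorem elmToSections_apply {U : Opens X} (σ : E.sections U)
    (p : (U ⊓ C.weierstrass.compl : Opens X)) :
    (D.elmToSections hε U σ).1 p = D.pullbackInv hε p (σ.1 ⟨p, p.2.1⟩) := rfl

/-- W has no interior, so a section vanishing off W vanishes. -/
theorem elmToSections_injective (U : Opens X) : Function.Injective (D.elmToSections hε U) := by
  rw [injective_iff_map_eq_zero]
  intro σ hσ
  refine Subtype.ext (funext fun p => ?_)
  have h1 : E.extend σ.1 p = 0 := by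
    refine (E.holAt_extend σ p.2).eq_of_eventuallyEq HolBundle.holAt_zero ?_
    filter_upwards [C.eventually_ι_ne (p : X), nhdsWithin_le_nhds (U.2.mem_nhds p.2)] with q h1 h2
    have h3 : D.pullbackInv hε q (σ.1 ⟨q, h2⟩) = 0 :=
      congrFun (congrArg Subtype.val hσ) ⟨q, h2, h1⟩
    rw [E.extend_apply σ.1 h2, ← D.pullbackEval_pullbackInv hε h1 (σ.1 ⟨q, h2⟩), h3, map_zero]
  rwa [E.extend_apply σ.1 p.2] at h1

/-- Write the odd function as ζ u with ζ the centred coordinate and u a unit. The section a f₀ + β g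
of E corresponds to a F₀ + β/(ζ u) F₁, and ζ times this is the `G` below, whose value at `w` lies on
the line of F₁. -/
theorem hasSimplePoleAlong_elmToSections {U : Opens X} (σ : E.sections U) (w : C.weierstrass)
    (hw : (w : X) ∈ U) :
    HasSimplePoleAlong C.weierstrass D.pullbackBundle (D.elmToSections hε U σ) w
      (D.direction (C.π w)) := by
  have hι : C.ι w = w := w.2
  have hf := isDescentFrame_descentFrame h hε (C.π w)
  have hi := mem_lineBaseSet_patchIndex (C.π w)
  obtain ⟨g, hg, hfg, hli, -⟩ := hf.branch w rfl hι
  obtain ⟨a, β, ha, hβ, hab⟩ := (hf.hol w rfl 0).exists_coeff hg hli (E.holAt_extend σ hw)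
  obtain ⟨N, hN, hinj⟩ := C.exists_injOn_oddFun hi hι
  obtain ⟨u, hu, hu0, hηu⟩ := (C.holFunAt_oddFun hi).exists_eq_centredCoord_mul_unit
    ((C.oddFun_eq_zero_iff hi).2 hι) hN hinj
  have hF := D.holAt_pullbackFrame hε (mem_frameSet h hε (C.π w))
  set G : ∀ q, D.pullbackBundle.fiber q := fun q =>
    (centredCoord (w : X) q * a q) • D.pullbackFrame hε (C.π w) 0 q +
      (β q * (u q)⁻¹) • D.pullbackFrame hε (C.π w) 1 q with hG
  have hGhol : D.pullbackBundle.HolAt G w :=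
    ((hF 0).smul ((holFunAt_centredCoord (w : X)).mul' ha)).add
      ((hF 1).smul (hβ.mul' (hu.inv hu0)))
  obtain ⟨U', hU', hwU', hP⟩ := exists_opens_of_eventually hw (hGhol.eventually.and
    (hab.and (hηu.and (hfg.and ((hu.continuousAt.eventually_ne hu0).and
      (eventually_mem_frameSet h hε w))))))
  refine ⟨U', hU', hwU', D.pullbackBundle.mkSection U' G fun q hq => (hP q hq).1, ?_, ?_⟩
  · rw [D.direction_eq_ker hε hι]
    change D.pullbackEval hε w (G w) = 0
    simp only [hG, centredCoord_self, zero_mul, zero_smul, zero_add]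
    rw [_root_.map_smul, D.pullbackEval_pullbackFrame hε (mem_frameSet h hε _),
      descentFrame_one_eq_zero h hε hι, smul_zero]
  · rintro ⟨q, hqU', hqW⟩
    obtain ⟨-, h2, h3, h4, h5, h6⟩ := hP q hqU'
    change G q = centredCoord (w : X) q • D.pullbackInv hε q (σ.1 ⟨q, hU' hqU'⟩)
    rw [← E.extend_apply σ.1 (hU' hqU'), h2, ← D.pullbackInv_pullbackEval hε hqW (G q), ← _root_.map_smul]
    congr 1
    simp only [hG]
    rw [map_add, _root_.map_smul, _root_.map_smul, D.pullbackEval_pullbackFrame hε h6,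
      D.pullbackEval_pullbackFrame hε h6, h4, h3]
    match_scalars <;> field_simp

/-- If ζ t = a F₀ + b F₁ has its value at `w` in the kernel, then a = ζ a'. Since F₁ goes to ζ u g,
the section t goes to a' f₀ + b u g, which is holomorphic at `w`. -/
theorem exists_holAt_eq_pullbackEval {U : Opens X}
    {t : D.pullbackBundle.sections (U ⊓ C.weierstrass.compl)} (w : C.weierstrass)
    (ht : HasSimplePoleAlong C.weierstrass D.pullbackBundle t w (D.direction (C.π w))) :
    ∃ σ : ∀ q, E.fiber q, E.HolAt σ w ∧ ∀ᶠ q in 𝓝[≠] (w : X),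
      σ q = D.pullbackEval hε q (D.pullbackBundle.extend t.1 q) := by
  have hι : C.ι w = w := w.2
  have hf := isDescentFrame_descentFrame h hε (C.π w)
  have hi := mem_lineBaseSet_patchIndex (C.π w)
  obtain ⟨U', hU', hwU', G, hGw, hGt⟩ := ht
  obtain ⟨g, hg, hfg, hli, -⟩ := hf.branch w rfl hι
  obtain ⟨N, hN, hinj⟩ := C.exists_injOn_oddFun hi hι
  obtain ⟨u, hu, hu0, hηu⟩ := (C.holFunAt_oddFun hi).exists_eq_centredCoord_mul_unit
    ((C.oddFun_eq_zero_iff hi).2 hι) hN hinj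
  obtain ⟨a, b, ha, hb, hab⟩ := D.exists_coeff_pullbackFrame hε
    (D.pullbackBundle.holAt_extend G hwU')
  have haw : a w = 0 := by
    have h1 := hab.self_of_nhds.2
    rw [D.pullbackBundle.extend_apply _ hwU', descentFrame_one_eq_zero h hε hι, smul_zero,
      add_zero] at h1
    rw [D.direction_eq_ker hε hι] at hGw
    have h2 : D.pullbackEval hε w (G.1 ⟨w, hwU'⟩) = 0 := hGw
    rw [h2] at h1
    exact (smul_eq_zero_iff_left (descentFrame_zero_ne_zero h hε hι)).1 h1.symm
  obtain ⟨a', ha', haa', -⟩ := ha.exists_eq_centredCoord_mul haw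
  refine ⟨fun q => a' q • descentFrame h hε (C.π w) 0 q + (b q * u q) • g q,
    ((hf.hol w rfl 0).smul ha').add (hg.smul (hb.mul' hu)), ?_⟩
  filter_upwards [nhdsWithin_le_nhds hab, nhdsWithin_le_nhds haa', nhdsWithin_le_nhds hηu,
    nhdsWithin_le_nhds hfg, eventually_centredCoord_ne_zero (w : X), C.eventually_ι_ne (w : X),
    nhdsWithin_le_nhds (U'.2.mem_nhds hwU')] with q h1 h2 h3 h4 h5 h6 h7
  have h8 := h1.2
  have h9 : D.pullbackBundle.extend G.1 q =
      centredCoord (w : X) q • D.pullbackBundle.extend t.1 q := by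
    rw [D.pullbackBundle.extend_apply _ h7,
      D.pullbackBundle.extend_apply t.1 (q := q) ⟨hU' h7, h6⟩]
    exact hGt ⟨q, h7, h6⟩
  rw [h9, _root_.map_smul, h2, h4, h3] at h8
  apply smul_right_injective _ h5
  simp only
  rw [h8]
  module

theorem mem_range_elmToSections (U : Opens X)
    (t : D.pullbackBundle.sections (U ⊓ C.weierstrass.compl)) :
    t ∈ LinearMap.range (D.elmToSections hε U) ↔ ∀ w : C.weierstrass, (w : X) ∈ U →
      HasSimplePoleAlong C.weierstrass D.pullbackBundle t w (D.direction (C.π w)) := by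
  classical
  constructor
  · rintro ⟨σ, rfl⟩ w hw
    exact D.hasSimplePoleAlong_elmToSections hε σ w hw
  · intro ht
    have h1 : ∀ q : X, ∃ σ : ∀ q, E.fiber q, C.ι q = q → q ∈ U → E.HolAt σ q ∧
        ∀ᶠ q' in 𝓝[≠] q, σ q' = D.pullbackEval hε q' (D.pullbackBundle.extend t.1 q') := by
      intro q
      by_cases hq : C.ι q = q ∧ q ∈ U
      · obtain ⟨σ, hσ⟩ := D.exists_holAt_eq_pullbackEval hε ⟨q, hq.1⟩ (ht ⟨q, hq.1⟩ hq.2)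
        exact ⟨σ, fun _ _ => hσ⟩
      · exact ⟨0, fun h1 h2 => absurd ⟨h1, h2⟩ hq⟩
    choose σ hσ using h1
    -- At a Weierstrass point only the value of its own local extension `σ q` is used; elsewhere the
    -- section is the image of `t`.
    set τ : ∀ q, E.fiber q := fun q => if C.ι q = q then σ q q else
      D.pullbackEval hε q (D.pullbackBundle.extend t.1 q) with hτ
    have hτhol : ∀ q ∈ U, E.HolAt τ q := by
      intro q hq
      by_cases hι : C.ι q = q
      · refine (hσ q hι hq).1.congr ?_
        filter_upwards [eventually_nhdsWithin_iff.1 (hσ q hι hq).2,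
          eventually_nhdsWithin_iff.1 (C.eventually_ι_ne q)] with q' h1 h2
        by_cases hqq : q' = q
        · subst hqq
          simp only [hτ, if_pos hι]
        · simp only [hτ, if_neg (h2 hqq)]
          exact (h1 hqq).symm
      · refine (D.holAt_pullbackEval hε (D.pullbackBundle.holAt_extend t (p := q) ⟨hq, hι⟩)).congr ?_
        filter_upwards [(isOpen_ne_fun C.continuous_ι continuous_id).mem_nhds hι] with q' hq'
        simp only [hτ]
        exact if_neg hq'
    refine ⟨E.mkSection U τ hτhol, Subtype.ext (funext fun p => ?_)⟩
    rw [elmToSections_apply]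
    change D.pullbackInv hε p (τ p) = _
    have hp : C.ι p ≠ p := p.2.2
    simp only [hτ]
    rw [if_neg hp, D.pullbackInv_pullbackEval hε hp, D.pullbackBundle.extend_apply _ p.2]

/-- Sections of E that extend across `w` as sections of the pullback are, near `w`, images under
`pullbackEval`, so their values at `w` fill its range, which is the ε-eigenline. -/
theorem eigendirection_eq_span (w : C.weierstrass) :
    h.eigendirection ε w = Submodule.span ℂ
      {e | ∃ (U : Opens X) (hw : (w : X) ∈ U) (σ : E.sections U),
        ExtendsAcross C.weierstrass D.pullbackBundle (D.elmToSections hε U σ) w ∧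
          σ.1 ⟨w, hw⟩ = e} := by
  have h1 : {e | ∃ (U : Opens X) (hw : (w : X) ∈ U) (σ : E.sections U),
      ExtendsAcross C.weierstrass D.pullbackBundle (D.elmToSections hε U σ) w ∧
        σ.1 ⟨w, hw⟩ = e} =
        ((LinearMap.range (D.pullbackEval hε w) : Submodule ℂ (E.fiber w)) : Set (E.fiber w)) := by
    ext e
    constructor
    · rintro ⟨U, hw, σ, ⟨U', hU', hwU', g, hg⟩, rfl⟩
      refine ⟨D.pullbackBundle.extend g.1 w, ?_⟩
      rw [← E.extend_apply σ.1 hw]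
      refine (D.holAt_pullbackEval hε (D.pullbackBundle.holAt_extend g hwU')).eq_of_eventuallyEq
        (E.holAt_extend σ hw) ?_
      filter_upwards [C.eventually_ι_ne (w : X), nhdsWithin_le_nhds (U'.2.mem_nhds hwU')]
        with q h2 h3
      rw [D.pullbackBundle.extend_apply _ h3, hg ⟨q, h3, h2⟩, elmToSections_apply,
        D.pullbackEval_pullbackInv hε h2, E.extend_apply σ.1 (hU' h3)]
    · rintro ⟨x, rfl⟩
      obtain ⟨τ, hτ, rfl⟩ := D.pullbackBundle.exists_holAt_eq (w : X) x
      obtain ⟨U, -, hwU, hU⟩ := exists_opens_of_eventually (U := ⊤) (Opens.mem_top (w : X))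
        hτ.eventually
      refine ⟨U, hwU, E.mkSection U _ fun q hq => D.holAt_pullbackEval hε (hU q hq),
        ⟨U, le_rfl, hwU, D.pullbackBundle.mkSection U τ hU, fun q => ?_⟩, rfl⟩
      exact (D.pullbackInv_pullbackEval hε q.2.2 _).symm
  rw [h1, Submodule.span_eq]
  exact D.eigendirection_eq_range hε w

/-- The bundle `E` is the positive elementary transformation of the pullback of its descent. -/
noncomputable def positiveElmIso : PositiveElmIso C.weierstrass (D.bundle.pullback C.π)
    (fun p => D.direction (C.π p)) E (h.eigendirection ε) where
  toSections := D.elmToSections hε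
  map_smul _ _ _ b := _root_.map_smul (D.pullbackInv hε (b : X)) _ _
  map_restrict _ _ _ _ _ := rfl
  injective := D.elmToSections_injective hε
  mem_range := D.mem_range_elmToSections hε
  direction := D.eigendirection_eq_span hε

theorem positiveElmIso_toSections (V : Opens (OnePoint ℂ)) (σ : D.bundle.sections V)
    (p : (C.preimage V ⊓ C.weierstrass.compl : Opens X)) :
    ((D.positiveElmIso hε).toSections (C.preimage V) (D.toSections V σ)).1 p =
      σ.1 ⟨C.π p, p.2.1⟩ := by
  change D.pullbackInv hε p ((D.toSections V σ).1 ⟨p, p.2.1⟩) = _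
  rw [D.toSections_apply hε σ ⟨p, p.2.1⟩]
  exact D.pullbackInv_pullbackEval hε p.2.2 _

end HyperellipticDescent

/-! ### Alternating forms on a plane -/

section AlternatingPairs

variable {V V' : Type*} [AddCommGroup V] [Module ℂ V] [AddCommGroup V'] [Module ℂ V']

theorem AlternatingMap.map_pair_add_smul (g : V [⋀^Fin 2]→ₗ[ℂ] V') (x y : V) (a b c d : ℂ) :
    g ![a • x + b • y, c • x + d • y] = (a * d - b * c) • g ![x, y] := by
  have hxx : ∀ x, g ![x, x] = 0 := fun x => g.map_eq_zero_of_eq _ (i := 0) (j := 1) rfl (by simp)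
  have hs : ∀ x y, g ![y, x] = -g ![x, y] := fun x y => by
    rw [← g.map_swap ![x, y] (i := 0) (j := 1) (by simp)]
    congr 1
    funext k
    fin_cases k <;> rfl
  have hr : ∀ z, g ![z, c • x + d • y] = c • g ![z, x] + d • g ![z, y] := fun z => by
    rw [hs (c • x + d • y) z, g.map_vecCons_add, g.map_vecCons_smul, g.map_vecCons_smul, hs z x,
      hs z y]
    module
  rw [hr, g.map_vecCons_add, g.map_vecCons_add, g.map_vecCons_smul, g.map_vecCons_smul,
    g.map_vecCons_smul, g.map_vecCons_smul, hxx, hxx, hs x y]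
  module

theorem AlternatingMap.map_pair_ne_zero {g : V [⋀^Fin 2]→ₗ[ℂ] ℂ} (hg : g ≠ 0)
    (hV : Module.finrank ℂ V = 2) {x y : V} (h : LinearIndependent ℂ ![x, y]) :
    g ![x, y] ≠ 0 := by
  have := (AlternatingMap.map_basis_ne_zero_iff
    (basisOfLinearIndependentOfCardEqFinrank h (by simp [hV])) g).2 hg
  rwa [coe_basisOfLinearIndependentOfCardEqFinrank] at this

/-- The linear isomorphism `⋀² V ≃ ℂ¹` taking `x ∧ y` to the nonzero number `κ`. -/
theorem exists_exteriorPower_equiv (hV : Module.finrank ℂ V = 2) {x y : V}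
    (h : LinearIndependent ℂ ![x, y]) {κ : ℂ} (hκ : κ ≠ 0) :
    ∃ e : ⋀[ℂ]^2 V ≃ₗ[ℂ] (Fin 1 → ℂ), ∀ a b c d : ℂ,
      e (exteriorPower.ιMulti ℂ 2 ![a • x + b • y, c • x + d • y]) =
        fun _ => (a * d - b * c) * κ := by
  have : FiniteDimensional ℂ V := Module.finite_of_finrank_pos (by omega)
  let B := basisOfLinearIndependentOfCardEqFinrank h (by simp [hV])
  let e₀ : ⋀[ℂ]^2 V →ₗ[ℂ] (Fin 1 → ℂ) :=
    LinearMap.pi fun _ => exteriorPower.alternatingMapLinearEquiv (κ • B.det)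
  have h1 : e₀ (exteriorPower.ιMulti ℂ 2 ![x, y]) = fun _ => κ := by
    funext k
    have h2 : B.det ![x, y] = 1 := by
      rw [← coe_basisOfLinearIndependentOfCardEqFinrank h (by simp [hV])]
      exact B.det_self
    simp [e₀, exteriorPower.alternatingMapLinearEquiv_apply_ιMulti, h2]
  have hsurj : Function.Surjective e₀ := fun v => by
    refine ⟨(v 0 * κ⁻¹) • exteriorPower.ιMulti ℂ 2 ![x, y], ?_⟩
    rw [map_smul, h1]
    funext k
    rw [Subsingleton.elim k 0]
    simp [mul_assoc, inv_mul_cancel₀ hκ]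
  have hinj := (LinearMap.injective_iff_surjective_of_finrank_eq_finrank (f := e₀)
    (by rw [exteriorPower.finrank_eq, hV]; simp)).2 hsurj
  refine ⟨LinearEquiv.ofBijective e₀ ⟨hinj, hsurj⟩, fun a b c d => ?_⟩
  rw [AlternatingMap.map_pair_add_smul, map_smul]
  exact congrArg ((a * d - b * c) • ·) h1

end AlternatingPairs

/-! ### Area forms from a trivial determinant -/

namespace HolBundle

open Filter Topology

variable {B : Type u} [TopologicalSpace B] [ChartedSpace ℂ B]

theorem holAt_trivial_iff {n : ℕ} {s : B → Fin n → ℂ} {p : B} :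
    (trivial n B).HolAt s p ↔ ContMDiffAt 𝓘(ℂ) 𝓘(ℂ, Fin n → ℂ) ω s p :=
  holAt_iff _ _ _

theorem exists_linearIndependent_pair (E : HolBundle.{u, v} 2 B) (p : B) :
    ∃ x y : E.fiber p, LinearIndependent ℂ ![x, y] := by
  let b : Module.Basis (Fin 2) ℂ (E.fiber p) :=
    (Pi.basisFun ℂ (Fin 2)).map (E.trivEquiv (E.self_mem_baseSet p)).symm
  refine ⟨b 0, b 1, ?_⟩
  convert b.linearIndependent using 1
  funext k
  fin_cases k <;> rfl

/-- A trivialization of the determinant is a nowhere vanishing holomorphic family of alternating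
forms. -/
theorem DetIso.exists_areaForm [IsManifold 𝓘(ℂ) ω B] {E : HolBundle.{u, v} 2 B}
    (hE : DetIso E (trivial 1 B)) :
    ∃ g : ∀ p, E.fiber p [⋀^Fin 2]→ₗ[ℂ] ℂ, (∀ p, g p ≠ 0) ∧
      ∀ (s₁ s₂ : ∀ q, E.fiber q) (p : B), E.HolAt s₁ p → E.HolAt s₂ p →
        HolFunAt (fun q => g q ![s₁ q, s₂ q]) p := by
  obtain ⟨δ, hδ⟩ := hE
  let π₀ : (Fin 1 → ℂ) →ₗ[ℂ] ℂ := LinearMap.proj 0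
  let L : ∀ p, ⋀[ℂ]^2 (E.fiber p) →ₗ[ℂ] ℂ := fun p => π₀.comp (δ p).toLinearMap
  refine ⟨fun p => (L p).compAlternatingMap (exteriorPower.ιMulti ℂ 2), fun p hp => ?_,
    fun s₁ s₂ p h₁ h₂ => ?_⟩
  · have h1 : L p = 0 := exteriorPower.linearMap_ext (hp.trans rfl)
    have h2 : L p ((δ p).symm fun _ => 1) = 1 :=
      congrArg π₀ ((δ p).apply_symm_apply fun _ => 1)
    rw [h1] at h2
    exact zero_ne_one h2
  · obtain ⟨U, -, hpU, hU⟩ := exists_opens_of_eventually (U := ⊤) (Opens.mem_top p)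
      (h₁.eventually.and h₂.eventually)
    have h3 := (isHolSection_restrict_iff (trivial 1 B) U
      (fun q => δ q (exteriorPower.ιMulti ℂ 2 ![s₁ q, s₂ q]))).1
      (hδ U (E.mkSection U s₁ fun q hq => (hU q hq).1) (E.mkSection U s₂ fun q hq => (hU q hq).2))
      p hpU
    exact contMDiffAt_pi_space.1 (holAt_trivial_iff.1 h3) 0

end HolBundle

/-! ### The determinant of the descent -/

section OddDeterminant

open Filter Topology

variable {r s t : ℂ} {X : Type u} [TopologicalSpace X] [T2Space X] [CompactSpace X]
  [ChartedSpace ℂ X] [IsManifold 𝓘(ℂ) ω X]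
  {C : GenusTwoCurve r s t X} {E : HolBundle.{u, v} 2 X}

/-- The action of the lift on the determinant changes the sign of a trivialization. -/
theorem HyperellipticLift.areaForm_transfer [ConnectedSpace X] (h : HyperellipticLift C E)
    {g : ∀ p, E.fiber p [⋀^Fin 2]→ₗ[ℂ] ℂ} (hg0 : ∀ p, g p ≠ 0)
    (hg : ∀ (s₁ s₂ : ∀ q, E.fiber q) (p : X), E.HolAt s₁ p → E.HolAt s₂ p →
      HolFunAt (fun q => g q ![s₁ q, s₂ q]) p) (σ₁ σ₂ : ∀ q, E.fiber q) (q : X) :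
    g q ![h.transfer σ₁ q, h.transfer σ₂ q] = -g (C.ι q) ![σ₁ (C.ι q), σ₂ (C.ι q)] := by
  -- The space of area forms on a plane is one-dimensional, so pulling back by the lift only
  -- rescales the form.
  have hex : ∀ q, ∃ c : ℂ, ∀ σ₁ σ₂ : ∀ q, E.fiber q,
      g q ![h.transfer σ₁ q, h.transfer σ₂ q] = c * g (C.ι q) ![σ₁ (C.ι q), σ₂ (C.ι q)] := by
    intro q
    obtain ⟨x, y, hB⟩ := E.exists_linearIndependent_pair (C.ι q)
    refine ⟨g q ![(h.map q).symm x, (h.map q).symm y] / g (C.ι q) ![x, y],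
      fun σ₁ σ₂ => ?_⟩
    obtain ⟨a, b, h1⟩ := exists_coeff_of_linearIndependent_pair (E.finrank_fiber _) hB (σ₁ (C.ι q))
    obtain ⟨c, d, h2⟩ := exists_coeff_of_linearIndependent_pair (E.finrank_fiber _) hB (σ₂ (C.ι q))
    have h3 := AlternatingMap.map_pair_ne_zero (hg0 (C.ι q)) (E.finrank_fiber _) hB
    simp only [transfer, h1, h2, map_add, map_smul, AlternatingMap.map_pair_add_smul, smul_eq_mul]
    field_simp
  choose c hc using hex
  have hhol : ∀ p, HolFunAt c p := by
    intro p
    obtain ⟨x, y, hB⟩ := E.exists_linearIndependent_pair (C.ι p)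
    obtain ⟨σ₁, h₁, h₁p⟩ := E.exists_holAt_eq (C.ι p) x
    obtain ⟨σ₂, h₂, h₂p⟩ := E.exists_holAt_eq (C.ι p) y
    have h3 : HolFunAt (fun q => g (C.ι q) ![σ₁ (C.ι q), σ₂ (C.ι q)]) p :=
      ContMDiffAt.comp (g := fun q => g q ![σ₁ q, σ₂ q]) p (hg σ₁ σ₂ _ h₁ h₂) (C.ι.contMDiff p)
    have h4 : g (C.ι p) ![σ₁ (C.ι p), σ₂ (C.ι p)] ≠ 0 := by
      rw [h₁p, h₂p]
      exact AlternatingMap.map_pair_ne_zero (hg0 _) (E.finrank_fiber _) hB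
    have h5 := (hg _ _ p (h.holAt_transfer h₁) (h.holAt_transfer h₂)).mul' (h3.inv h4)
    refine h5.congr_of_eventuallyEq ?_
    filter_upwards [h3.continuousAt.eventually_ne h4] with q hq
    rw [hc q, mul_assoc, mul_inv_cancel₀ hq, mul_one]
  -- The factor `c` is holomorphic on a compact connected surface, hence constant. It is computed at
  -- a Weierstrass point, where it is the product of the eigenvalues 1 and -1.
  have : IsManifold 𝓘(ℂ) 1 X := IsManifold.of_le (n := ω) (by simp)
  have hmd : MDifferentiable 𝓘(ℂ) 𝓘(ℂ) c := fun p => (hhol p).mdifferentiableAt (by simp)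
  obtain ⟨p, hp⟩ : ∃ p, C.ι p = p := by
    have h1 := C.ncard_weierstrass
    obtain ⟨p, hp⟩ := nonempty_of_ncard_ne_zero (s := (C.weierstrass : Set X)) (by omega)
    exact ⟨p, hp⟩
  obtain ⟨x, y, hxy, hx, hy⟩ := exists_eigenvector_pair (Or.inl rfl) (h.hasEigenvalue_one ⟨p, hp⟩)
    (h.hasEigenvalue_neg_one ⟨p, hp⟩)
  obtain ⟨e₁, -, rfl⟩ := E.exists_holAt_eq p x
  obtain ⟨e₂, -, rfl⟩ := E.exists_holAt_eq p y
  rw [h.fiberEnd_apply ⟨p, hp⟩] at hx hy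
  have h6 := hc p e₁ e₂
  have h7 : g (C.ι p) ![e₁ (C.ι p), e₂ (C.ι p)] = g p ![e₁ p, e₂ p] :=
    congrArg (fun q => g q ![e₁ q, e₂ q]) hp
  have h8 : g p ![h.transfer e₁ p, h.transfer e₂ p] = -g p ![e₁ p, e₂ p] := by
    have h9 := AlternatingMap.map_pair_add_smul (g p) (e₁ p) (e₂ p) 1 0 0 (-1)
    change h.transfer e₁ p = _ at hx
    change h.transfer e₂ p = _ at hy
    rw [hx, hy]
    simpa using h9
  have h10 : c p = -1 := by
    refine mul_right_cancel₀ (AlternatingMap.map_pair_ne_zero (hg0 p) (E.finrank_fiber _) hxy) ?_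
    rw [← h7, ← h6, h8, h7, neg_one_mul]
  rw [hc q, hmd.apply_eq_of_compactSpace q p, h10, neg_one_mul]

/-- The relation y = x³ · (y / x³) is the source of the degree -3. -/
theorem GenusTwoCurve.oddFun_eq_lineTransition_mul (C : GenusTwoCurve r s t X) {i j : Bool} {q : X}
    (hi : C.π q ∈ lineBaseSet i) (hj : C.π q ∈ lineBaseSet j) :
    C.oddFun i q = lineTransition (-3) i j (C.π q) * C.oddFun j q := by
  cases i <;> cases j
  · exact (one_mul _).symm
  · rw [C.oddFun_false_eq hj hi]
    rfl
  · rw [C.oddFun_false_eq hi hj, ← mul_assoc]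
    have h0 := affineCoord_ne_zero hi hj
    change _ = affineCoord (C.π q) ^ (-3 : ℤ) * _ * _
    rw [zpow_neg]
    norm_cast
    rw [inv_mul_cancel₀ (pow_ne_zero 3 h0), one_mul]
  · exact (one_mul _).symm

variable {h : HyperellipticLift C E} {ε : ℂ}

/-- Near `b`, the function `τ₁ ∧ τ₂` on `X` is the product of an odd function and `K`. -/
def HasOddQuotient (C : GenusTwoCurve r s t X) {E : HolBundle.{u, v} 2 X}
    (g : ∀ p, E.fiber p [⋀^Fin 2]→ₗ[ℂ] ℂ) (τ₁ τ₂ : ∀ q, E.fiber q) (i : Bool)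
    (K : OnePoint ℂ → ℂ) (b : OnePoint ℂ) : Prop :=
  HolFunAt K b ∧ ∀ᶠ c in 𝓝 b, ∀ q, C.π q = c → g q ![τ₁ q, τ₂ q] = C.oddFun i q * K c

/-- The two factors ε cancel and the sign -1 of the lift on determinants remains, so the area of two
equivariant sections is odd. -/
theorem exists_hasOddQuotient [ConnectedSpace X] (hεε : ε * ε = 1)
    {g : ∀ p, E.fiber p [⋀^Fin 2]→ₗ[ℂ] ℂ} (hg0 : ∀ p, g p ≠ 0)
    (hg : ∀ (s₁ s₂ : ∀ q, E.fiber q) (p : X), E.HolAt s₁ p → E.HolAt s₂ p →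
      HolFunAt (fun q => g q ![s₁ q, s₂ q]) p) {τ₁ τ₂ : ∀ q, E.fiber q} {b : OnePoint ℂ}
    (h₁ : IsEquivariantGerm h ε τ₁ b) (h₂ : IsEquivariantGerm h ε τ₂ b) {i : Bool}
    (hi : b ∈ lineBaseSet i) : ∃ K, HasOddQuotient C g τ₁ τ₂ i K b := by
  refine C.exists_descend_odd hi (fun p hp => hg τ₁ τ₂ p (h₁.1 p hp) (h₂.1 p hp)) ?_
  filter_upwards [h₁.2, h₂.2] with c h3 h4 q hq
  have h5 := h.areaForm_transfer hg0 hg τ₁ τ₂ q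
  have h6 := AlternatingMap.map_pair_add_smul (g q) (τ₁ q) (τ₂ q) ε 0 0 ε
  simp only [zero_smul, add_zero, zero_add, mul_zero, sub_zero, hεε, one_smul] at h6
  rw [h3 q hq, h4 q hq, h6] at h5
  rw [h5, neg_neg]

/-- Off W the frame is independent in E. At a Weierstrass point `f 1` is the odd function times `e`,
so `K` is the area of `f 0` and `e`, which are independent. -/
theorem HasOddQuotient.ne_zero {g : ∀ p, E.fiber p [⋀^Fin 2]→ₗ[ℂ] ℂ} (hg0 : ∀ p, g p ≠ 0)
    (hg : ∀ (s₁ s₂ : ∀ q, E.fiber q) (p : X), E.HolAt s₁ p → E.HolAt s₂ p →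
      HolFunAt (fun q => g q ![s₁ q, s₂ q]) p) {f : Fin 2 → ∀ q, E.fiber q} {b : OnePoint ℂ}
    (hf : IsDescentFrame h ε f b) {K : OnePoint ℂ → ℂ}
    (hK : HasOddQuotient C g (f 0) (f 1) (patchIndex b) K b) : K b ≠ 0 := by
  obtain ⟨p, rfl⟩ := C.π_surjective b
  by_cases hp : C.ι p = p
  · obtain ⟨e, he, hfe, hli, -⟩ := hf.branch p rfl hp
    have h1 : g p ![f 0 p, e p] = K (C.π p) := by
      refine eq_of_eventuallyEq_nhdsNE (f := fun q => g q ![f 0 q, e q]) (g := fun q => K (C.π q))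
        (hg _ _ p (hf.hol p rfl 0) he).continuousAt
        (ContinuousAt.comp hK.1.continuousAt C.continuous_π.continuousAt) ?_
      filter_upwards [C.eventually_ι_ne p, nhdsWithin_le_nhds hfe,
        nhdsWithin_le_nhds (C.eventually_π_mem_lineBaseSet (mem_lineBaseSet_patchIndex (C.π p))),
        nhdsWithin_le_nhds (C.continuous_π.continuousAt.eventually hK.2)] with q h2 h3 h5 h6
      have h7 := AlternatingMap.map_pair_add_smul (g q) (f 0 q) (e q) 1 0 0
        (C.oddFun (patchIndex (C.π p)) q)
      simp only [zero_smul, add_zero, zero_add, mul_zero, sub_zero, one_smul, one_mul,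
        smul_eq_mul] at h7
      refine mul_left_cancel₀ (C.oddFun_ne_zero h5 h2) ?_
      rw [← h7, ← h3, h6 q rfl]
    rw [← h1]
    exact AlternatingMap.map_pair_ne_zero (hg0 p) (E.finrank_fiber p) hli
  · intro h0
    have h1 := hK.2.self_of_nhds p rfl
    rw [h0, mul_zero] at h1
    exact AlternatingMap.map_pair_ne_zero (hg0 p) (E.finrank_fiber p)
      (hf.linearIndependent.self_of_nhds p rfl hp) h1

/-- The behaviour of `K` under a change of coefficients and of the chart of `ℙ¹`. -/
theorem HasOddQuotient.eq_mul {g : ∀ p, E.fiber p [⋀^Fin 2]→ₗ[ℂ] ℂ}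
    {f : Fin 2 → ∀ q, E.fiber q} {τ₁ τ₂ : ∀ q, E.fiber q} {b : OnePoint ℂ} {i j : Bool}
    (hi : b ∈ lineBaseSet i) (hj : b ∈ lineBaseSet j) {K L : OnePoint ℂ → ℂ}
    (hK : HasOddQuotient C g (f 0) (f 1) i K b) (hL : HasOddQuotient C g τ₁ τ₂ j L b)
    {A A' : Fin 2 → OnePoint ℂ → ℂ} (hA : HasCoeff C f τ₁ A b) (hA' : HasCoeff C f τ₂ A' b) :
    lineTransition (-3) i j b * ((A 0 b * A' 1 b - A 1 b * A' 0 b) * K b) = L b := by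
  have hij : ∀ᶠ c in 𝓝 b, c ∈ lineBaseSet i ∩ lineBaseSet j :=
    ((isOpen_lineBaseSet i).inter (isOpen_lineBaseSet j)).mem_nhds ⟨hi, hj⟩
  have h1 : HolFunAt (lineTransition (-3) i j) b :=
    (contMDiffOn_lineTransition (-3) i j).contMDiffAt hij
  have h2 := h1.continuousAt.mul (((((hA.1 0).continuousAt.mul (hA'.1 1).continuousAt).sub
    ((hA.1 1).continuousAt.mul (hA'.1 0).continuousAt))).mul hK.1.continuousAt)
  refine eq_of_eventuallyEq_nhdsNE (f := fun c => lineTransition (-3) i j c *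
    ((A 0 c * A' 1 c - A 1 c * A' 0 c) * K c)) h2 hL.1.continuousAt ?_
  filter_upwards [C.eventually_fiber_ι_ne b, nhdsWithin_le_nhds hij, nhdsWithin_le_nhds hK.2,
    nhdsWithin_le_nhds hL.2, nhdsWithin_le_nhds hA.2, nhdsWithin_le_nhds hA'.2]
    with c h3 h4 h5 h6 h7 h8
  obtain ⟨q, rfl⟩ := C.π_surjective c
  refine mul_left_cancel₀ (C.oddFun_ne_zero h4.2 (h3 q rfl)) ?_
  rw [← h6 q rfl, h7 q rfl, h8 q rfl, AlternatingMap.map_pair_add_smul, h5 q rfl,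
    C.oddFun_eq_lineTransition_mul h4.1 h4.2, smul_eq_mul]
  ring

theorem trivCoord_sphereLineBundle (k : ℤ) (b : OnePoint ℂ) (σ : OnePoint ℂ → Fin 1 → ℂ)
    (c : OnePoint ℂ) : (sphereLineBundle k).trivCoord b σ c =
      lineTransition k (patchIndex c) (patchIndex b) c • σ c := rfl

/-- The isomorphism over `b` sends the wedge of the frame vectors at `b` to the nonzero number `K b
b`. It is holomorphic because it sends σ₁ ∧ σ₂ to the quotient of their area on X by the odd
function, read in the trivializations of 𝒪(-3). -/
theorem HyperellipticDescent.detIso [ConnectedSpace X] (D : HyperellipticDescent.{u, v, w} h ε)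
    (hε : ε = 1 ∨ ε = -1) (hE : HolBundle.DetIso E (HolBundle.trivial 1 X)) :
    HolBundle.DetIso D.bundle (sphereLineBundle (-3)) := by
  have hεε : ε * ε = 1 := by rcases hε with rfl | rfl <;> simp
  obtain ⟨g, hg0, hg⟩ := hE.exists_areaForm
  have hf := isDescentFrame_descentFrame h hε
  have hK := fun b => exists_hasOddQuotient hεε hg0 hg ((hf b).isEquivariantGerm 0)
    ((hf b).isEquivariantGerm 1) (mem_lineBaseSet_patchIndex b)
  choose K hK using hK
  have hδ := fun b => exists_exteriorPower_equiv (D.bundle.finrank_fiber b)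
    (D.linearIndependent_frame hε b) ((hK b).ne_zero hg0 hg (hf b))
  choose δ hδ using hδ
  refine ⟨δ, fun V σ₁ σ₂ => ?_⟩
  have key : ∀ b ∈ V, (sphereLineBundle (-3)).HolAt (fun c => δ c (exteriorPower.ιMulti ℂ 2
      ![D.bundle.extend σ₁.1 c, D.bundle.extend σ₂.1 c])) b := by
    intro b hb
    have hb' := mem_lineBaseSet_patchIndex b
    obtain ⟨L, hL⟩ := exists_hasOddQuotient hεε hg0 hg (D.isEquivariantGerm_toSections σ₁ hεε hb)
      (D.isEquivariantGerm_toSections σ₂ hεε hb) hb'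
    refine (HolBundle.holAt_iff _ _ _).2 ?_
    have h1 : ContMDiffAt 𝓘(ℂ) 𝓘(ℂ, Fin 1 → ℂ) ω (fun c (_ : Fin 1) => L c) b :=
      contMDiffAt_pi_space.2 fun _ => hL.1
    refine h1.congr_of_eventuallyEq ?_
    -- The holomorphic function `L`, obtained at `b`, is compared at each nearby `c` with `K c`,
    -- although frame and patch vary with `c`; the change of patch gives exactly the transition
    -- function of 𝒪(-3).
    filter_upwards [hL.1.eventually, hL.2.eventually_nhds, V.2.mem_nhds hb,
      (isOpen_lineBaseSet _).mem_nhds hb'] with c h2 h3 hcV hcb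
    obtain ⟨A, hA, hAσ⟩ := D.exists_coeff_frame hε σ₁ hcV
    obtain ⟨A', hA', hAσ'⟩ := D.exists_coeff_frame hε σ₂ hcV
    refine (trivCoord_sphereLineBundle _ _ _ _).trans ?_
    rw [hAσ.self_of_nhds, hAσ'.self_of_nhds, hδ]
    funext _
    exact (hK c).eq_mul (mem_lineBaseSet_patchIndex c) hcb ⟨h2, h3⟩ hA hA'
  have h4 := (HolBundle.isHolSection_restrict_iff _ V _).2 key
  refine Eq.subst (motive := fun σ : ∀ _ : V, Fin 1 → ℂ =>
    (sphereLineBundle (-3)).IsHolSection V σ) (funext fun p => ?_) h4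
  rw [HolBundle.extend_apply _ _ p.2, HolBundle.extend_apply _ _ p.2]
  rfl

end OddDeterminant

/-! ### The proposition -/

theorem mainTheorem5 {r s t : ℂ} {X : Type u} [TopologicalSpace X] [T2Space X]
    [CompactSpace X] [ConnectedSpace X] [ChartedSpace ℂ X] [IsManifold 𝓘(ℂ) ω X]
    (C : GenusTwoCurve r s t X) (E : HolBundle.{u, v} 2 X)
    (hE : HolBundle.DetIso E (HolBundle.trivial 1 X)) (h : HyperellipticLift C E) :
    (C.weierstrass : Set X).ncard = 6 ∧
    ∀ ε : ℂ, ε = 1 ∨ ε = -1 →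
      Nonempty (HyperellipticDescent.{u, v, 0} h ε) ∧
      ∀ D : HyperellipticDescent.{u, v, w} h ε,
        HolBundle.DetIso D.bundle (sphereLineBundle (-3)) ∧
        (∀ p : C.weierstrass, Module.finrank ℂ (D.direction (C.π p)) = 1) ∧
        (∀ p : C.weierstrass, Module.finrank ℂ (h.eigendirection ε p) = 1) ∧
        ∃ Ψ : PositiveElmIso C.weierstrass
            (D.bundle.pullback C.π) (fun p => D.direction (C.π p)) E (h.eigendirection ε),
          ∀ (V : Opens (OnePoint ℂ)) (σ : D.bundle.sections V)
            (p : (C.preimage V ⊓ C.weierstrass.compl : Opens X)),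
            (Ψ.toSections (C.preimage V) (D.toSections V σ)).1 p = σ.1 ⟨C.π p, p.2.1⟩ := by
  refine ⟨C.ncard_weierstrass, fun ε hε => ⟨⟨hyperellipticDescent h hε⟩, fun D => ⟨D.detIso hε hE,
    fun p => D.finrank_direction hε p.2, fun p => D.finrank_eigendirection hε p,
    D.positiveElmIso hε, D.positiveElmIso_toSections hε⟩⟩⟩
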